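/- Let $n,r,s:\mathbb N\to\mathbb N$ with $n(k)\to\infty$ (for instance $n$ any length function, $k^{1/c}\le n(k)\le k^c$) and $1\le s(k)\le 2^{n(k)/5}$ for all but finitely many $k$, and suppose that $r(k)<\frac{n(k)}{1000\log_2 s(k)}$ (that is, $1000\,r(k)\log_2 s(k)<n(k)$) for infinitely many $k$. Then there is no non-uniform, security-parameter-restricted, fully black-box construction $(g,A)$ of a pseudorandom generator from a regular one-way function with security $s$ in which $g(k,\cdot)$ makes at most $r(k)$ calls to its oracle. Here such a construction consists of two oracle algorithms with the following properties. (i) For every $k$, with oracle access to $f_k:\{0,1\}^{n(k)}\to\{0,1\}^{n(k)}$ only, $g$ computes a function $g_k^{(f)}:\{0,1\}^{m(k)}\to\{0,1\}^{m'(k)}$, where $m'(k)>m(k)$. (ii) The randomized security reduction $A$, on security parameter $k$, an advice string $h_k\in\{0,1\}^{s(k)}$ and an input $y\in\{0,1\}^{n(k)}$, makes at most $s(k)$ calls in total to the oracles $B_k:\{0,1\}^{m'(k)}\to\{0,1\}$ and $f_k$ (and calls no others). (iii) For every family $f=\{f_k\}$ of regular functions (for each $k$ all nonempty fibres of $f_k$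 have the same size) and every oracle $B=\{B_k\}$ such that $$\Pr_{v\leftarrow\{0,1\}^{m(k)}}[B_k(g_k^{(f)}(v))=1]-\Pr_{w\leftarrow\{0,1\}^{m'(k)}}[B_k(w)=1]\ \ge\ \tfrac1{100}\quad\text{for infinitely many }k,$$ there are advice strings $h_k\in\{0,1\}^{s(k)}$ such that $$\Pr_{x\leftarrow\{0,1\}^{n(k)},\,A}\bigl[f_k\bigl(A^{(B,f)}(k,h_k,f_k(x))\bigr)=f_k(x)\bigr]\ >\ \frac1{s(k)}\quad\text{for infinitely many }k.$$ No bound on the running time of $g$ or $A$ is assumed beyond the stated bounds on the number of calls; in particular constructions in which $g$ runs in polynomial time are excluded. -/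

import Mathlib

open Filter

/-- Bit strings of length `n`. -/
abbrev Bits (n : ℕ) : Type := Fin n → Bool

/-- A deterministic adaptive oracle algorithm with output in `α`, described by its query behaviour:
it either stops with an output, or asks a question `q : Q` and continues depending on the reply in
`R q`. Local computation between queries is neither restricted nor counted. -/
inductive OracleAlg (Q : Type) (R : Q → Type) (α : Type) : Type
  | ret (a : α) : OracleAlg Q R α
  | ask (q : Q) (next : R q → OracleAlg Q R α) : OracleAlg Q R α

namespace OracleAlg

variable {Q : Type} {R : Q → Type} {α : Type}

/-- The output of the algorithm when its questions are answered by `O`. -/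
def run (O : (q : Q) → R q) : OracleAlg Q R α → α
  | ret a => a
  | ask q next => run O (next (O q))

/-- The number of oracle calls made when the questions are answered by `O`
(repeated questions are counted each time). -/
def calls (O : (q : Q) → R q) : OracleAlg Q R α → ℕ
  | ret _ => 0
  | ask q next => calls O (next (O q)) + 1

end OracleAlg

/-- The probability of the event `E` under the discrete distribution `p`. -/
noncomputable def prob {α : Type} (p : PMF α) (E : α → Prop) : ℝ :=
  (p.toOuterMeasure {a | E a}).toReal

/-- A function on bit strings is regular if all its nonempty fibres have the same size. -/
def IsRegularFun {n : ℕ} (f : Bits n → Bits n) : Prop :=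
  ∀ x₁ x₂ : Bits n, Nat.card {x // f x = f x₁} = Nat.card {x // f x = f x₂}

/-- The construction part: for every security parameter `k` an oracle algorithm computing, from a
seed of length `m k` and with oracle access to `f k : {0,1}^(n k) → {0,1}^(n k)` only, a string of
length `m' k > m k`. No bound on running time (nor computability) is imposed, so that the efficient
constructions are a special case. -/
structure PRGConstruction (n : ℕ → ℕ) where
  /-- seed length -/
  m : ℕ → ℕ
  /-- output length -/
  m' : ℕ → ℕ
  expands : ∀ k, m k < m' k
  /-- the generator -/
  g : (k : ℕ) → Bits (m k) → OracleAlg (Bits (n k)) (fun _ => Bits (n k)) (Bits (m' k))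

/-- Replies of the pair of oracles (breaker, function): the breaker is asked strings of length `l`
and answers with a bit, the function is asked strings of length `n` and answers with strings of
length `n`. -/
def Reply (l n : ℕ) : Bits l ⊕ Bits n → Type
  | Sum.inl _ => Bool
  | Sum.inr _ => Bits n

/-- The pair of oracles `(B, f)` as a single oracle. -/
def pairOracle {l n : ℕ} (B : Bits l → Bool) (f : Bits n → Bits n) :
    (q : Bits l ⊕ Bits n) → Reply l n q
  | Sum.inl w => B w
  | Sum.inr x => f x

/-- The security-reduction part: a randomized oracle algorithm which, on security parameter `k`,
random coins, advice of length `s k` and the string of length `n k` to be inverted, has access to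
the breaker `B k` (on strings of length `l k`) and to `f k` only, and outputs a candidate preimage.
The coins may have any discrete distribution. -/
structure Reduction (n s l : ℕ → ℕ) where
  Coins : ℕ → Type
  coins : (k : ℕ) → PMF (Coins k)
  A : (k : ℕ) → Coins k → Bits (s k) → Bits (n k) →
    OracleAlg (Bits (l k) ⊕ Bits (n k)) (Reply (l k) (n k)) (Bits (n k))

/-- The distinguishing advantage `Pr_v[B (g v) = 1] - Pr_w[B w = 1]` of `B` at security parameter
`k`, for uniform `v ∈ {0,1}^(m k)` and `w ∈ {0,1}^(m' k)`, when `g` is run with oracle `f`. -/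
noncomputable def PRGConstruction.advantage {n : ℕ → ℕ} (G : PRGConstruction n) (k : ℕ)
    (f : Bits (n k) → Bits (n k)) (B : Bits (G.m' k) → Bool) : ℝ :=
  prob (PMF.uniformOfFintype (Bits (G.m k))) (fun v => B ((G.g k v).run f) = true) -
    prob (PMF.uniformOfFintype (Bits (G.m' k))) (fun w => B w = true)

/-- The probability, over uniform `x ∈ {0,1}^(n k)` and independent coins, that the reduction with
oracles `(B, f)` and advice `h` finds a preimage of `f x` under `f`. -/
noncomputable def Reduction.invProb {n s l : ℕ → ℕ} (A : Reduction n s l) (k : ℕ)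
    (f : Bits (n k) → Bits (n k)) (B : Bits (l k) → Bool) (h : Bits (s k)) : ℝ :=
  prob ((PMF.uniformOfFintype (Bits (n k))).bind fun x => (A.coins k).map fun ω => (x, ω))
    (fun p => f ((A.A k p.2 h (f p.1)).run (pairOracle B f)) = f p.1)

/-- `(G, A)` is a non-uniform, security-parameter-restricted, fully black-box construction of a
pseudorandom generator from a regular one-way function with security `s`: the reduction makes at
most `s k` oracle calls, and whenever `B` distinguishes the output of `G` run with a regular `f`
from uniform with advantage at least `1/100` for infinitely many `k`, the reduction inverts `f k`
with probability greater than `1 / s k` for infinitely many `k`, given suitable advice. -/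
def IsNonuniformFBB {n : ℕ → ℕ} (s : ℕ → ℕ) (G : PRGConstruction n)
    (A : Reduction n s G.m') : Prop :=
  (∀ (k : ℕ) (ω : A.Coins k) (h : Bits (s k)) (y : Bits (n k)) (B : Bits (G.m' k) → Bool)
      (f : Bits (n k) → Bits (n k)), (A.A k ω h y).calls (pairOracle B f) ≤ s k) ∧
  ∀ f : (k : ℕ) → Bits (n k) → Bits (n k), (∀ k, IsRegularFun (f k)) →
    ∀ B : (k : ℕ) → Bits (G.m' k) → Bool,
      (∃ᶠ k in atTop, 1 / 100 ≤ G.advantage k (f k) (B k)) →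
        ∃ h : (k : ℕ) → Bits (s k),
          ∃ᶠ k in atTop, 1 / (s k : ℝ) < A.invProb k (f k) (B k) (h k)

set_option linter.unusedSectionVars false

/-! Different security parameters do not interact, so it suffices to find, for each large `k`, a
regular `f` and a breaker `B` for which no advice lets the reduction invert with probability above
`1 / s`, and for which `B` has advantage at least 1/100 whenever `1000 r log s < n`.

Inversion. The functions are `x ↦ lab (π (P x))` with `P` balanced and `π` a random permutation of a
set `Ω`; `B` accepts `w` if one of the partial functions (witnesses) attached to `w` is part of `f`.
Such a breaker can help to invert `y` only through queries that are rejected while `y` is hidden,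
although placing `y` at any of many positions would complete a witness (`Risky`). A run without such
queries interacts with few labels. Successful runs are collected in chains, in which no label is met
by an older run. A permutation that is inverted noticeably often has many chains of length `q`, but
a chain is shared by at most `(card Ω)! / q!` permutations (`Chain.unique`). So the inverted
permutations have density about `2 ^ (-16 s)`, small enough for a union bound over the advice
(`card_mul_pow_le`, `sum_invert_le`).

Breakers with few risky queries. If `2 ^ n` is large compared to `2 ^ (2 s)`, the replies of any
breaker can be guessed (`exists_perm_forall_invProb_le`); if `r = 0`, the range of the generator
does not depend on `f`. Otherwise let `L` be `s` rounded up to a power of two, so that `n ≤ 8 L` and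
`L ^ (500 r) ≤ 2 ^ n`. Transcripts are classified by `refWeight`, which measures how many
transcripts with the same output overlap with a given one, and by a threshold `θ`.

If seeds with a heavy transcript are rare for random permutations, `B` accepts the outputs of light
transcripts contained in `f`. Lightness bounds the expected number of transcripts that lack only the
label `y`, even conditionally on part of `f`, and a moment of order `4 s` makes risky queries
extremely unlikely (`card_risky_light_le`).

If heavy seeds are frequent, they stay frequent for random functions with an image of size only `L ^
10`, because these extend any given transcript at least half as often (`numExt_le_sum_extends`). Now
`B` is random as well: each part of each transcript becomes a witness with a probability given by
the weights of the missing pairs. Heavy outputs are then accepted with probability at least 1/2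
while few strings are accepted altogether. Removing the label `y` from a witness costs only a factor
`b`, so a string with many witnesses that lack only `y` almost surely has one that does not involve
`y` (`sum_risky_planted_le`). -/

theorem Finset.sum_biUnion_le_sum {ι β : Type*} [DecidableEq ι] [DecidableEq β] (s : Finset ι) (T : ι → Finset β)
    (w : β → ℝ) (hw : ∀ b, 0 ≤ w b) : ∑ b ∈ s.biUnion T, w b ≤ ∑ i ∈ s, ∑ b ∈ T i, w b := by
  induction s using Finset.induction_on with
  | empty => simp
  | insert a s ha ih =>
    rw [Finset.biUnion_insert, Finset.sum_insert ha]
    have := Finset.sum_union_inter (s₁ := T a) (s₂ := s.biUnion T) (f := w)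
    have h2 : 0 ≤ ∑ b ∈ T a ∩ s.biUnion T, w b := Finset.sum_nonneg fun b _ => hw b
    linarith

/-! ### Query trees: reachable questions, hardwired replies, transcripts -/

namespace OracleAlg

section Queries
variable {Q : Type} {R : Q → Type} {α : Type}

/-- The questions asked along the run. -/
def queries (O : (q : Q) → R q) : OracleAlg Q R α → List Q
  | ret _ => []
  | ask q next => q :: queries O (next (O q))

theorem length_queries (O : (q : Q) → R q) (t : OracleAlg Q R α) :
    (t.queries O).length = t.calls O := by
  induction t with
  | ret a => rfl
  | ask q next ih => simp [queries, calls, ih]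

/-- An algorithm sees its oracle only through the replies to its own questions. Agreement along the
run with `O` is enough, since the two runs never diverge. -/
theorem run_queries_congr {O O' : (q : Q) → R q} (t : OracleAlg Q R α)
    (h : ∀ q ∈ t.queries O, O q = O' q) :
    t.run O' = t.run O ∧ t.queries O' = t.queries O := by
  induction t with
  | ret a => exact ⟨rfl, rfl⟩
  | ask q next ih =>
    have hq : O q = O' q := h q (by simp [queries])
    have := ih (O q) (fun q' hq' => h q' (by simp [queries, hq']))
    simp only [run, queries, ← hq]
    exact ⟨this.1, by rw [this.2]⟩

open Classical in
/-- The questions that can be reached within `k` steps under arbitrary replies. -/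
noncomputable def reach [∀ q, Fintype (R q)] : OracleAlg Q R α → ℕ → Finset Q
  | ret _, _ => ∅
  | ask _ _, 0 => ∅
  | ask q next, k + 1 => insert q (Finset.univ.biUnion fun a => reach (next a) k)

theorem card_reach_le [∀ q, Fintype (R q)] {b : ℕ} (hb : ∀ q, Fintype.card (R q) ≤ b)
    (t : OracleAlg Q R α) (k : ℕ) : (t.reach k).card ≤ (b + 1) ^ k := by
  classical
  induction t generalizing k with
  | ret a => simp [reach]
  | ask q next ih =>
    cases k with
    | zero => simp [reach]
    | succ k =>
      have h1 : (Finset.univ.biUnion fun a => reach (next a) k).card ≤ b * (b + 1) ^ k := by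
        refine Finset.card_biUnion_le.trans ?_
        refine (Finset.sum_le_card_nsmul _ _ _ (fun a _ => ih a k)).trans ?_
        simpa using hb q
      have h2 : 1 ≤ (b + 1) ^ k := Nat.one_le_pow _ _ (Nat.succ_pos _)
      simp only [reach]
      refine (Finset.card_insert_le _ _).trans ?_
      rw [pow_succ]
      nlinarith

theorem mem_reach_of_mem_queries [∀ q, Fintype (R q)] (O : (q : Q) → R q)
    (t : OracleAlg Q R α) (k : ℕ) (hk : t.calls O ≤ k) {q : Q} (hq : q ∈ t.queries O) :
    q ∈ t.reach k := by
  classical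
  induction t generalizing k with
  | ret a => simp [queries] at hq
  | ask q' next ih =>
    cases k with
    | zero => simp [calls] at hk
    | succ k =>
      simp only [queries, List.mem_cons] at hq
      simp only [calls, Nat.add_le_add_iff_right] at hk
      simp only [reach, Finset.mem_insert, Finset.mem_biUnion, Finset.mem_univ, true_and]
      rcases hq with h | h
      · exact Or.inl h
      · exact Or.inr ⟨_, ih _ k hk h⟩

end Queries

section Hardwire
variable {l n : ℕ} {α : Type}

/-- Replace the replies of the breaker by the bits `β`, and stop after `k` steps. -/
def hardwire (d : α) (β : ℕ → Bool) : OracleAlg (Bits l ⊕ Bits n) (Reply l n) α → ℕ →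
    OracleAlg (Bits l ⊕ Bits n) (Reply l n) α
  | ret a, _ => ret a
  | ask _ _, 0 => ret d
  | ask (Sum.inl _) next, k + 1 => hardwire d β (next (β k)) k
  | ask (Sum.inr x) next, k + 1 => ask (Sum.inr x) fun a => hardwire d β (next a) k

theorem calls_hardwire_le (d : α) (β : ℕ → Bool)
    (O : (q : Bits l ⊕ Bits n) → Reply l n q)
    (t : OracleAlg (Bits l ⊕ Bits n) (Reply l n) α) (k : ℕ) :
    (hardwire d β t k).calls O ≤ k := by
  induction t generalizing k with
  | ret a => simp [hardwire, calls]
  | ask q next ih =>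
    cases k with
    | zero => simp [hardwire, calls]
    | succ k =>
      cases q with
      | inl w => exact (ih _ k).trans (Nat.le_succ k)
      | inr x => exact Nat.succ_le_succ (ih _ k)

/-- The guessed bits are indexed by the number of remaining steps, so the first reply uses the
largest index and the later ones are untouched by it. Only the bits below `k` matter, hence `2 ^ k`
guesses suffice. -/
theorem exists_run_hardwire (d : α) (B B' : Bits l → Bool) (f : Bits n → Bits n)
    (t : OracleAlg (Bits l ⊕ Bits n) (Reply l n) α) (k : ℕ)
    (hk : t.calls (pairOracle B f) ≤ k) :
    ∃ β : ℕ → Bool, ∀ β' : ℕ → Bool, (∀ i < k, β' i = β i) →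
      (hardwire d β' t k).run (pairOracle B' f) = t.run (pairOracle B f) := by
  induction t generalizing k with
  | ret a => exact ⟨fun _ => false, fun _ _ => by simp [hardwire, run]⟩
  | ask q next ih =>
    cases k with
    | zero => simp [calls] at hk
    | succ k =>
      simp only [calls, Nat.add_le_add_iff_right] at hk
      obtain ⟨β, hβ⟩ := ih _ k hk
      cases q with
      | inl w =>
        refine ⟨Function.update β k (B w), fun β' h' => ?_⟩
        have h1 : β' k = B w := by simpa using h' k (Nat.lt_succ_self k)
        have h2 := hβ β' fun i hi => by
          have := h' i (hi.trans (Nat.lt_succ_self k))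
          rwa [Function.update_of_ne hi.ne] at this
        simp only [hardwire, run, h1]
        exact h2
      | inr x =>
        refine ⟨β, fun β' h' => ?_⟩
        have h2 := hβ β' fun i hi => h' i (hi.trans (Nat.lt_succ_self k))
        simp only [hardwire, run]
        exact h2

end Hardwire

section Leaves
open scoped Classical
variable {X α : Type}

/-- A finite partial injection. -/
def IsMatching (W : Finset (X × X)) : Prop :=
  (∀ p ∈ W, ∀ p' ∈ W, p.1 = p'.1 → p = p') ∧ ∀ p ∈ W, ∀ p' ∈ W, p.2 = p'.2 → p = p'

/-- The function `f` extends `W`. -/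
def Extends (f : X → X) (W : Finset (X × X)) : Prop := ∀ p ∈ W, f p.1 = p.2

theorem Extends.mono {f : X → X} {W W' : Finset (X × X)} (h : Extends f W') (hW : W ⊆ W') :
    Extends f W := fun p hp => h p (hW hp)

theorem isMatching_insert {W : Finset (X × X)} (hW : IsMatching W) {x z : X}
    (hx : ∀ z', (x, z') ∉ W) (hz : ∀ x', (x', z) ∉ W) : IsMatching (insert (x, z) W) := by
  constructor
  · intro p hp p' hp' e
    rcases Finset.mem_insert.1 hp with rfl | hp <;> rcases Finset.mem_insert.1 hp' with rfl | hp'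
    · rfl
    · exact absurd (show (x, p'.2) ∈ W by rw [show x = p'.1 from e]; exact hp') (hx _)
    · exact absurd (show (x, p.2) ∈ W by rw [show x = p.1 from e.symm]; exact hp) (hx _)
    · exact hW.1 p hp p' hp' e
  · intro p hp p' hp' e
    rcases Finset.mem_insert.1 hp with rfl | hp <;> rcases Finset.mem_insert.1 hp' with rfl | hp'
    · rfl
    · exact absurd (show (p'.1, z) ∈ W by rw [show z = p'.2 from e]; exact hp') (hz _)
    · exact absurd (show (p.1, z) ∈ W by rw [show z = p.2 from e.symm]; exact hp) (hz _)
    · exact hW.2 p hp p' hp' e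

theorem exists_extends {W : Finset (X × X)} (hW : IsMatching W) : ∃ f : X → X, Extends f W := by
  refine ⟨fun x => if h : ∃ z, (x, z) ∈ W then h.choose else x, fun p hp => ?_⟩
  have h : ∃ z, (p.1, z) ∈ W := ⟨p.2, hp⟩
  simp only [dif_pos h]
  exact congrArg Prod.snd (hW.1 _ h.choose_spec _ hp rfl)

theorem isMatching_empty : IsMatching (∅ : Finset (X × X)) := by simp [IsMatching]

variable [Fintype X]

/-- The pairs (transcript, output) of the runs that extend the transcript `W`, repeat no question and
receive pairwise distinct replies. -/
noncomputable def leaves : OracleAlg X (fun _ => X) α → Finset (X × X) →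
    Finset (Finset (X × X) × α)
  | ret a, W => {(W, a)}
  | ask x next, W =>
    if h : ∃ z, (x, z) ∈ W then leaves (next h.choose) W
    else (Finset.univ.filter fun z => ∀ x', (x', z) ∉ W).biUnion fun z =>
      leaves (next z) (insert (x, z) W)

theorem leaves_ask_of_mem {x : X} (next : X → OracleAlg X (fun _ => X) α) {W : Finset (X × X)}
    (h : ∃ z, (x, z) ∈ W) :
    ∃ z, (x, z) ∈ W ∧ (ask x next).leaves W = (next z).leaves W :=
  ⟨h.choose, h.choose_spec, by simp only [leaves]; rw [dif_pos h]⟩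

theorem leaves_ask_of_notMem {x : X} (next : X → OracleAlg X (fun _ => X) α)
    {W : Finset (X × X)} (h : ∀ z, (x, z) ∉ W) :
    (ask x next).leaves W = (Finset.univ.filter fun z => ∀ x', (x', z) ∉ W).biUnion fun z =>
      leaves (next z) (insert (x, z) W) := by
  simp only [leaves]; rw [dif_neg (not_exists.2 h)]

theorem leaves_ask_cases {x : X} {next : X → OracleAlg X (fun _ => X) α} {W : Finset (X × X)}
    {L : Finset (X × X) × α} (hL : L ∈ (ask x next).leaves W) :
    (∃ z, (x, z) ∈ W ∧ L ∈ (next z).leaves W) ∨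
    ((∀ z, (x, z) ∉ W) ∧ ∃ z, (∀ x', (x', z) ∉ W) ∧ L ∈ leaves (next z) (insert (x, z) W)) := by
  by_cases h : ∃ z, (x, z) ∈ W
  · obtain ⟨z, hz, e⟩ := leaves_ask_of_mem next h
    exact Or.inl ⟨z, hz, e ▸ hL⟩
  · rw [leaves_ask_of_notMem next (not_exists.1 h)] at hL
    simp only [Finset.mem_biUnion, Finset.mem_filter, Finset.mem_univ, true_and] at hL
    exact Or.inr ⟨not_exists.1 h, hL⟩

theorem leaves_subset_isMatching (t : OracleAlg X (fun _ => X) α) {W : Finset (X × X)}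
    (hW : IsMatching W) {L : Finset (X × X) × α} (hL : L ∈ t.leaves W) :
    W ⊆ L.1 ∧ IsMatching L.1 := by
  induction t generalizing W with
  | ret a => simp only [leaves, Finset.mem_singleton] at hL; subst hL; exact ⟨subset_rfl, hW⟩
  | ask x next ih =>
    rcases leaves_ask_cases hL with ⟨z, _, h⟩ | ⟨hx, z, hz, h⟩
    · exact ih _ hW h
    · have := ih z (isMatching_insert hW hx hz) h
      exact ⟨(Finset.subset_insert _ _).trans this.1, this.2⟩

theorem leaves_run_calls (t : OracleAlg X (fun _ => X) α) {W : Finset (X × X)}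
    {L : Finset (X × X) × α} (hL : L ∈ t.leaves W) (hW : IsMatching W) {f : X → X}
    (hf : Extends f L.1) : L.2 = t.run f ∧ L.1.card ≤ W.card + t.calls f := by
  induction t generalizing W with
  | ret a =>
    simp only [leaves, Finset.mem_singleton] at hL; subst hL; exact ⟨rfl, by simp⟩
  | ask x next ih =>
    have hWL := (leaves_subset_isMatching _ hW hL).1
    rcases leaves_ask_cases hL with ⟨z, hz, h⟩ | ⟨hx, z, hz, h⟩
    · have e : f x = z := hf _ (hWL hz)
      have := ih z h hW
      simp only [run, calls, e]
      exact ⟨this.1, this.2.trans (by omega)⟩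
    · have hm := isMatching_insert hW hx hz
      have e : f x = z := hf _ ((leaves_subset_isMatching _ hm h).1 (Finset.mem_insert_self _ _))
      have := ih z h hm
      simp only [run, calls, e]
      exact ⟨this.1, this.2.trans (by have := Finset.card_insert_le (x, z) W; omega)⟩

theorem card_le_of_mem_leaves (t : OracleAlg X (fun _ => X) α) {r : ℕ}
    (hr : ∀ f, t.calls f ≤ r) {L : Finset (X × X) × α} (hL : L ∈ t.leaves ∅) :
    L.1.card ≤ r := by
  obtain ⟨f, hf⟩ := exists_extends (leaves_subset_isMatching t isMatching_empty hL).2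
  simpa using (leaves_run_calls t hL isMatching_empty hf).2.trans
    (Nat.add_le_add_left (hr f) _)

/-- The branches missing from `leaves` are those in which a reply repeats; an injective `f` never
takes them. -/
theorem exists_mem_leaves (t : OracleAlg X (fun _ => X) α) {f : X → X}
    (hf : Function.Injective f) {W : Finset (X × X)} (hW : Extends f W) :
    ∃ V, (V, t.run f) ∈ t.leaves W ∧ Extends f V := by
  induction t generalizing W with
  | ret a => exact ⟨W, by simp [leaves, run], hW⟩
  | ask x next ih =>
    by_cases h : ∃ z, (x, z) ∈ W
    · obtain ⟨z, hz, e⟩ := leaves_ask_of_mem next h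
      rw [e]
      have e' : f x = z := hW _ hz
      simpa only [run, e'] using ih z hW
    · push Not at h
      have hW' : Extends f (insert (x, f x) W) := by
        intro p hp
        rcases Finset.mem_insert.1 hp with rfl | hp
        · rfl
        · exact hW p hp
      obtain ⟨V, hV, hfV⟩ := ih (f x) hW'
      refine ⟨V, ?_, hfV⟩
      rw [leaves_ask_of_notMem next h]
      simp only [Finset.mem_biUnion, Finset.mem_filter, Finset.mem_univ, true_and]
      refine ⟨f x, fun x' hx' => ?_, hV⟩
      have : x' = x := hf (hW _ hx')
      subst this
      exact h _ hx'

/-- Two distinct leaves part at some question, to which they record different replies, and `f` gives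
only one. -/
theorem leaves_unique (t : OracleAlg X (fun _ => X) α) {f : X → X} {W : Finset (X × X)}
    (hW : IsMatching W) {L L' : Finset (X × X) × α} (hL : L ∈ t.leaves W)
    (hL' : L' ∈ t.leaves W) (hf : Extends f L.1) (hf' : Extends f L'.1) : L = L' := by
  induction t generalizing W with
  | ret a =>
    simp only [leaves, Finset.mem_singleton] at hL hL'; rw [hL, hL']
  | ask x next ih =>
    by_cases h : ∃ z, (x, z) ∈ W
    · obtain ⟨z, hz, e⟩ := leaves_ask_of_mem next h
      rw [e] at hL hL'
      exact ih z hW hL hL'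
    · push Not at h
      rw [leaves_ask_of_notMem next h] at hL hL'
      simp only [Finset.mem_biUnion, Finset.mem_filter, Finset.mem_univ, true_and] at hL hL'
      obtain ⟨z, hz, hL⟩ := hL
      obtain ⟨z', hz', hL'⟩ := hL'
      have e : f x = z :=
        hf _ ((leaves_subset_isMatching _ (isMatching_insert hW h hz) hL).1
          (Finset.mem_insert_self _ _))
      have e' : f x = z' :=
        hf' _ ((leaves_subset_isMatching _ (isMatching_insert hW h hz') hL').1
          (Finset.mem_insert_self _ _))
      obtain rfl : z = z' := e.symm.trans e'
      exact ih z (isMatching_insert hW h hz) hL hL'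

/-- A Kraft inequality: the branches below a new question have total weight at most `R`, and a leaf
has at most `d` new questions above it. -/
theorem sum_leaves_prod_le {ρ : X × X → ℝ} (hρ : ∀ p, 0 ≤ ρ p) {R : ℝ} (hR : 0 ≤ R)
    (hsum : ∀ x, ∑ z, ρ (x, z) ≤ R) (hR1 : 1 ≤ R) (t : OracleAlg X (fun _ => X) α)
    {W : Finset (X × X)} (hW : IsMatching W) {d : ℕ}
    (hd : ∀ L ∈ t.leaves W, L.1.card ≤ W.card + d) :
    ∑ L ∈ t.leaves W, ∏ p ∈ L.1, ρ p ≤ R ^ d * ∏ p ∈ W, ρ p := by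
  have hprod : ∀ V : Finset (X × X), 0 ≤ ∏ p ∈ V, ρ p := fun V =>
    Finset.prod_nonneg fun p _ => hρ p
  induction t generalizing W d with
  | ret a =>
    simp only [leaves, Finset.sum_singleton]
    exact le_mul_of_one_le_left (hprod _) (one_le_pow₀ hR1)
  | ask x next ih =>
    by_cases h : ∃ z, (x, z) ∈ W
    · obtain ⟨z, hz, e⟩ := leaves_ask_of_mem next h
      rw [e] at hd ⊢
      exact ih z hW hd
    · push Not at h
      rw [leaves_ask_of_notMem next h] at hd ⊢
      simp only [Finset.mem_biUnion, Finset.mem_filter, Finset.mem_univ, true_and] at hd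
      have hcard : ∀ z, (insert (x, z) W).card = W.card + 1 := fun z =>
        Finset.card_insert_of_notMem (h z)
      refine (Finset.sum_biUnion_le_sum _ _ _ fun L : Finset (X × X) × α => hprod L.1).trans ?_
      -- For `d = 0` there is no leaf below a new question, since it would contain a pair too many.
      -- The vanishing factor records this and makes the truncated `d - 1` harmless.
      have key : ∀ z ∈ Finset.univ.filter fun z => ∀ x', (x', z) ∉ W,
          ∑ L ∈ leaves (next z) (insert (x, z) W), ∏ p ∈ L.1, ρ p ≤
            (R ^ (d - 1) * ∏ p ∈ W, ρ p) * (if d = 0 then 0 else ρ (x, z)) := by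
        intro z hz
        simp only [Finset.mem_filter, Finset.mem_univ, true_and] at hz
        have hm := isMatching_insert hW h hz
        rcases Nat.eq_zero_or_pos d with rfl | hd0
        · refine le_of_eq ?_
          simp only [if_true, mul_zero]
          refine Finset.sum_eq_zero fun L hL => ?_
          have h1 := hd L ⟨z, hz, hL⟩
          have h2 := Finset.card_le_card (leaves_subset_isMatching _ hm hL).1
          rw [hcard] at h2
          omega
        · have := ih z hm (d := d - 1) fun L hL => by
            have := hd L ⟨z, hz, hL⟩
            rw [hcard]
            omega
          rw [Finset.prod_insert (h z)] at this
          rw [if_neg hd0.ne']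
          linarith
      refine (Finset.sum_le_sum key).trans ?_
      rw [← Finset.mul_sum]
      rcases Nat.eq_zero_or_pos d with rfl | hd0
      · simpa using hprod W
      · simp only [if_neg hd0.ne']
        have h1 : ∑ z ∈ Finset.univ.filter (fun z => ∀ x', (x', z) ∉ W), ρ (x, z) ≤ R :=
          (Finset.sum_le_sum_of_subset_of_nonneg (Finset.filter_subset _ _)
            fun z _ _ => hρ _).trans (hsum x)
        obtain ⟨d, rfl⟩ : ∃ e, d = e + 1 := ⟨d - 1, by omega⟩
        have h2 : 0 ≤ R ^ d * ∏ p ∈ W, ρ p := mul_nonneg (pow_nonneg hR _) (hprod W)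
        calc _ ≤ (R ^ d * ∏ p ∈ W, ρ p) * R := mul_le_mul_of_nonneg_left h1 h2
          _ = _ := by ring

end Leaves
end OracleAlg

/-! ### Discrete probability and double counting of chains -/

section Prob
open scoped Classical
variable {U : Type}

theorem prob_eq_tsum (μ : PMF U) (E : U → Prop) :
    prob μ E = ∑' u, if E u then (μ u).toReal else 0 := by
  rw [prob, PMF.toOuterMeasure_apply, ENNReal.tsum_toReal_eq]
  · refine tsum_congr fun u => ?_
    by_cases h : E u <;> simp [Set.indicator, h]
  · intro u
    by_cases h : E u <;> simp [Set.indicator, h, PMF.apply_ne_top]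

theorem hasSum_toReal (μ : PMF U) : HasSum (fun u => (μ u).toReal) 1 := by
  have h := ENNReal.hasSum_toReal (f := μ) (by rw [PMF.tsum_coe]; exact ENNReal.one_ne_top)
  rw [← ENNReal.tsum_toReal_eq fun u => PMF.apply_ne_top μ u] at h
  simpa [PMF.tsum_coe] using h

theorem toOuterMeasure_ne_top (μ : PMF U) (S : Set U) : μ.toOuterMeasure S ≠ ⊤ := by
  refine ne_top_of_le_ne_top ENNReal.one_ne_top ?_
  rw [PMF.toOuterMeasure_apply, ← PMF.tsum_coe μ]
  exact ENNReal.tsum_le_tsum fun u => Set.indicator_le_self _ _ _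

theorem prob_nonneg (μ : PMF U) (E : U → Prop) : 0 ≤ prob μ E := ENNReal.toReal_nonneg

theorem prob_mono {μ : PMF U} {E F : U → Prop} (h : ∀ u, E u → F u) : prob μ E ≤ prob μ F :=
  ENNReal.toReal_mono (toOuterMeasure_ne_top _ _) (μ.toOuterMeasure.mono h)

theorem prob_or_le (μ : PMF U) (E F : U → Prop) :
    prob μ (fun u => E u ∨ F u) ≤ prob μ E + prob μ F := by
  rw [prob, prob, prob, ← ENNReal.toReal_add (toOuterMeasure_ne_top _ _) (toOuterMeasure_ne_top _ _)]
  exact ENNReal.toReal_mono (ENNReal.add_ne_top.2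
    ⟨toOuterMeasure_ne_top _ _, toOuterMeasure_ne_top _ _⟩)
    (MeasureTheory.measure_union_le (μ := μ.toOuterMeasure) {u | E u} {u | F u})

theorem prob_le_one (μ : PMF U) (E : U → Prop) : prob μ E ≤ 1 := by
  rw [prob_eq_tsum, ← (hasSum_toReal μ).tsum_eq]
  refine Summable.tsum_le_tsum (fun u => ?_) ?_ (hasSum_toReal μ).summable
  · split_ifs <;> simp
  · refine Summable.of_nonneg_of_le (fun u => ?_) (fun u => ?_) (hasSum_toReal μ).summable
    · split_ifs <;> simp
    · split_ifs <;> simp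

theorem prob_exists_le {ι : Type*} (s : Finset ι) (μ : PMF U) (E : ι → U → Prop) :
    prob μ (fun u => ∃ i ∈ s, E i u) ≤ ∑ i ∈ s, prob μ (E i) := by
  induction s using Finset.induction_on with
  | empty => simp [prob]
  | insert a s ha ih =>
    rw [Finset.sum_insert ha]
    refine le_trans (prob_mono (F := fun u => E a u ∨ ∃ i ∈ s, E i u) fun u hu => ?_)
      ((prob_or_le _ _ _).trans (add_le_add le_rfl ih))
    obtain ⟨i, hi, hE⟩ := hu
    rcases Finset.mem_insert.1 hi with rfl | hi
    · exact Or.inl hE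
    · exact Or.inr ⟨i, hi, hE⟩

/-- Exchange of a finite weighted sum with a probability, bounded pointwise. -/
theorem sum_mul_prob_le {ι : Type*} (s : Finset ι) (μ : PMF U) (R : ι → U → Prop) (w : ι → ℝ)
    {M : ℝ} (h : ∀ u, ∑ i ∈ s, (if R i u then w i else 0) ≤ M) :
    ∑ i ∈ s, w i * prob μ (R i) ≤ M := by
  have hs : ∀ i, Summable fun u => if R i u then (μ u).toReal else 0 := fun i => by
    refine Summable.of_nonneg_of_le (fun u => ?_) (fun u => ?_) (hasSum_toReal μ).summable
    · split_ifs <;> simp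
    · split_ifs <;> simp
  have h1 : ∑ i ∈ s, w i * prob μ (R i) =
      ∑' u, ∑ i ∈ s, w i * (if R i u then (μ u).toReal else 0) := by
    rw [Summable.tsum_finsetSum fun i _ => (hs i).mul_left _]
    refine Finset.sum_congr rfl fun i _ => ?_
    rw [prob_eq_tsum, tsum_mul_left]
  have h2 : HasSum (fun u => M * (μ u).toReal) M := by
    simpa using (hasSum_toReal μ).mul_left M
  rw [h1, ← h2.tsum_eq]
  refine Summable.tsum_le_tsum (fun u => ?_) (summable_sum fun i _ => (hs i).mul_left _)
    h2.summable
  refine le_trans (le_of_eq ?_) (mul_le_mul_of_nonneg_right (h u) ENNReal.toReal_nonneg)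
  rw [Finset.sum_mul]
  refine Finset.sum_congr rfl fun i _ => ?_
  split_ifs <;> simp

theorem prob_uniform_bind {X V : Type} [Fintype X] [Nonempty X] (κ : X → PMF V) (E : V → Prop) :
    prob ((PMF.uniformOfFintype X).bind κ) E = (∑ x, prob (κ x) E) / Fintype.card X := by
  rw [prob, PMF.toOuterMeasure_bind_apply, tsum_fintype, ENNReal.toReal_sum, Finset.sum_div]
  · refine Finset.sum_congr rfl fun x _ => ?_
    rw [ENNReal.toReal_mul, PMF.uniformOfFintype_apply, ENNReal.toReal_inv, ENNReal.toReal_natCast,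
      prob]
    ring
  · intro x _
    exact ENNReal.mul_ne_top (PMF.apply_ne_top _ _) (toOuterMeasure_ne_top _ _)

theorem prob_map {V W : Type} (μ : PMF V) (f : V → W) (E : W → Prop) :
    prob (μ.map f) E = prob μ (fun v => E (f v)) := by
  rw [prob, PMF.toOuterMeasure_map_apply]; rfl

theorem prob_uniform {X : Type} [Fintype X] [Nonempty X] (E : X → Prop)
    [DecidablePred E] : prob (PMF.uniformOfFintype X) E = (Finset.univ.filter E).card / Fintype.card X := by
  rw [prob, PMF.toOuterMeasure_uniformOfFintype_apply, ENNReal.toReal_div, ENNReal.toReal_natCast,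
    ENNReal.toReal_natCast, Fintype.card_subtype]
  congr!

/-- If every member of `S` extends chains with probability at least `c`, and no chain of length `q`
is shared by more than `M` members, then `S` is small. -/
theorem card_mul_pow_le_of_chain {ι : Type*} (S : Finset ι) (μ : PMF U)
    (chain : ι → List U → Prop) (q : ℕ) {c M : ℝ} (hc : 0 ≤ c)
    (hnil : ∀ π, chain π [])
    (hstep : ∀ π ∈ S, ∀ L : List U, L.length < q → chain π L →
      c ≤ prob μ fun u => chain π (u :: L))
    (hM : ∀ L : List U, L.length = q → ((S.filter fun π => chain π L).card : ℝ) ≤ M) :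
    (S.card : ℝ) * c ^ q ≤ M := by
  -- Induction on the number `j` of missing entries: averaging over the next entry `u` costs one
  -- factor `c`.
  have key : ∀ j ≤ q, ∀ L : List U, L.length + j = q →
      ((S.filter fun π => chain π L).card : ℝ) * c ^ j ≤ M := by
    intro j
    induction j with
    | zero => intro _ L hL; simpa using hM L (by simpa using hL)
    | succ j ih =>
      intro hj L hL
      have h1 : ∀ u, ∑ π ∈ S.filter (fun π => chain π L),
          (if chain π (u :: L) then c ^ j else 0) ≤ M := by
        intro u
        refine le_trans ?_ (ih (by omega) (u :: L) (by simp; omega))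
        rw [← Finset.sum_filter, Finset.sum_const, nsmul_eq_mul]
        refine mul_le_mul_of_nonneg_right ?_ (pow_nonneg hc _)
        exact_mod_cast Finset.card_le_card fun π hπ => by
          simp only [Finset.mem_filter] at hπ ⊢
          exact ⟨hπ.1.1, hπ.2⟩
      refine le_trans ?_ (sum_mul_prob_le _ μ (fun π u => chain π (u :: L)) (fun _ => c ^ j) h1)
      rw [← nsmul_eq_mul, pow_succ, ← Finset.sum_const]
      refine Finset.sum_le_sum fun π hπ => mul_le_mul_of_nonneg_left ?_ (pow_nonneg hc _)
      simp only [Finset.mem_filter] at hπ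
      exact hstep π hπ.1 L (by omega) hπ.2
  simpa [hnil] using key q le_rfl [] (by simp)

end Prob

/-! ### Witness systems and oracles with erased labels -/

/-- A permutation `π` of `Ω` gives the function `x ↦ lab (π (P x))` on bit strings, together with
the breaker accepting `w` if one of the transcripts in `wit w` is part of this function. -/
structure WitnessSystem (n l : ℕ) (Ω : Type) where
  P : Bits n → Ω
  lab : Ω → Bits n
  lab_injective : Function.Injective lab
  wit : Bits l → Set (Finset (Bits n × Bits n))

namespace WitnessSystem
open scoped Classical
variable {n l : ℕ} {Ω : Type} [DecidableEq Ω] (S : WitnessSystem n l Ω)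

def fn (π : Equiv.Perm Ω) (x : Bits n) : Bits n := S.lab (π (S.P x))

/-- Some witness of `w` is part of the function and avoids the labels in `T`. -/
def Holds (π : Equiv.Perm Ω) (T : Set Ω) (w : Bits l) : Prop :=
  ∃ K ∈ S.wit w, ∀ p ∈ K, S.lab (π (S.P p.1)) = p.2 ∧ π (S.P p.1) ∉ T

/-- The breaker. -/
noncomputable def breaker (π : Equiv.Perm Ω) (w : Bits l) : Bool := decide (S.Holds π ∅ w)

/-- The oracles from which all information about the labels in `T` is erased. -/
noncomputable def orc (π : Equiv.Perm Ω) (T : Set Ω) : (q : Bits l ⊕ Bits n) → Reply l n q :=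
  pairOracle (fun w => decide (S.Holds π T w))
    fun x => if π (S.P x) ∈ T then fun _ => false else S.lab (π (S.P x))

theorem orc_empty (π : Equiv.Perm Ω) : S.orc π ∅ = pairOracle (S.breaker π) (S.fn π) := by
  simp only [orc, Set.mem_empty_iff_false, if_false]
  rfl

theorem orc_inl_congr {S : WitnessSystem n l Ω} {π π' : Equiv.Perm Ω} {T T' : Set Ω} {w : Bits l}
    (h : S.Holds π T w ↔ S.Holds π' T' w) :
    S.orc π T (Sum.inl w) = S.orc π' T' (Sum.inl w) :=
  decide_eq_decide.2 h

theorem orc_inr_congr {S : WitnessSystem n l Ω} {π π' : Equiv.Perm Ω} {T T' : Set Ω} {x : Bits n}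
    (h : π (S.P x) ∈ T ↔ π' (S.P x) ∈ T') (h' : π (S.P x) ∉ T → π (S.P x) = π' (S.P x)) :
    S.orc π T (Sum.inr x) = S.orc π' T' (Sum.inr x) := by
  change (if π (S.P x) ∈ T then fun _ => false else S.lab (π (S.P x)) : Bits n) =
    if π' (S.P x) ∈ T' then fun _ => false else S.lab (π' (S.P x))
  by_cases hT : π (S.P x) ∈ T
  · rw [if_pos hT, if_pos (h.1 hT)]
  · rw [if_neg hT, if_neg (mt h.2 hT), h' hT]

theorem Holds.mono {S : WitnessSystem n l Ω} {π : Equiv.Perm Ω} {T T' : Set Ω} {w : Bits l}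
    (h : S.Holds π T' w) (hT : T ⊆ T') : S.Holds π T w := by
  obtain ⟨K, hK, h⟩ := h
  exact ⟨K, hK, fun p hp => ⟨(h p hp).1, fun h' => (h p hp).2 (hT h')⟩⟩

/-- The labels on a chosen witness. -/
noncomputable def witLabels (π : Equiv.Perm Ω) (T : Set Ω) (w : Bits l) : Finset Ω :=
  if h : S.Holds π T w then h.choose.image fun p => π (S.P p.1) else ∅

theorem Holds.exists_witLabels {S : WitnessSystem n l Ω} {π : Equiv.Perm Ω} {T : Set Ω}
    {w : Bits l} (h : S.Holds π T w) :
    ∃ K ∈ S.wit w, ∀ p ∈ K, S.lab (π (S.P p.1)) = p.2 ∧ π (S.P p.1) ∉ T ∧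
      π (S.P p.1) ∈ S.witLabels π T w := by
  refine ⟨h.choose, h.choose_spec.1, fun p hp => ⟨(h.choose_spec.2 p hp).1,
    (h.choose_spec.2 p hp).2, ?_⟩⟩
  rw [witLabels, dif_pos h]
  exact Finset.mem_image_of_mem _ hp

theorem card_witLabels_le {r : ℕ} (hr : ∀ w, ∀ K ∈ S.wit w, K.card ≤ r) (π : Equiv.Perm Ω)
    (T : Set Ω) (w : Bits l) : (S.witLabels π T w).card ≤ r := by
  rw [witLabels]
  split_ifs with h
  · exact Finset.card_image_le.trans (hr w _ h.choose_spec.1)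
  · simp

variable [Fintype Ω]

/-- The positions at which the label `y` would complete a witness of `w`. -/
noncomputable def critical (π : Equiv.Perm Ω) (y : Ω) (w : Bits l) : Finset Ω :=
  Finset.univ.filter fun a => ∃ K ∈ S.wit w, ∀ p ∈ K,
    (p.2 = S.lab y ∧ S.P p.1 = a) ∨ (p.2 ≠ S.lab y ∧ S.lab (π (S.P p.1)) = p.2)

/-! ### Concentration of the inversion probability by chains -/

section Algorithm
variable {U : Type} (Y : U → Ω)
  (t : U → OracleAlg (Bits l ⊕ Bits n) (Reply l n) (Bits n))

def Succeeds (π : Equiv.Perm Ω) (u : U) : Prop := π (S.P ((t u).run (S.orc π ∅))) = Y u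

/-- A breaker query with too many critical positions is made. -/
def Bad (D : ℕ) (π : Equiv.Perm Ω) (u : U) : Prop :=
  ∃ w, Sum.inl w ∈ (t u).queries (S.orc π {Y u}) ∧ ¬ S.Holds π {Y u} w ∧
    D < (S.critical π (Y u) w).card

/-- The labels with which a query interacts. -/
noncomputable def touched (π : Equiv.Perm Ω) (y : Ω) : Bits l ⊕ Bits n → Finset Ω
  | Sum.inl w => S.witLabels π {y} w ∪ S.witLabels π ∅ w ∪
      if S.Holds π {y} w then ∅ else (S.critical π y w).image π
  | Sum.inr x => {π (S.P x)}

/-- The labels with which the run on input `Y u`, performed without information about `Y u`,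
interacts. -/
noncomputable def forbidden (π : Equiv.Perm Ω) (u : U) : Finset Ω :=
  {Y u, π (S.P ((t u).run (S.orc π {Y u})))} ∪
    ((t u).queries (S.orc π {Y u})).toFinset.biUnion (S.touched π (Y u))

/-- Two labels come from the input and the output. A breaker query adds two witnesses of at most `r`
labels and, as the run is not bad, at most `D` critical labels; a function query adds one label. -/
theorem card_forbidden_le {r s D : ℕ} (hr : ∀ w, ∀ K ∈ S.wit w, K.card ≤ r)
    {π : Equiv.Perm Ω} {u : U} (hs : (t u).calls (S.orc π {Y u}) ≤ s)
    (hbad : ¬ S.Bad Y t D π u) : (S.forbidden Y t π u).card ≤ 2 + s * (2 * r + D + 1) := by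
  refine (Finset.card_union_le _ _).trans (add_le_add Finset.card_le_two ?_)
  refine (Finset.card_biUnion_le_card_mul _ _ (2 * r + D + 1) fun q hq => ?_).trans
    (Nat.mul_le_mul_right _ ((List.toFinset_card_le _).trans ?_))
  · cases q with
    | inr x => simp [touched]
    | inl w =>
      simp only [touched]
      refine (Finset.card_union_le _ _).trans ?_
      have h1 := Finset.card_union_le (S.witLabels π {Y u} w) (S.witLabels π ∅ w)
      have h2 := S.card_witLabels_le hr π {Y u} w
      have h3 := S.card_witLabels_le hr π ∅ w
      have h4 : (if S.Holds π {Y u} w then ∅ else (S.critical π (Y u) w).image π).card ≤ D := by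
        split_ifs with h
        · simp
        · refine Finset.card_image_le.trans ?_
          by_contra hD
          exact hbad ⟨w, List.mem_toFinset.1 hq, h, not_le.1 hD⟩
      omega
  · rw [OracleAlg.length_queries]; exact hs

/-- The newest entry comes first. Each run succeeds, and no run interacts with a newer label. -/
def Chain (D : ℕ) (π : Equiv.Perm Ω) : List U → Prop
  | [] => True
  | u :: L => S.Succeeds Y t π u ∧ ¬ S.Bad Y t D π u ∧
      (∀ u' ∈ L, Y u ∉ S.forbidden Y t π u') ∧ Chain D π L

variable {S Y t}

theorem Chain.of_append {D : ℕ} {π : Equiv.Perm Ω} {L₁ L₂ : List U}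
    (h : S.Chain Y t D π (L₁ ++ L₂)) :
    S.Chain Y t D π L₂ ∧ ∀ u ∈ L₁, ∀ u' ∈ L₂, Y u ∉ S.forbidden Y t π u' := by
  induction L₁ with
  | nil => exact ⟨h, by simp⟩
  | cons v L₁ ih =>
    obtain ⟨_, _, h3, h4⟩ := h
    obtain ⟨h5, h6⟩ := ih h4
    refine ⟨h5, fun u hu u' hu' => ?_⟩
    rcases List.mem_cons.1 hu with rfl | hu
    · exact h3 u' (List.mem_append_right _ hu')
    · exact h6 u hu u' hu'

/-- Each label is forbidden for its own run, so it cannot return as a newer entry. -/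
theorem Chain.nodup {D : ℕ} {π : Equiv.Perm Ω} {L : List U} (h : S.Chain Y t D π L) :
    (L.map Y).Nodup := by
  induction L with
  | nil => simp
  | cons u L ih =>
    obtain ⟨_, _, h3, h4⟩ := h
    rw [List.map_cons, List.nodup_cons]
    refine ⟨fun hu => ?_, ih h4⟩
    obtain ⟨u', hu', e⟩ := List.mem_map.1 hu
    refine h3 u' hu' ?_
    simp [forbidden, e]

/-- The run without information about `Y u` is not affected by erasing labels it does not
interact with. -/
theorem run_orc_eq {π : Equiv.Perm Ω} {u : U} {T : Set Ω} (hu : Y u ∈ T)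
    (hT : ∀ b ∈ T, b ≠ Y u → b ∉ S.forbidden Y t π u) :
    (∀ q ∈ (t u).queries (S.orc π {Y u}), S.orc π {Y u} q = S.orc π T q) ∧
    (∀ w, Sum.inl w ∈ (t u).queries (S.orc π {Y u}) → (S.Holds π {Y u} w ↔ S.Holds π T w)) := by
  have h2 : ∀ w, Sum.inl w ∈ (t u).queries (S.orc π {Y u}) →
      (S.Holds π {Y u} w ↔ S.Holds π T w) := by
    intro w hw
    refine ⟨fun h => ?_, fun h => h.mono (by simpa using hu)⟩
    obtain ⟨K, hK, h'⟩ := h.exists_witLabels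
    refine ⟨K, hK, fun p hp => ⟨(h' p hp).1, fun hpT => ?_⟩⟩
    refine hT _ hpT (fun e => (h' p hp).2.1 e) ?_
    refine Finset.mem_union_right _ (Finset.mem_biUnion.2 ⟨_, List.mem_toFinset.2 hw, ?_⟩)
    simp only [touched, Finset.mem_union]
    exact Or.inl (Or.inl (h' p hp).2.2)
  refine ⟨fun q hq => ?_, h2⟩
  cases q with
  | inl w => exact orc_inl_congr (h2 w hq)
  | inr x =>
    have : π (S.P x) ∈ T ↔ π (S.P x) ∈ ({Y u} : Set Ω) := by
      refine ⟨fun h => ?_, fun h => by rw [Set.mem_singleton_iff.1 h]; exact hu⟩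
      by_contra hne
      refine hT _ h hne ?_
      refine Finset.mem_union_right _ (Finset.mem_biUnion.2 ⟨_, List.mem_toFinset.2 hq, ?_⟩)
      simp [touched]
    exact orc_inr_congr this.symm fun _ => rfl

/-- Since `σ` fixes the complement of `T` pointwise, it maps `T` to itself; it rearranges only
labels that have been erased. -/
theorem orc_mul_eq {π σ : Equiv.Perm Ω} {T : Set Ω} (hσ : ∀ b ∉ T, σ b = b) :
    S.orc (σ * π) T = S.orc π T ∧ ∀ w, S.Holds (σ * π) T w ↔ S.Holds π T w := by
  have hmem : ∀ b, σ b ∈ T ↔ b ∈ T := by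
    intro b
    by_cases hb : b ∈ T
    · refine ⟨fun _ => hb, fun _ => ?_⟩
      by_contra h
      exact h (by rwa [σ.injective (hσ _ h)])
    · rw [hσ b hb]
  have hH : ∀ w, S.Holds (σ * π) T w ↔ S.Holds π T w := by
    intro w
    refine exists_congr fun K => and_congr_right fun _ => forall₂_congr fun p _ => ?_
    simp only [Equiv.Perm.mul_apply, hmem]
    refine and_congr_left fun h => ?_
    rw [hσ _ h]
  refine ⟨?_, hH⟩
  funext q
  cases q with
  | inl w => exact orc_inl_congr (hH w)
  | inr x =>
    refine orc_inr_congr (hmem _) fun h => hσ _ fun h' => h ?_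
    exact (hmem _).2 h'

theorem _root_.List.exists_last_of_exists {β : Type*} (L : List β) (p : β → Prop)
    (h : ∃ u ∈ L, p u) : ∃ L₁ u L₂, L = L₁ ++ u :: L₂ ∧ p u ∧ ∀ u' ∈ L₂, ¬ p u' := by
  induction L with
  | nil => simp at h
  | cons v L ih =>
    by_cases h' : ∃ u ∈ L, p u
    · obtain ⟨L₁, u, L₂, e, h1, h2⟩ := ih h'
      exact ⟨v :: L₁, u, L₂, by simp [e], h1, h2⟩
    · obtain ⟨u, hu, hp⟩ := h
      rcases List.mem_cons.1 hu with rfl | hu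
      · exact ⟨[], u, L, rfl, hp, fun u' hu' hp' => h' ⟨u', hu', hp'⟩⟩
      · exact absurd ⟨u, hu, hp⟩ h'

/-- A chain determines the permutation up to the positions of its labels: no two permutations which
differ by a permutation of the labels have the same chain. -/
theorem Chain.unique {D : ℕ} {π σ : Equiv.Perm Ω} {L : List U} (h : S.Chain Y t D π L)
    (h' : S.Chain Y t D (σ * π) L) (hσ : ∀ b, (∀ u ∈ L, b ≠ Y u) → σ b = b) : σ = 1 := by
  by_contra hne
  obtain ⟨b, hb⟩ : ∃ b, σ b ≠ b := by
    by_contra hall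
    push Not at hall
    exact hne (Equiv.ext hall)
  -- `u` is the oldest entry whose label is moved by `σ`: the newest entry stands first in the list.
  obtain ⟨L₁, u, L₂, rfl, hu, hL₂⟩ := L.exists_last_of_exists (fun u => σ (Y u) ≠ Y u) (by
    by_contra hall
    push Not at hall
    refine hb (hσ b fun u hu e => hb ?_)
    rw [e]; exact hall u hu)
  simp only [not_not] at hL₂
  -- The labels of `u` and of all newer entries. Outside `T` the permutation `σ` is trivial, and
  -- within `T` the run on `u` may interact only with its own label.
  set T : Set Ω := {b | b = Y u ∨ ∃ v ∈ L₁, b = Y v} with hTdef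
  have huT : Y u ∈ T := Or.inl rfl
  have hσT : ∀ b ∉ T, σ b = b := by
    intro b hb
    by_cases hb2 : ∃ v ∈ L₂, b = Y v
    · obtain ⟨v, hv, rfl⟩ := hb2
      exact hL₂ v hv
    · refine hσ b fun v hv e => ?_
      rcases List.mem_append.1 hv with hv | hv
      · exact hb (Or.inr ⟨v, hv, e⟩)
      · rcases List.mem_cons.1 hv with rfl | hv
        · exact hb (Or.inl e)
        · exact hb2 ⟨v, hv, e⟩
  have newer : ∀ {ρ : Equiv.Perm Ω}, S.Chain Y t D ρ (L₁ ++ u :: L₂) →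
      ∀ b ∈ T, b ≠ Y u → b ∉ S.forbidden Y t ρ u := by
    intro ρ hρ b hb hbu
    rcases hb with hb | ⟨v, hv, rfl⟩
    · exact absurd hb hbu
    · exact hρ.of_append.2 v hv u List.mem_cons_self
  -- Erasing all of `T` instead of `Y u` alone changes neither blind run, and with `T` erased the
  -- oracles of `π` and `σ * π` are equal. Hence the two blind runs on `u` coincide.
  have r1 := run_orc_eq huT (newer h)
  have r2 := run_orc_eq huT (newer h')
  obtain ⟨o1, o2⟩ := orc_mul_eq (S := S) (π := π) hσT
  have e1 := OracleAlg.run_queries_congr (t u) r1.1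
  have e2 := OracleAlg.run_queries_congr (t u) r2.1
  rw [o1] at e2
  have erun : (t u).run (S.orc (σ * π) {Y u}) = (t u).run (S.orc π {Y u}) :=
    e2.1.symm.trans e1.1
  have equer : (t u).queries (S.orc (σ * π) {Y u}) = (t u).queries (S.orc π {Y u}) :=
    e2.2.symm.trans e1.2
  -- A position that receives `Y u` under `σ * π` carries a newer label under `π`, and the run on
  -- `u` under `π` is not allowed to meet it.
  have hsymm : ∀ {a}, σ (π a) = Y u → π a ∈ T ∧ π a ≠ Y u := by
    intro a ha
    refine ⟨?_, fun e => hu (by rw [← e, ha, e])⟩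
    by_contra hT
    rw [hσT _ hT] at ha
    exact hT (ha ▸ huT)
  have clash : ∀ {a}, σ (π a) = Y u → π a ∉ S.forbidden Y t π u := fun ha =>
    newer h _ (hsymm ha).1 (hsymm ha).2
  -- Under `σ * π` the blind run is the true run: a query that reveals `Y u` would under `π`
  -- interact with a newer label.
  have agree : ∀ q ∈ (t u).queries (S.orc (σ * π) {Y u}),
      S.orc (σ * π) {Y u} q = S.orc (σ * π) ∅ q := by
    intro q hq
    have hq' := hq
    rw [equer] at hq'
    cases q with
    | inr x =>
      have : (σ * π) (S.P x) ≠ Y u := fun hx => clash (a := S.P x) hx <| by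
        refine Finset.mem_union_right _ (Finset.mem_biUnion.2 ⟨_, List.mem_toFinset.2 hq', ?_⟩)
        simp [touched]
      exact orc_inr_congr (by simpa using this) fun _ => rfl
    | inl w =>
      have : S.Holds (σ * π) {Y u} w ↔ S.Holds (σ * π) ∅ w := by
        refine ⟨fun hw => hw.mono (Set.empty_subset _), fun hw => ?_⟩
        by_contra hw'
        have hnot : ¬ S.Holds π {Y u} w := by
          rw [r1.2 w hq', ← o2 w, ← r2.2 w hq]
          exact hw'
        obtain ⟨K, hK, hKp⟩ := hw.exists_witLabels
        obtain ⟨p, hp, hpy⟩ : ∃ p ∈ K, (σ * π) (S.P p.1) = Y u := by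
          by_contra hall
          push Not at hall
          exact hw' ⟨K, hK, fun p hp => ⟨(hKp p hp).1, hall p hp⟩⟩
        -- The other pairs of the witness have labels met by the run under `σ * π`, hence outside
        -- `T`, where `π` and `σ * π` agree. So under `π` the witness lacks only `Y u`, and the
        -- position is critical.
        have hcrit : S.P p.1 ∈ S.critical π (Y u) w := by
          simp only [critical, Finset.mem_filter, Finset.mem_univ, true_and]
          refine ⟨K, hK, fun p' hp' => ?_⟩
          by_cases e : p'.2 = S.lab (Y u)
          · refine Or.inl ⟨e, (σ * π).injective ?_⟩
            rw [hpy]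
            exact S.lab_injective ((hKp p' hp').1.trans e)
          · refine Or.inr ⟨e, ?_⟩
            have hlab := (hKp p' hp').1
            have hne' : (σ * π) (S.P p'.1) ≠ Y u := fun e' => e (by rw [← hlab, e'])
            have hforb : (σ * π) (S.P p'.1) ∈ S.forbidden Y t (σ * π) u := by
              refine Finset.mem_union_right _
                (Finset.mem_biUnion.2 ⟨_, List.mem_toFinset.2 hq, ?_⟩)
              simp only [touched, Finset.mem_union]
              exact Or.inl (Or.inr (hKp p' hp').2.2)
            have hnT : (σ * π) (S.P p'.1) ∉ T := fun hT => newer h' _ hT hne' hforb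
            have : σ (π (S.P p'.1)) = π (S.P p'.1) := σ.injective (hσT _ hnT)
            rw [Equiv.Perm.mul_apply, this] at hlab
            exact hlab
        refine clash (a := S.P p.1) hpy ?_
        refine Finset.mem_union_right _ (Finset.mem_biUnion.2 ⟨_, List.mem_toFinset.2 hq', ?_⟩)
        simp only [touched, if_neg hnot, Finset.mem_union]
        exact Or.inr (Finset.mem_image_of_mem _ hcrit)
      exact orc_inl_congr this
  -- The blind run thus outputs a position to which `σ * π` gives `Y u`; its label under `π` belongs
  -- to the forbidden set.
  have hsucc : S.Succeeds Y t (σ * π) u := h'.of_append.1.1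
  rw [Succeeds, (OracleAlg.run_queries_congr (t u) agree).1, erun] at hsucc
  refine clash (a := S.P ((t u).run (S.orc π {Y u}))) hsucc ?_
  simp [forbidden]

/-- Composing the permutations that share a chain with arbitrary permutations of its labels never
produces the same permutation twice, by `Chain.unique`. The labels are distinct, which gives the
factorial. -/
theorem card_chain_mul_factorial_le (D : ℕ) (L : List U) :
    ((Finset.univ.filter fun π : Equiv.Perm Ω => S.Chain Y t D π L).card : ℝ) *
      (L.length.factorial : ℝ) ≤ ((Fintype.card Ω).factorial : ℝ) := by
  by_cases hex : ∃ π, S.Chain Y t D π L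
  · obtain ⟨π₀, hπ₀⟩ := hex
    set F : Finset Ω := (L.map Y).toFinset with hF
    have hcard : F.card = L.length := by
      rw [hF, List.toFinset_card_of_nodup hπ₀.nodup, List.length_map]
    have hinj : Function.Injective
        (fun x : {π : Equiv.Perm Ω // S.Chain Y t D π L} × Equiv.Perm {a // a ∈ F} =>
          (Equiv.Perm.ofSubtype x.2 : Equiv.Perm Ω) * x.1.1) := by
      rintro ⟨⟨π, hπ⟩, τ⟩ ⟨⟨π', hπ'⟩, τ'⟩ e
      simp only at e
      have e' : π' = Equiv.Perm.ofSubtype (τ'⁻¹ * τ) * π := by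
        rw [map_mul, mul_assoc, e, ← mul_assoc, ← map_mul, inv_mul_cancel, map_one, one_mul]
      have h1 : (Equiv.Perm.ofSubtype (τ'⁻¹ * τ) : Equiv.Perm Ω) = 1 := by
        refine Chain.unique hπ (e' ▸ hπ') fun b hb => ?_
        refine Equiv.Perm.ofSubtype_apply_of_not_mem _ fun hbF => ?_
        rw [hF, List.mem_toFinset, List.mem_map] at hbF
        obtain ⟨u, hu, rfl⟩ := hbF
        exact hb u hu rfl
      have h2 : τ'⁻¹ * τ = 1 := Equiv.Perm.ofSubtype_injective (by rw [h1, map_one])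
      have h3 : τ = τ' := (inv_mul_eq_one.1 h2).symm
      have h4 : π' = π := by rw [e', h1, one_mul]
      subst h3; subst h4; rfl
    have := Fintype.card_le_of_injective _ hinj
    rw [Fintype.card_prod, Fintype.card_perm, Fintype.card_perm, Fintype.card_coe, hcard,
      Fintype.card_subtype] at this
    exact_mod_cast this
  · push Not at hex
    simp [hex]

variable (S Y t)

/-- Concentration: few permutations allow the algorithm to invert with noticeable probability. -/
theorem card_mul_pow_le [Nonempty Ω] (μ : PMF U)
    (hμ : ∀ F : Finset Ω, prob μ (fun u => Y u ∈ F) ≤ (F.card : ℝ) / Fintype.card Ω)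
    {r s D q : ℕ} (hr : ∀ w, ∀ K ∈ S.wit w, K.card ≤ r)
    (hs : ∀ u π y, (t u).calls (S.orc π {y}) ≤ s) {c : ℝ} (hc : 0 ≤ c)
    (hq : (q : ℝ) * (2 + s * (2 * r + D + 1)) ≤ c / 4 * Fintype.card Ω) :
    ((Finset.univ.filter fun π : Equiv.Perm Ω =>
        c < prob μ (S.Succeeds Y t π) ∧ prob μ (S.Bad Y t D π) ≤ c / 4).card : ℝ) * (c / 2) ^ q ≤
      ((Fintype.card Ω).factorial : ℝ) / (q.factorial : ℝ) := by
  have hN : (0 : ℝ) < Fintype.card Ω := by exact_mod_cast Fintype.card_pos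
  refine card_mul_pow_le_of_chain _ μ (fun π L => S.Chain Y t D π L) q (by positivity)
    (fun _ => trivial) ?_ ?_
  · intro π hπ L hL hchain
    simp only [Finset.mem_filter, Finset.mem_univ, true_and] at hπ
    set F : Finset Ω := L.toFinset.biUnion (S.forbidden Y t π) with hF
    have hnb : ∀ u ∈ L, ¬ S.Bad Y t D π u := by
      clear hL hF F
      induction L with
      | nil => simp
      | cons v L ih =>
        intro u hu
        rcases List.mem_cons.1 hu with rfl | hu
        · exact hchain.2.1
        · exact ih hchain.2.2.2 u hu
    have hFc : F.card ≤ q * (2 + s * (2 * r + D + 1)) := by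
      refine (Finset.card_biUnion_le_card_mul _ _ _ fun u hu =>
        S.card_forbidden_le Y t hr (hs u π _) (hnb u (List.mem_toFinset.1 hu))).trans ?_
      exact Nat.mul_le_mul_right _ ((List.toFinset_card_le _).trans hL.le)
    have h1 : prob μ (fun u => Y u ∈ F) ≤ c / 4 := by
      refine (hμ F).trans ?_
      rw [div_le_iff₀ hN]
      refine le_trans ?_ hq
      exact_mod_cast hFc
    -- A success prolongs the chain unless the run is bad or its label was met before. Each
    -- exception costs at most `c / 4`, which leaves `c / 2`.
    have h2 : prob μ (S.Succeeds Y t π) ≤ prob μ (fun u => S.Chain Y t D π (u :: L)) +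
        (prob μ (S.Bad Y t D π) + prob μ fun u => Y u ∈ F) := by
      refine le_trans (prob_mono (F := fun u => S.Chain Y t D π (u :: L) ∨
        (S.Bad Y t D π u ∨ Y u ∈ F)) fun u hu => ?_)
        ((prob_or_le _ _ _).trans (add_le_add le_rfl (prob_or_le _ _ _)))
      by_cases hb : S.Bad Y t D π u
      · exact Or.inr (Or.inl hb)
      · by_cases huF : Y u ∈ F
        · exact Or.inr (Or.inr huF)
        · refine Or.inl ⟨hu, hb, fun u' hu' h' => huF ?_, hchain⟩
          exact Finset.mem_biUnion.2 ⟨u', List.mem_toFinset.2 hu', h'⟩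
    linarith [hπ.1, hπ.2]
  · intro L hL
    rw [le_div_iff₀ (by positivity), ← hL]
    refine le_trans (mul_le_mul_of_nonneg_right ?_ (by positivity))
      (card_chain_mul_factorial_le (S := S) (Y := Y) (t := t) D L)
    exact_mod_cast Finset.card_le_card fun π hπ => by
      simp only [Finset.mem_filter, Finset.mem_univ, true_and] at hπ ⊢
      exact hπ.2

end Algorithm
end WitnessSystem

/-- `q ^ q / q!` is a term of the series of `exp q`, which is at most `4 ^ q`. -/
theorem pow_div_factorial_le (q : ℕ) : ((q : ℝ) / 8) ^ q / q.factorial ≤ (1 / 2) ^ q := by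
  have h1 := Real.pow_div_factorial_le_exp (x := (q : ℝ)) (by positivity) q
  have h2 : Real.exp q ≤ 4 ^ q := by
    rw [← mul_one (q : ℝ), Real.exp_nat_mul]
    exact pow_le_pow_left₀ (Real.exp_pos _).le (Real.exp_one_lt_d9.le.trans (by norm_num)) _
  have h3 : ((q : ℝ) / 8) ^ q / q.factorial = (q : ℝ) ^ q / q.factorial * (1 / 8) ^ q := by
    rw [div_eq_mul_one_div (q : ℝ), mul_pow]; ring
  rw [h3]
  calc _ ≤ (4 : ℝ) ^ q * (1 / 8) ^ q :=
        mul_le_mul_of_nonneg_right (h1.trans h2) (by positivity)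
    _ = _ := by rw [← mul_pow]; norm_num

/-- The joint distribution of an independent uniform element and random coins. -/
noncomputable def uniformProd (Ω : Type) [Fintype Ω] [Nonempty Ω] {C : Type} (coins : PMF C) :
    PMF (Ω × C) :=
  (PMF.uniformOfFintype Ω).bind fun y => coins.map fun ω => (y, ω)

theorem prob_uniformProd {Ω : Type} [Fintype Ω] [Nonempty Ω] {C : Type} (coins : PMF C)
    (E : Ω × C → Prop) :
    prob (uniformProd Ω coins) E = (∑ y, prob coins fun ω => E (y, ω)) / Fintype.card Ω := by
  rw [uniformProd, prob_uniform_bind]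
  simp only [prob_map]

open Classical in
theorem prob_uniformProd_fst_mem {Ω : Type} [Fintype Ω] [Nonempty Ω] {C : Type} (coins : PMF C)
    (F : Finset Ω) :
    prob (uniformProd Ω coins) (fun u => u.1 ∈ F) ≤ (F.card : ℝ) / Fintype.card Ω := by
  rw [prob_uniformProd]
  refine div_le_div_of_nonneg_right ?_ (by positivity)
  calc ∑ y, prob coins (fun _ => y ∈ F) ≤ ∑ y, if y ∈ F then (1 : ℝ) else 0 := by
        refine Finset.sum_le_sum fun y _ => ?_
        split_ifs with h
        · exact prob_le_one _ _
        · simp [prob, h]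
    _ = F.card := by simp

/-! ### From concentration to inversion with advice -/

namespace WitnessSystem
open scoped Classical
variable {n l : ℕ} {Ω : Type} [DecidableEq Ω] (S : WitnessSystem n l Ω)

/-- The same functions with other witnesses. -/
def withWit (𝒲 : Bits l → Set (Finset (Bits n × Bits n))) : WitnessSystem n l Ω where
  P := S.P
  lab := S.lab
  lab_injective := S.lab_injective
  wit := 𝒲

variable [Fintype Ω]

/-- All fibres of the projection have the same size. -/
def Balanced : Prop := ∃ c : ℕ, ∀ y, (Finset.univ.filter fun x => S.P x = y).card = c

variable {S}

/-- `P` takes each value equally often, so `π (P x)` is uniform for uniform `x`. This allows the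
challenge to be drawn from `Ω` instead of as an image of the function. -/
theorem Balanced.sum_comp (hS : S.Balanced) (π : Equiv.Perm Ω) (G : Ω → ℝ) :
    (∑ x, G (π (S.P x))) / Fintype.card (Bits n) = (∑ y, G y) / Fintype.card Ω := by
  obtain ⟨c, hc⟩ := hS
  have h : ∀ H : Ω → ℝ, ∑ x, H (S.P x) = c * ∑ y, H y := by
    intro H
    rw [← Finset.sum_fiberwise (s := Finset.univ) (g := S.P) (f := fun x => H (S.P x)),
      Finset.mul_sum]
    refine Finset.sum_congr rfl fun y _ => ?_
    rw [← hc y, ← nsmul_eq_mul, ← Finset.sum_const]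
    refine Finset.sum_congr rfl fun x hx => ?_
    rw [(Finset.mem_filter.1 hx).2]
  have h1 := h fun _ => 1
  simp only [Finset.sum_const, Finset.card_univ, nsmul_eq_mul, mul_one] at h1
  have hX : (0 : ℝ) < Fintype.card (Bits n) := by exact_mod_cast Fintype.card_pos
  have hcΩ : (0 : ℝ) < c * Fintype.card Ω := h1 ▸ hX
  have hc0 : (c : ℝ) ≠ 0 := left_ne_zero_of_mul hcΩ.ne'
  rw [h fun a => G (π a), h1, Equiv.sum_comp π G, mul_div_mul_left _ _ hc0]

theorem Balanced.isRegularFun (hS : S.Balanced) (π : Equiv.Perm Ω) : IsRegularFun (S.fn π) := by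
  obtain ⟨c, hc⟩ := hS
  have h : ∀ x₀, Nat.card {x // S.fn π x = S.fn π x₀} = c := by
    intro x₀
    rw [← hc (S.P x₀), Nat.card_eq_fintype_card, Fintype.card_subtype]
    congr 1
    ext x
    simp only [Finset.mem_filter, Finset.mem_univ, true_and]
    exact ⟨fun h => π.injective (S.lab_injective h), fun h => by simp only [fn, h]⟩
  intro x₁ x₂
  rw [h, h]

/-- The probability that the algorithm `t` inverts the function. -/
noncomputable def invProb {C : Type} (coins : PMF C)
    (t : C → Bits n → OracleAlg (Bits l ⊕ Bits n) (Reply l n) (Bits n))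
    (f : Bits n → Bits n) (B : Bits l → Bool) : ℝ :=
  prob ((PMF.uniformOfFintype (Bits n)).bind fun x => coins.map fun ω => (x, ω))
    (fun p => f ((t p.2 (f p.1)).run (pairOracle B f)) = f p.1)

theorem Balanced.prob_succeeds [Nonempty Ω] (hS : S.Balanced) {C : Type} (coins : PMF C)
    (t : C → Bits n → OracleAlg (Bits l ⊕ Bits n) (Reply l n) (Bits n)) (π : Equiv.Perm Ω) :
    invProb coins t (S.fn π) (S.breaker π) =
      prob (uniformProd Ω coins) (S.Succeeds Prod.fst (fun u => t u.2 (S.lab u.1)) π) := by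
  rw [invProb, prob_uniform_bind, prob_uniformProd, ← hS.sum_comp π]
  simp only [prob_map]
  congr 1
  refine Finset.sum_congr rfl fun x _ => ?_
  refine congrArg _ (funext fun ω => propext ?_)
  simp only [Succeeds, orc_empty]
  exact ⟨fun h => S.lab_injective h, fun h => congrArg S.lab h⟩

variable (S)

/-- With `c = 1 / M`, chains of length `q = 16 * M` give `(2 / c) ^ q = (q / 8) ^ q`, which is below
`q!` by a factor `2 ^ q`. -/
theorem card_invert_le [Nonempty Ω] {C : Type} (coins : PMF C)
    (t : C → Bits n → OracleAlg (Bits l ⊕ Bits n) (Reply l n) (Bits n)) {r s D M : ℕ}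
    (hM : 1 ≤ M) (hr : ∀ w, ∀ K ∈ S.wit w, K.card ≤ r)
    (hs : ∀ ω y B f, (t ω y).calls (pairOracle B f) ≤ s)
    (hq : 64 * M ^ 2 * (2 + s * (2 * r + D + 1)) ≤ Fintype.card Ω) :
    ((Finset.univ.filter fun π : Equiv.Perm Ω =>
        1 / (M : ℝ) < prob (uniformProd Ω coins)
          (S.Succeeds Prod.fst (fun u => t u.2 (S.lab u.1)) π) ∧
        prob (uniformProd Ω coins) (S.Bad Prod.fst (fun u => t u.2 (S.lab u.1)) D π) ≤
          1 / (M : ℝ) / 4).card : ℝ) ≤ (Fintype.card Ω).factorial * (1 / 2) ^ (16 * M) := by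
  have hM0 : (0 : ℝ) < M := by exact_mod_cast hM
  have h := S.card_mul_pow_le Prod.fst (fun u : Ω × C => t u.2 (S.lab u.1))
    (uniformProd Ω coins) (prob_uniformProd_fst_mem coins) hr (s := s) (D := D) (q := 16 * M)
    (fun u π y => hs _ _ _ _) (c := 1 / (M : ℝ)) (by positivity) (by
      have : (64 * M ^ 2 * (2 + s * (2 * r + D + 1)) : ℝ) ≤ Fintype.card Ω := by exact_mod_cast hq
      push_cast
      calc (16 * M * (2 + s * (2 * r + D + 1)) : ℝ)
          = 1 / M / 4 * (64 * M ^ 2 * (2 + s * (2 * r + D + 1))) := by field_simp; ring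
        _ ≤ _ := mul_le_mul_of_nonneg_left this (by positivity))
  have h2 := pow_div_factorial_le (16 * M)
  set c : ℝ := 1 / M / 2
  have hc : 0 < c := by positivity
  have h3 : (((16 * M : ℕ) : ℝ) / 8) = c⁻¹ := by
    simp only [c]; push_cast; field_simp; norm_num
  rw [h3] at h2
  refine (le_div_iff₀ (pow_pos hc _)).2 h |>.trans ?_
  rw [div_div, mul_comm ((16 * M).factorial : ℝ), ← div_div, div_eq_mul_inv, div_eq_mul_inv]
  rw [inv_pow, div_eq_mul_inv] at h2
  rw [mul_assoc]
  exact mul_le_mul_of_nonneg_left h2 (by positivity)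

end WitnessSystem

instance {l n : ℕ} (q : Bits l ⊕ Bits n) : Fintype (Reply l n q) :=
  match q with
  | Sum.inl _ => inferInstanceAs (Fintype Bool)
  | Sum.inr _ => inferInstanceAs (Fintype (Bits n))

theorem card_bits (n : ℕ) : Fintype.card (Bits n) = 2 ^ n := by simp

theorem card_reply_le {l n : ℕ} (hn : 1 ≤ n) (q : Bits l ⊕ Bits n) :
    Fintype.card (Reply l n q) ≤ 2 ^ n := by
  cases q with
  | inl w =>
    change Fintype.card Bool ≤ 2 ^ n
    rw [Fintype.card_bool]
    exact Nat.le_self_pow (by omega) 2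
  | inr x => exact (card_bits n).le

namespace WitnessSystem
open scoped Classical
variable {n l : ℕ} {Ω : Type} [DecidableEq Ω] (S : WitnessSystem n l Ω) [Fintype Ω]

/-- With `y` unknown, the query `w` is not answered positively but has many critical positions. -/
def Risky (D : ℕ) (π : Equiv.Perm Ω) (y : Ω) (w : Bits l) : Prop :=
  ¬ S.Holds π {y} w ∧ D < (S.critical π y w).card

/-- Markov's inequality for a finite sum of probabilities. -/
theorem _root_.card_prob_lt_le {ι U : Type} [Fintype ι] (μ : PMF U) (E : ι → U → Prop) {c : ℝ}
    (hc : 0 < c) :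
    ((Finset.univ.filter fun i => c < prob μ (E i)).card : ℝ) ≤ c⁻¹ * ∑ i, prob μ (E i) := by
  rw [← div_eq_inv_mul, le_div_iff₀ hc, ← nsmul_eq_mul, ← Finset.sum_const]
  refine (Finset.sum_le_sum fun i hi => (Finset.mem_filter.1 hi).2.le).trans ?_
  exact Finset.sum_le_sum_of_subset_of_nonneg (Finset.filter_subset _ _)
    fun i _ _ => prob_nonneg _ _

theorem _root_.card_exists_le {ι H : Type} [Fintype ι] [Fintype H] (E : H → ι → Prop) :
    ((Finset.univ.filter fun i => ∃ h, E h i).card : ℝ) ≤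
      ∑ h, ((Finset.univ.filter fun i => E h i).card : ℝ) := by
  have : (Finset.univ.filter fun i => ∃ h, E h i) ⊆
      Finset.univ.biUnion fun h => Finset.univ.filter fun i => E h i := by
    intro i hi
    simp only [Finset.mem_filter, Finset.mem_univ, true_and, Finset.mem_biUnion] at hi ⊢
    exact hi
  exact_mod_cast (Finset.card_le_card this).trans Finset.card_biUnion_le

/-- `Risky` refers to a single query and not to the algorithm. Although queries are adaptive, a
union bound over all those reachable under arbitrary replies suffices; for each `u` there are at
most `(2 ^ n + 1) ^ s`. -/
theorem sum_bad_le [Nonempty Ω] {I : Type} [Fintype I] (wt : I → ℝ) (hwt : ∀ i, 0 ≤ wt i)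
    (𝒲 : I → Bits l → Set (Finset (Bits n × Bits n))) {U : Type} (μ : PMF U) (Y : U → Ω)
    (t : U → OracleAlg (Bits l ⊕ Bits n) (Reply l n) (Bits n)) {s D : ℕ} (hn : 1 ≤ n)
    (hs : ∀ u B f, (t u).calls (pairOracle B f) ≤ s) {β : ℝ}
    (hβ : ∀ y w, ∑ i, ∑ π, (if (S.withWit (𝒲 i)).Risky D π y w then wt i else 0) ≤ β)
    (hβ0 : 0 ≤ β) :
    ∑ i, wt i * ∑ π, prob μ ((S.withWit (𝒲 i)).Bad Y t D π) ≤ (2 ^ n + 1 : ℝ) ^ s * β := by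
  have h := sum_mul_prob_le (Finset.univ : Finset (I × Equiv.Perm Ω)) μ
    (fun j => (S.withWit (𝒲 j.1)).Bad Y t D j.2) (fun j => wt j.1)
    (M := (2 ^ n + 1 : ℝ) ^ s * β) ?_
  · rw [Fintype.sum_prod_type] at h
    simpa only [Finset.mul_sum] using h
  · intro u
    have h1 : ∀ j : I × Equiv.Perm Ω,
        (if (S.withWit (𝒲 j.1)).Bad Y t D j.2 u then wt j.1 else 0) ≤
          ∑ q ∈ (t u).reach s, if (∃ w, q = Sum.inl w ∧
            (S.withWit (𝒲 j.1)).Risky D j.2 (Y u) w) then wt j.1 else 0 := by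
      intro j
      have hnn : ∀ q ∈ (t u).reach s, 0 ≤ if (∃ w, q = Sum.inl w ∧
            (S.withWit (𝒲 j.1)).Risky D j.2 (Y u) w) then wt j.1 else 0 := fun q _ => by
        split_ifs
        · exact hwt _
        · exact le_rfl
      split_ifs with hb
      · obtain ⟨w, hw, hb⟩ := hb
        have hq := OracleAlg.mem_reach_of_mem_queries _ (t u) s (hs u _ _) hw
        refine le_trans ?_ (Finset.single_le_sum hnn hq)
        rw [if_pos ⟨w, rfl, hb⟩]
      · exact Finset.sum_nonneg hnn
    refine (Finset.sum_le_sum fun j _ => h1 j).trans ?_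
    rw [Finset.sum_comm]
    have h2 : ∀ q ∈ (t u).reach s, ∑ j : I × Equiv.Perm Ω, (if (∃ w, q = Sum.inl w ∧
            (S.withWit (𝒲 j.1)).Risky D j.2 (Y u) w) then wt j.1 else 0) ≤ β := by
      intro q _
      cases q with
      | inl w =>
        rw [Fintype.sum_prod_type]
        simpa using hβ (Y u) w
      | inr x => simpa using hβ0
    refine (Finset.sum_le_sum h2).trans ?_
    rw [Finset.sum_const, nsmul_eq_mul]
    refine mul_le_mul_of_nonneg_right ?_ hβ0
    exact_mod_cast OracleAlg.card_reach_le (fun q => card_reply_le hn q) (t u) s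

/-- In a random system in which risky queries are unlikely, inversion is unlikely. -/
theorem sum_invert_le [Nonempty Ω] (hS : S.Balanced) {I : Type} [Fintype I] (wt : I → ℝ)
    (hwt : ∀ i, 0 ≤ wt i) (𝒲 : I → Bits l → Set (Finset (Bits n × Bits n)))
    {C : Type} (coins : PMF C) {r s D : ℕ}
    (A : C → Bits s → Bits n → OracleAlg (Bits l ⊕ Bits n) (Reply l n) (Bits n))
    (hn : 1 ≤ n) (hs1 : 1 ≤ s)
    (hs : ∀ ω h y B f, (A ω h y).calls (pairOracle B f) ≤ s)
    (hr : ∀ i w, ∀ K ∈ 𝒲 i w, K.card ≤ r)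
    (hq : 64 * s ^ 2 * (2 + s * (2 * r + D + 1)) ≤ Fintype.card Ω) {β : ℝ}
    (hβ : ∀ y w, ∑ i, ∑ π, (if (S.withWit (𝒲 i)).Risky D π y w then wt i else 0) ≤ β)
    (hβ0 : 0 ≤ β) :
    ∑ i, wt i * ((Finset.univ.filter fun π : Equiv.Perm Ω => ∃ h : Bits s,
        1 / (s : ℝ) < invProb coins (fun ω => A ω h) ((S.withWit (𝒲 i)).fn π)
          ((S.withWit (𝒲 i)).breaker π)).card : ℝ) ≤
      2 ^ s * ((∑ i, wt i) * ((Fintype.card Ω).factorial * (1 / 2) ^ (16 * s)) +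
        4 * s * ((2 ^ n + 1 : ℝ) ^ s * β)) := by
  have hs0 : (0 : ℝ) < s := by exact_mod_cast hs1
  have key : ∀ i, ((Finset.univ.filter fun π : Equiv.Perm Ω => ∃ h : Bits s,
        1 / (s : ℝ) < invProb coins (fun ω => A ω h) ((S.withWit (𝒲 i)).fn π)
          ((S.withWit (𝒲 i)).breaker π)).card : ℝ) ≤
      ∑ h : Bits s, ((Fintype.card Ω).factorial * (1 / 2) ^ (16 * s) + 4 * s * ∑ π,
        prob (uniformProd Ω coins) ((S.withWit (𝒲 i)).Bad Prod.fst
          (fun u => A u.2 h (S.lab u.1)) D π)) := by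
    intro i
    -- For fixed advice, a permutation that is inverted either has bad runs with probability above
    -- `1 / (4 s)`, and Markov's inequality counts these, or it falls under the concentration bound.
    refine (card_exists_le _).trans (Finset.sum_le_sum fun h _ => ?_)
    have hSi : (S.withWit (𝒲 i)).Balanced := hS
    have h1 := (S.withWit (𝒲 i)).card_invert_le coins (fun ω => A ω h) hs1 (hr i)
      (fun ω => hs ω h) hq
    have h2 := card_prob_lt_le (uniformProd Ω coins) ((S.withWit (𝒲 i)).Bad Prod.fst
          (fun u => A u.2 h (S.lab u.1)) D) (c := 1 / (s : ℝ) / 4) (by positivity)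
    have h3 : (1 / (s : ℝ) / 4)⁻¹ = 4 * s := by field_simp
    rw [h3] at h2
    refine le_trans ?_ (add_le_add h1 h2)
    rw [← Nat.cast_add]
    refine Nat.cast_le.2 (le_trans (Finset.card_le_card fun π hπ => ?_) (Finset.card_union_le _ _))
    simp only [Finset.mem_filter, Finset.mem_univ, true_and, Finset.mem_union] at hπ ⊢
    rw [hSi.prob_succeeds] at hπ
    by_cases hb : 1 / (s : ℝ) / 4 < prob (uniformProd Ω coins) ((S.withWit (𝒲 i)).Bad Prod.fst
          (fun u => A u.2 h (S.lab u.1)) D π)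
    · exact Or.inr hb
    · exact Or.inl ⟨hπ, not_lt.1 hb⟩
  refine (Finset.sum_le_sum fun i _ => mul_le_mul_of_nonneg_left (key i) (hwt i)).trans ?_
  simp only [Finset.mul_sum (s := (Finset.univ : Finset (Bits s)))]
  rw [Finset.sum_comm]
  have h4 : ∀ h : Bits s, ∑ i, wt i * ((Fintype.card Ω).factorial * (1 / 2) ^ (16 * s) +
      4 * s * ∑ π, prob (uniformProd Ω coins)
        ((S.withWit (𝒲 i)).Bad Prod.fst (fun u => A u.2 h (S.lab u.1)) D π)) ≤
      (∑ i, wt i) * ((Fintype.card Ω).factorial * (1 / 2) ^ (16 * s)) +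
        4 * s * ((2 ^ n + 1 : ℝ) ^ s * β) := by
    intro h
    have := S.sum_bad_le wt hwt 𝒲 (uniformProd Ω coins) Prod.fst
      (fun u => A u.2 h (S.lab u.1)) hn (fun u => hs u.2 h _) hβ hβ0
    simp only [mul_add, Finset.sum_add_distrib, ← Finset.sum_mul]
    refine add_le_add le_rfl ?_
    calc _ = 4 * s * ∑ i, wt i * ∑ π, prob (uniformProd Ω coins)
          ((S.withWit (𝒲 i)).Bad Prod.fst (fun u => A u.2 h (S.lab u.1)) D π) := by
          rw [Finset.mul_sum]; exact Finset.sum_congr rfl fun i _ => by ring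
      _ ≤ _ := mul_le_mul_of_nonneg_left this (by positivity)
  refine (Finset.sum_le_sum fun h _ => h4 h).trans (le_of_eq ?_)
  simp only [Finset.sum_const, Finset.card_univ, card_bits, nsmul_eq_mul]
  push_cast; rfl

end WitnessSystem

/-! ### Advantage, and the cases in which the breaker is harmless -/

/-- The distinguishing advantage of `B` against the generator `g` with oracle `f`. -/
noncomputable def adv {n m l : ℕ} (g : Bits m → OracleAlg (Bits n) (fun _ => Bits n) (Bits l))
    (f : Bits n → Bits n) (B : Bits l → Bool) : ℝ :=
  prob (PMF.uniformOfFintype (Bits m)) (fun v => B ((g v).run f) = true) -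
    prob (PMF.uniformOfFintype (Bits l)) (fun w => B w = true)

/-- All outputs are accepted, and they make up at most `2 ^ m ≤ 2 ^ l / 2` strings. -/
theorem half_le_adv {n m l : ℕ} (hml : m < l)
    (g : Bits m → OracleAlg (Bits n) (fun _ => Bits n) (Bits l))
    (f : Bits n → Bits n) (B : Bits l → Bool) (hB : ∀ w, B w = true ↔ ∃ v, (g v).run f = w) :
    1 / 2 ≤ adv g f B := by
  classical
  rw [adv, prob_uniform, prob_uniform]
  have h1 : (Finset.univ.filter fun v => B ((g v).run f) = true) = Finset.univ := by
    ext v; simp [hB]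
  have h2 : (Finset.univ.filter fun w => B w = true).card ≤ 2 ^ m := by
    rw [← card_bits m, ← Finset.card_univ]
    refine le_trans (Finset.card_le_card (t := Finset.univ.image fun v => (g v).run f)
      fun w hw => ?_) Finset.card_image_le
    simpa [hB] using hw
  rw [h1, Finset.card_univ, div_self (by positivity), card_bits]
  have h3 : (((Finset.univ.filter fun w => B w = true).card : ℝ)) ≤ 2 ^ m := by exact_mod_cast h2
  have h4 : (2 : ℝ) ^ m * 2 ≤ 2 ^ l := by
    rw [← pow_succ]; exact pow_le_pow_right₀ (by norm_num) hml
  have h5 : ((Finset.univ.filter fun w => B w = true).card : ℝ) / ((2 ^ l : ℕ) : ℝ) ≤ 1 / 2 := by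
    rw [div_le_div_iff₀ (by positivity) (by norm_num)]
    push_cast
    linarith
  linarith

namespace WitnessSystem
open scoped Classical
variable {n l : ℕ}

/-- The functions are all permutations. -/
def ofPerm (n : ℕ) {l : ℕ} (𝒲 : Bits l → Set (Finset (Bits n × Bits n))) :
    WitnessSystem n l (Bits n) where
  P := id
  lab := id
  lab_injective := Function.injective_id
  wit := 𝒲

theorem balanced_ofPerm (𝒲 : Bits l → Set (Finset (Bits n × Bits n))) :
    (ofPerm n 𝒲).Balanced :=
  ⟨1, fun y => by
    refine Finset.card_eq_one.2 ⟨y, ?_⟩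
    ext x
    simp only [Finset.mem_filter, Finset.mem_univ, true_and, Finset.mem_singleton]
    rfl⟩

/-- Without risky queries no run is bad, and the `2 ^ s` advice strings together invert only a
fraction `2 ^ s * 2 ^ (-16 s) < 1` of the permutations. -/
theorem exists_forall_invProb_le {Ω : Type} [Fintype Ω] [DecidableEq Ω] [Nonempty Ω] (S : WitnessSystem n l Ω)
    (hS : S.Balanced) {C : Type} (coins : PMF C) {r s D : ℕ}
    (A : C → Bits s → Bits n → OracleAlg (Bits l ⊕ Bits n) (Reply l n) (Bits n))
    (hn : 1 ≤ n) (hs1 : 1 ≤ s)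
    (hs : ∀ ω h y B f, (A ω h y).calls (pairOracle B f) ≤ s)
    (hr : ∀ w, ∀ K ∈ S.wit w, K.card ≤ r)
    (hq : 64 * s ^ 2 * (2 + s * (2 * r + D + 1)) ≤ Fintype.card Ω)
    (hsafe : ∀ π y w, ¬ S.Risky D π y w) :
    ∃ π, ∀ h : Bits s, invProb coins (fun ω => A ω h) (S.fn π) (S.breaker π) ≤ 1 / s := by
  by_contra hall
  push Not at hall
  have h := S.sum_invert_le hS (I := Unit) (fun _ => 1) (fun _ => zero_le_one) (fun _ => S.wit)
    coins A hn hs1 hs (fun _ => hr) hq (β := 0) (fun y w => by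
      refine Finset.sum_nonpos fun i _ => Finset.sum_nonpos fun π _ => ?_
      exact (if_neg (hsafe π y w)).le) le_rfl
  have e : (Finset.univ.filter fun π : Equiv.Perm Ω => ∃ h : Bits s,
      1 / (s : ℝ) < invProb coins (fun ω => A ω h) (S.fn π) (S.breaker π)) = Finset.univ :=
    Finset.filter_true_of_mem fun π _ => hall π
  simp only [Finset.univ_unique, Finset.sum_singleton, mul_zero, add_zero, one_mul] at h
  change ((Finset.univ.filter fun π : Equiv.Perm Ω => ∃ h : Bits s,
      1 / (s : ℝ) < invProb coins (fun ω => A ω h) (S.fn π) (S.breaker π)).card : ℝ) ≤ _ at h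
  rw [e, Finset.card_univ, Fintype.card_perm] at h
  have hN : (0 : ℝ) < (Fintype.card Ω).factorial := by positivity
  have h2 : (2 : ℝ) ^ s * (1 / 2) ^ (16 * s) < 1 := by
    rw [pow_mul, ← mul_pow]
    exact pow_lt_one₀ (by norm_num) (by norm_num) (by omega)
  nlinarith

/-- If the oracle replies are long compared to the number of queries, the replies of the breaker
can be guessed, and even a breaker that depends arbitrarily on the permutation does not help. -/
theorem exists_perm_forall_invProb_le {C : Type} (coins : PMF C) {s : ℕ}
    (A : C → Bits s → Bits n → OracleAlg (Bits l ⊕ Bits n) (Reply l n) (Bits n)) (hs1 : 1 ≤ s)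
    (hs : ∀ ω h y B f, (A ω h y).calls (pairOracle B f) ≤ s)
    (hq : 64 * (s * 2 ^ s) ^ 2 * (2 + s) ≤ 2 ^ n)
    (B : Equiv.Perm (Bits n) → Bits l → Bool) :
    ∃ π : Equiv.Perm (Bits n), ∀ h : Bits s,
      invProb coins (fun ω => A ω h) π (B π) ≤ 1 / s := by
  by_contra hall
  push Not at hall
  have hs0 : (0 : ℝ) < s := by exact_mod_cast hs1
  -- There are no witnesses: the hardwired algorithm never consults the breaker.
  set S : WitnessSystem n l (Bits n) := ofPerm n fun _ => ∅ with hSdef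
  have hS : S.Balanced := balanced_ofPerm _
  set ext : Bits s → ℕ → Bool := fun β i => if h : i < s then β ⟨i, h⟩ else false with hext
  set t : Bits s → Bits s → C → Bits n → OracleAlg (Bits l ⊕ Bits n) (Reply l n) (Bits n) :=
    fun h β ω y => OracleAlg.hardwire (fun _ => false) (ext β) (A ω h y) s with ht
  -- Some guess of the replies keeps a fraction `2 ^ (-s)` of the success probability, so
  -- concentration is applied at the level `1 / (s * 2 ^ s)`.
  have hM : 1 ≤ s * 2 ^ s := Nat.mul_pos hs1 (by positivity)
  have h1 : ∀ h β, ((Finset.univ.filter fun π : Equiv.Perm (Bits n) =>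
      1 / ((s * 2 ^ s : ℕ) : ℝ) < invProb coins (t h β) π (S.breaker π)).card : ℝ) ≤
      (2 ^ n).factorial * (1 / 2) ^ (16 * (s * 2 ^ s)) := by
    intro h β
    have := S.card_invert_le coins (t h β) (r := 0) (s := s) (D := 0) hM (by simp [hSdef, ofPerm])
      (fun ω y B f => OracleAlg.calls_hardwire_le _ _ _ _ _) (by rw [card_bits]; simpa using hq)
    rw [card_bits] at this
    refine le_trans (Nat.cast_le.2 (Finset.card_le_card fun π hπ => ?_)) this
    simp only [Finset.mem_filter, Finset.mem_univ, true_and] at hπ ⊢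
    refine ⟨?_, ?_⟩
    · rw [← hS.prob_succeeds]; exact hπ
    · refine le_trans (le_of_eq ?_) (show (0 : ℝ) ≤ _ by positivity)
      have : ∀ u, ¬ S.Bad Prod.fst (fun u => t h β u.2 (S.lab u.1)) 0 π u := by
        rintro u ⟨w, _, _, hw⟩
        simp [critical, hSdef, ofPerm] at hw
      simp [prob, this]
  have h2 : ∀ π : Equiv.Perm (Bits n), ∃ hβ : Bits s × Bits s,
      1 / ((s * 2 ^ s : ℕ) : ℝ) < invProb coins (t hβ.1 hβ.2) π (S.breaker π) := by
    intro π
    obtain ⟨h, hh⟩ := hall π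
    by_contra hno
    push Not at hno
    have h3 : invProb coins (fun ω => A ω h) π (B π) ≤
        ∑ β, invProb coins (t h β) π (S.breaker π) := by
      refine le_trans (prob_mono fun p hp => ?_) (prob_exists_le Finset.univ _ _)
      obtain ⟨β, hβ⟩ := OracleAlg.exists_run_hardwire (fun _ => false) (B π) (S.breaker π) π
        (A p.2 h (π p.1)) s (hs _ _ _ _ _)
      refine ⟨fun i => β i, Finset.mem_univ _, ?_⟩
      rw [ht]
      simp only
      rw [hβ (ext fun i => β i) fun i hi => by simp [hext, hi]]
      exact hp
    have h4 := h3.trans (Finset.sum_le_card_nsmul _ _ _ fun β _ => hno (h, β))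
    rw [Finset.card_univ, card_bits, nsmul_eq_mul] at h4
    have h5 : ((2 ^ s : ℕ) : ℝ) * (1 / ((s * 2 ^ s : ℕ) : ℝ)) = 1 / s := by
      push_cast; field_simp
    rw [h5] at h4
    exact absurd hh (not_lt.2 h4)
  have h6 := card_exists_le fun (hβ : Bits s × Bits s) (π : Equiv.Perm (Bits n)) =>
    1 / ((s * 2 ^ s : ℕ) : ℝ) < invProb coins (t hβ.1 hβ.2) π (S.breaker π)
  rw [Finset.filter_true_of_mem fun π _ => h2 π, Finset.card_univ, Fintype.card_perm,
    card_bits] at h6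
  have h7 := h6.trans (Finset.sum_le_card_nsmul _ _ _ fun hβ _ => h1 hβ.1 hβ.2)
  rw [Finset.card_univ, Fintype.card_prod, card_bits, nsmul_eq_mul] at h7
  have hN : (0 : ℝ) < (2 ^ n).factorial := by positivity
  have h8 : ((2 ^ s * 2 ^ s : ℕ) : ℝ) * (1 / 2) ^ (16 * (s * 2 ^ s)) < 1 := by
    push_cast
    calc (2 : ℝ) ^ s * 2 ^ s * (1 / 2) ^ (16 * (s * 2 ^ s))
        ≤ 2 ^ s * 2 ^ s * (1 / 2) ^ (16 * s) := by
          refine mul_le_mul_of_nonneg_left ?_ (by positivity)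
          refine pow_le_pow_of_le_one (by norm_num) (by norm_num) ?_
          exact Nat.mul_le_mul_left _ (Nat.le_mul_of_pos_right _ (by positivity))
      _ = (2 * 2 * (1 / 2) ^ 16) ^ s := by rw [mul_pow, mul_pow, ← pow_mul]
      _ < 1 := pow_lt_one₀ (by norm_num) (by norm_num) (by omega)
  nlinarith

/-- Without breaker. -/
theorem exists_perm_of_no_witness {C : Type} (coins : PMF C) {s : ℕ}
    (A : C → Bits s → Bits n → OracleAlg (Bits l ⊕ Bits n) (Reply l n) (Bits n)) (hn : 1 ≤ n)
    (hs1 : 1 ≤ s) (hs : ∀ ω h y B f, (A ω h y).calls (pairOracle B f) ≤ s)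
    (hq : 64 * s ^ 2 * (2 + s) ≤ 2 ^ n) (acc : Bits l → Prop) :
    ∃ (π : Equiv.Perm (Bits n)), ∀ h : Bits s,
      invProb coins (fun ω => A ω h) π (fun w => decide (acc w)) ≤ 1 / s := by
  set S : WitnessSystem n l (Bits n) := ofPerm n fun w => {K | acc w ∧ K = ∅} with hS
  obtain ⟨π, hπ⟩ := S.exists_forall_invProb_le (balanced_ofPerm _) coins (r := 0) (D := 0) A hn hs1
    hs (by rintro w K ⟨_, rfl⟩; simp) (by rw [card_bits]; simpa using hq) (by
      rintro π y w ⟨h1, h2⟩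
      obtain ⟨a, ha⟩ := Finset.card_pos.1 h2
      simp only [critical, Finset.mem_filter] at ha
      obtain ⟨_, K, hK, _⟩ := ha
      obtain ⟨hacc, rfl⟩ := hK
      exact h1 ⟨∅, ⟨hacc, rfl⟩, by simp⟩)
  have e : S.breaker π = fun w => decide (acc w) := by
    funext w
    refine decide_eq_decide.2 ⟨?_, fun h => ⟨∅, ⟨h, rfl⟩, by simp⟩⟩
    rintro ⟨K, hK, _⟩
    exact hK.1
  rw [e] at hπ
  exact ⟨π, hπ⟩

end WitnessSystem

/-! ### Partial functions inside random permutations and random functions with small image -/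

section Permutations
open scoped Classical
open OracleAlg (Extends IsMatching)
variable {X : Type} [Fintype X] [DecidableEq X]

/-- The number of permutations extending a partial function. -/
noncomputable def numExt (K : Finset (X × X)) : ℕ :=
  (Finset.univ.filter fun τ : Equiv.Perm X => Extends τ K).card

theorem numExt_insert_eq {K : Finset (X × X)} {x z z' : X} (hz : ∀ p ∈ K, p.2 ≠ z)
    (hz' : ∀ p ∈ K, p.2 ≠ z') : numExt (insert (x, z) K) = numExt (insert (x, z') K) := by
  have key : ∀ {a b : X}, (∀ p ∈ K, p.2 ≠ a) → (∀ p ∈ K, p.2 ≠ b) →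
      ∀ τ : Equiv.Perm X, Extends τ (insert (x, a) K) →
        Extends (Equiv.swap a b * τ : Equiv.Perm X) (insert (x, b) K) := by
    intro a b ha hb τ h p hp
    rcases Finset.mem_insert.1 hp with rfl | hp
    · have : τ x = a := h _ (Finset.mem_insert_self _ _)
      simp [this]
    · have : τ p.1 = p.2 := h _ (Finset.mem_insert_of_mem hp)
      simp only [Equiv.Perm.mul_apply, this]
      exact Equiv.swap_apply_of_ne_of_ne (ha p hp) (hb p hp)
  refine Finset.card_bij' (fun τ _ => Equiv.swap z z' * τ) (fun τ _ => Equiv.swap z' z * τ)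
    ?_ ?_ ?_ ?_
  · intro τ hτ
    simp only [Finset.mem_filter, Finset.mem_univ, true_and] at hτ ⊢
    exact key hz hz' τ hτ
  · intro τ hτ
    simp only [Finset.mem_filter, Finset.mem_univ, true_and] at hτ ⊢
    exact key hz' hz τ hτ
  · intro τ _
    rw [Equiv.swap_comm z' z, ← mul_assoc, Equiv.swap_mul_self, one_mul]
  · intro τ _
    rw [Equiv.swap_comm z' z, ← mul_assoc, Equiv.swap_mul_self, one_mul]

/-- Pairs are added one by one. By `hK` at least half of the values are still free, and all free
values are equally frequent by `numExt_insert_eq`, so a pair costs a factor `2 / card X`. -/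
theorem numExt_mul_le {K : Finset (X × X)} (hK : 2 * K.card ≤ Fintype.card X) :
    numExt K * Fintype.card X ^ K.card ≤ (Fintype.card X).factorial * 2 ^ K.card := by
  induction K using Finset.induction_on with
  | empty => simp [numExt, Extends, Fintype.card_perm]
  | insert p K hp ih =>
    rw [Finset.card_insert_of_notMem hp] at hK ⊢
    have ih := ih (by omega)
    by_cases hex : numExt (insert p K) = 0
    · rw [hex]; simp
    obtain ⟨τ, hτ⟩ := Finset.card_pos.1 (Nat.pos_of_ne_zero hex)
    simp only [Finset.mem_filter, Finset.mem_univ, true_and] at hτ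
    have hz : ∀ p' ∈ K, p'.2 ≠ p.2 := by
      intro p' hp' e
      have h1 : τ p.1 = p.2 := hτ p (Finset.mem_insert_self _ _)
      have h2 : τ p'.1 = p'.2 := hτ p' (Finset.mem_insert_of_mem hp')
      have h3 : p'.1 = p.1 := τ.injective (by rw [h1, h2, e])
      exact hp (by rw [← Prod.ext h3 e]; exact hp')
    set Z : Finset X := Finset.univ \ K.image Prod.snd with hZ
    have hZc : Fintype.card X ≤ 2 * Z.card := by
      have := Finset.le_card_sdiff (K.image Prod.snd) (Finset.univ : Finset X)
      rw [Finset.card_univ, ← hZ] at this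
      have h2 := Finset.card_image_le (s := K) (f := Prod.snd)
      omega
    have hsum : Z.card * numExt (insert p K) ≤ numExt K := by
      have h1 : ∀ z ∈ Z, numExt (insert (p.1, z) K) = numExt (insert p K) := by
        intro z hz'
        refine numExt_insert_eq (fun p' hp' e => ?_) hz
        rw [hZ, Finset.mem_sdiff] at hz'
        exact hz'.2 (Finset.mem_image.2 ⟨p', hp', e⟩)
      rw [← smul_eq_mul, ← Finset.sum_const, ← Finset.sum_congr rfl h1]
      unfold numExt
      rw [← Finset.card_biUnion]
      · refine Finset.card_le_card fun τ hτ => ?_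
        simp only [Finset.mem_biUnion, Finset.mem_filter, Finset.mem_univ, true_and] at hτ ⊢
        obtain ⟨z, _, h⟩ := hτ
        exact h.mono (Finset.subset_insert _ _)
      · intro z _ z' _ hne
        refine Finset.disjoint_left.2 fun τ h h' => hne ?_
        simp only [Finset.mem_filter, Finset.mem_univ, true_and] at h h'
        exact (h _ (Finset.mem_insert_self _ _)).symm.trans (h' _ (Finset.mem_insert_self _ _))
    have h4 : Fintype.card X * numExt (insert p K) ≤ 2 * numExt K := by
      calc _ ≤ 2 * Z.card * numExt (insert p K) := Nat.mul_le_mul_right _ hZc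
        _ = 2 * (Z.card * numExt (insert p K)) := by ring
        _ ≤ _ := Nat.mul_le_mul_left _ hsum
    calc numExt (insert p K) * Fintype.card X ^ (K.card + 1)
        = Fintype.card X * numExt (insert p K) * Fintype.card X ^ K.card := by ring
      _ ≤ 2 * numExt K * Fintype.card X ^ K.card := Nat.mul_le_mul_right _ h4
      _ = 2 * (numExt K * Fintype.card X ^ K.card) := by ring
      _ ≤ 2 * ((Fintype.card X).factorial * 2 ^ K.card) := Nat.mul_le_mul_left _ ih
      _ = _ := by ring

theorem numExt_le {K : Finset (X × X)} [Nonempty X] (hK : 2 * K.card ≤ Fintype.card X) :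
    (numExt K : ℝ) ≤ (Fintype.card X).factorial * (2 / Fintype.card X : ℝ) ^ K.card := by
  have hN : (0 : ℝ) < Fintype.card X := by exact_mod_cast Fintype.card_pos
  rw [div_pow, ← mul_div_assoc, le_div_iff₀ (by positivity)]
  exact_mod_cast numExt_mul_le hK

/-- A random permutation after a map that is injective on the domain of a partial function. -/
theorem card_perm_comp_extends {W : Finset (X × X)} {φ : X → X}
    (hφ : Set.InjOn φ (W.image Prod.fst)) :
    (Finset.univ.filter fun τ : Equiv.Perm X => Extends (fun x => τ (φ x)) W).card =
      numExt W := by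
  obtain ⟨ρ, hρ⟩ := Finset.exists_equiv_extend_of_card_eq (α := X) (t := (Finset.univ : Finset X))
    (by simp) (s := W.image Prod.fst) (f := φ) (Finset.subset_univ _) hφ
  set σ : Equiv.Perm X := ρ.trans (Equiv.subtypeUnivEquiv Finset.mem_univ) with hσ
  have hσφ : ∀ p ∈ W, σ p.1 = φ p.1 := fun p hp => hρ _ (Finset.mem_image_of_mem _ hp)
  refine Finset.card_bij' (fun τ _ => τ * σ) (fun τ _ => τ * σ⁻¹) ?_ ?_ ?_ ?_
  · intro τ hτ
    simp only [Finset.mem_filter, Finset.mem_univ, true_and] at hτ ⊢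
    intro p hp
    rw [Equiv.Perm.mul_apply, hσφ p hp]
    exact hτ p hp
  · intro τ hτ
    simp only [Finset.mem_filter, Finset.mem_univ, true_and] at hτ ⊢
    intro p hp
    change (τ * σ⁻¹) (φ p.1) = p.2
    rw [← hσφ p hp]
    simpa using hτ p hp
  · intro τ _; simp
  · intro τ _; simp

variable {Ω : Type} [Fintype Ω] [DecidableEq Ω]

/-- By symmetry all points other than `x` collide with `x` equally often, and each `κ` has `c - 1`
such collisions. As `card X = card Ω * c`, the quotient `(c - 1) / (card X - 1)` is at most `1 /
card Ω`. -/
theorem card_collision_mul_le {P : X → Ω} {c : ℕ}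
    (hP : ∀ y, (Finset.univ.filter fun x => P x = y).card = c) {x x' : X} (hx : x ≠ x') :
    (Finset.univ.filter fun κ : Equiv.Perm X => P (κ x) = P (κ x')).card * Fintype.card Ω ≤
      (Fintype.card X).factorial := by
  set A : X → ℕ := fun x'' => (Finset.univ.filter fun κ : Equiv.Perm X =>
    P (κ x) = P (κ x'')).card with hA
  have hsymm : ∀ x'' ∈ Finset.univ.erase x, A x'' = A x' := by
    intro x'' hx''
    have hx'' := Finset.ne_of_mem_erase hx''
    have hswap : ∀ κ : Equiv.Perm X, (κ * Equiv.swap x' x'') x = κ x := fun κ => by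
      rw [Equiv.Perm.mul_apply, Equiv.swap_apply_of_ne_of_ne hx hx''.symm]
    refine Finset.card_bij' (fun κ _ => κ * Equiv.swap x' x'') (fun κ _ => κ * Equiv.swap x' x'')
      ?_ ?_ ?_ ?_
    · intro κ hκ
      simp only [Finset.mem_filter, Finset.mem_univ, true_and] at hκ ⊢
      rw [hswap, Equiv.Perm.mul_apply, Equiv.swap_apply_left]
      exact hκ
    · intro κ hκ
      simp only [Finset.mem_filter, Finset.mem_univ, true_and] at hκ ⊢
      rw [hswap, Equiv.Perm.mul_apply, Equiv.swap_apply_right]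
      exact hκ
    · intro κ _; simp [mul_assoc]
    · intro κ _; simp [mul_assoc]
  have hsum : ∑ x'' ∈ Finset.univ.erase x, A x'' = (Fintype.card X).factorial * (c - 1) := by
    simp only [hA, Finset.card_filter]
    rw [Finset.sum_comm]
    have : ∀ κ : Equiv.Perm X, ∑ x'' ∈ Finset.univ.erase x,
        (if P (κ x) = P (κ x'') then 1 else 0) = c - 1 := by
      intro κ
      rw [← Finset.card_filter, ← hP (P (κ x))]
      have h1 : (Finset.univ.filter fun a => P a = P (κ x)) =
          (Finset.univ.filter fun x'' => P (κ x) = P (κ x'')).map κ.toEmbedding := by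
        ext a
        simp only [Finset.mem_filter, Finset.mem_univ, true_and, Finset.mem_map_equiv]
        rw [Equiv.apply_symm_apply]
        exact eq_comm
      rw [h1, Finset.card_map, ← Finset.card_erase_of_mem (a := x) (by simp)]
      congr 1
      ext a
      simp only [Finset.mem_filter, Finset.mem_erase, Finset.mem_univ, true_and, and_true]
    rw [Finset.sum_congr rfl fun κ _ => this κ, Finset.sum_const, Finset.card_univ,
      Fintype.card_perm, smul_eq_mul]
  have hcard : Fintype.card X = Fintype.card Ω * c := by
    have := Finset.card_eq_sum_card_fiberwise (f := P) (s := Finset.univ) (t := Finset.univ)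
      (by intro _ _; simp)
    rw [Finset.sum_congr rfl fun y _ => hP y, Finset.sum_const, smul_eq_mul, Finset.card_univ,
      Finset.card_univ] at this
    exact this
  rw [Finset.sum_congr rfl hsymm, Finset.sum_const, Finset.card_erase_of_mem (Finset.mem_univ _),
    Finset.card_univ, smul_eq_mul] at hsum
  have hX : 1 < Fintype.card X := Fintype.one_lt_card_iff.2 ⟨x, x', hx⟩
  change A x' * _ ≤ _
  have hΩ : 1 ≤ Fintype.card Ω := Fintype.card_pos_iff.2 ⟨P x⟩
  have h1 : (c - 1) * Fintype.card Ω ≤ Fintype.card X - 1 := by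
    rw [hcard, Nat.sub_mul, mul_comm c]; omega
  refine Nat.le_of_mul_le_mul_left ?_ (show 0 < Fintype.card X - 1 by omega)
  calc (Fintype.card X - 1) * (A x' * Fintype.card Ω)
      = (Fintype.card X).factorial * ((c - 1) * Fintype.card Ω) := by
        rw [← mul_assoc, hsum, mul_assoc]
    _ ≤ (Fintype.card X).factorial * (Fintype.card X - 1) := Nat.mul_le_mul_left _ h1
    _ = _ := mul_comm _ _

/-- A small set is mapped injectively by most shifts of a balanced map. -/
theorem card_injOn_ge {P : X → Ω} {c : ℕ}
    (hP : ∀ y, (Finset.univ.filter fun x => P x = y).card = c) (F : Finset X) {r : ℕ}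
    (hF : F.card ≤ r) (hr : 2 * r ^ 2 ≤ Fintype.card Ω) :
    (Fintype.card X).factorial ≤ 2 * (Finset.univ.filter fun κ : Equiv.Perm X =>
      Set.InjOn (fun x => P (κ x)) F).card := by
  have h1 : (Finset.univ.filter fun κ : Equiv.Perm X => ¬ Set.InjOn (fun x => P (κ x)) F) ⊆
      F.offDiag.biUnion fun q => Finset.univ.filter fun κ : Equiv.Perm X =>
        P (κ q.1) = P (κ q.2) := by
    intro κ hκ
    have hκ := (Finset.mem_filter.1 hκ).2
    unfold Set.InjOn at hκ
    push Not at hκ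
    obtain ⟨x, hx, x', hx', e, hne⟩ := hκ
    simp only [Finset.mem_biUnion, Finset.mem_filter, Finset.mem_univ, true_and]
    exact ⟨(x, x'), Finset.mem_offDiag.2 ⟨hx, hx', hne⟩, e⟩
  have h2 : (Finset.univ.filter fun κ : Equiv.Perm X =>
      ¬ Set.InjOn (fun x => P (κ x)) F).card * Fintype.card Ω ≤
      r ^ 2 * (Fintype.card X).factorial := by
    refine (Nat.mul_le_mul_right _ ((Finset.card_le_card h1).trans Finset.card_biUnion_le)).trans ?_
    rw [Finset.sum_mul]
    refine (Finset.sum_le_card_nsmul _ _ _ fun q hq =>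
      card_collision_mul_le hP (Finset.mem_offDiag.1 hq).2.2).trans ?_
    rw [smul_eq_mul]
    refine Nat.mul_le_mul_right _ ?_
    rw [Finset.offDiag_card, pow_two]
    exact (Nat.sub_le _ _).trans (Nat.mul_le_mul hF hF)
  have h3 := Finset.card_filter_add_card_filter_not (s := (Finset.univ : Finset (Equiv.Perm X)))
    (fun κ : Equiv.Perm X => Set.InjOn (fun x => P (κ x)) F)
  rw [Finset.card_univ, Fintype.card_perm] at h3
  set G := (Finset.univ.filter fun κ : Equiv.Perm X => Set.InjOn (fun x => P (κ x)) F).card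
  set H := (Finset.univ.filter fun κ : Equiv.Perm X =>
    ¬ Set.InjOn (fun x => P (κ x)) F).card
  rcases Nat.eq_zero_or_pos (Fintype.card Ω) with h0 | h0
  · have : IsEmpty Ω := Fintype.card_eq_zero_iff.1 h0
    have hX : IsEmpty X := ⟨fun x => this.elim (P x)⟩
    have : H = 0 := by
      refine Finset.card_eq_zero.2 (Finset.filter_eq_empty_iff.2 fun κ _ h => h ?_)
      intro x; exact hX.elim x
    omega
  · have h4 : 2 * H ≤ (Fintype.card X).factorial := by
      refine Nat.le_of_mul_le_mul_left ?_ h0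
      calc Fintype.card Ω * (2 * H) = 2 * (H * Fintype.card Ω) := by ring
        _ ≤ 2 * (r ^ 2 * (Fintype.card X).factorial) := Nat.mul_le_mul_left _ h2
        _ = 2 * r ^ 2 * (Fintype.card X).factorial := by ring
        _ ≤ _ := Nat.mul_le_mul_right _ hr
    omega

/-- A partial function is extended by random functions that factor through `Ω` at least half as
often as by random permutations. -/
theorem numExt_le_sum_extends {P : X → Ω} {c : ℕ}
    (hP : ∀ y, (Finset.univ.filter fun x => P x = y).card = c) {e : Ω → X}
    (he : Function.Injective e) {r : ℕ} (hr : 2 * r ^ 2 ≤ Fintype.card Ω) {W : Finset (X × X)}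
    (hW : W.card ≤ r) :
    (Fintype.card X).factorial * (Fintype.card Ω).factorial * numExt W ≤
      2 * ∑ κ : Equiv.Perm X, ∑ π : Equiv.Perm Ω, ∑ τ : Equiv.Perm X,
        if Extends (fun x => τ (e (π (P (κ x))))) W then 1 else 0 := by
  have h1 := card_injOn_ge hP (W.image Prod.fst) (Finset.card_image_le.trans hW) hr
  set G := Finset.univ.filter fun κ : Equiv.Perm X =>
    Set.InjOn (fun x => P (κ x)) (W.image Prod.fst) with hG
  -- Once `κ` separates the domain of `W` under `P`, the outer permutation `τ` extends `W` exactly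
  -- as often as a random permutation does.
  have h2 : ∀ κ ∈ G, (Fintype.card Ω).factorial * numExt W ≤
      ∑ π : Equiv.Perm Ω, ∑ τ : Equiv.Perm X,
        if Extends (fun x => τ (e (π (P (κ x))))) W then 1 else 0 := by
    intro κ hκ
    rw [← Fintype.card_perm, ← smul_eq_mul, ← Finset.card_univ]
    refine Finset.card_nsmul_le_sum _ _ _ fun π _ => ?_
    rw [← Finset.card_filter]
    refine (card_perm_comp_extends (φ := fun x => e (π (P (κ x)))) ?_).ge
    intro x hx x' hx' h
    exact (Finset.mem_filter.1 hκ).2 hx hx' (π.injective (he h))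
  have h3 := Finset.card_nsmul_le_sum _ _ _ h2
  have h4 := h3.trans (Finset.sum_le_sum_of_subset (Finset.subset_univ G))
  rw [smul_eq_mul] at h4
  calc _ ≤ (2 * G.card) * (Fintype.card Ω).factorial * numExt W :=
        Nat.mul_le_mul_right _ (Nat.mul_le_mul_right _ h1)
    _ = 2 * (G.card * ((Fintype.card Ω).factorial * numExt W)) := by ring
    _ ≤ _ := Nat.mul_le_mul_left _ h4

end Permutations

/-! ### Random subsets with independent inclusions -/

section Bernoulli
variable {J : Type} [Fintype J] [DecidableEq J]

/-- The probability of the subset `S` if each `j` is included independently with probability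
`p j`. -/
noncomputable def bernoulliWeight (p : J → ℝ) (S : Finset J) : ℝ :=
  (∏ j ∈ S, p j) * ∏ j ∈ Finset.univ \ S, (1 - p j)

theorem bernoulliWeight_nonneg {p : J → ℝ} (h0 : ∀ j, 0 ≤ p j) (h1 : ∀ j, p j ≤ 1)
    (S : Finset J) : 0 ≤ bernoulliWeight p S :=
  mul_nonneg (Finset.prod_nonneg fun j _ => h0 j)
    (Finset.prod_nonneg fun j _ => sub_nonneg.2 (h1 j))

/-- The generating function of the random subset. Setting `x` to 0 or 2 on a set `A` gives the
probability of missing `A` and an exponential moment of the number of hits. -/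
theorem sum_bernoulliWeight_mul_prod (p x : J → ℝ) :
    ∑ S, bernoulliWeight p S * ∏ j ∈ S, x j = ∏ j, (p j * x j + (1 - p j)) := by
  rw [Finset.prod_add, Finset.powerset_univ]
  refine Finset.sum_congr rfl fun S _ => ?_
  rw [bernoulliWeight, Finset.prod_mul_distrib]
  ring

theorem sum_bernoulliWeight (p : J → ℝ) : ∑ S, bernoulliWeight p S = 1 := by
  simpa using sum_bernoulliWeight_mul_prod p fun _ => 1

omit [DecidableEq J] in
theorem prod_add_one_sub_le_exp {p x : J → ℝ} (h : ∀ j, 0 ≤ p j * x j + (1 - p j)) :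
    ∏ j, (p j * x j + (1 - p j)) ≤ Real.exp (∑ j, p j * (x j - 1)) := by
  rw [Real.exp_sum]
  refine Finset.prod_le_prod (fun j _ => h j) fun j _ => ?_
  have := Real.add_one_le_exp (p j * (x j - 1))
  linarith

theorem sum_bernoulliWeight_disjoint_le {p : J → ℝ} (h0 : ∀ j, 0 ≤ p j) (h1 : ∀ j, p j ≤ 1)
    (A : Finset J) :
    ∑ S, (if Disjoint S A then bernoulliWeight p S else 0) ≤ Real.exp (-∑ j ∈ A, p j) := by
  have h := sum_bernoulliWeight_mul_prod p fun j => if j ∈ A then 0 else 1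
  have h2 := prod_add_one_sub_le_exp (p := p) (x := fun j => if j ∈ A then 0 else 1) fun j => by
    have := h0 j; have := h1 j
    split_ifs <;> linarith
  have h3 : ∑ j, p j * ((if j ∈ A then (0 : ℝ) else 1) - 1) = -∑ j ∈ A, p j := by
    rw [← Finset.sum_neg_distrib, ← Finset.sum_subset (Finset.subset_univ A)]
    · exact Finset.sum_congr rfl fun j hj => by simp [hj]
    · intro j _ hj; simp [hj]
  rw [h3, ← h] at h2
  refine le_trans (le_of_eq (Finset.sum_congr rfl fun S _ => ?_)) h2
  split_ifs with hd
  · rw [Finset.prod_congr rfl fun j hj => if_neg (Finset.disjoint_left.1 hd hj)]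
    simp
  · obtain ⟨j, hj, hA⟩ := Finset.not_disjoint_iff.1 hd
    rw [Finset.prod_eq_zero hj (by simp [hA]), mul_zero]

theorem sum_bernoulliWeight_two_pow_le {p : J → ℝ} (h0 : ∀ j, 0 ≤ p j)
    (A : Finset J) :
    ∑ S, bernoulliWeight p S * 2 ^ (S ∩ A).card ≤ Real.exp (∑ j ∈ A, p j) := by
  have h := sum_bernoulliWeight_mul_prod p fun j => if j ∈ A then 2 else 1
  have h2 := prod_add_one_sub_le_exp (p := p) (x := fun j => if j ∈ A then 2 else 1) fun j => by
    have := h0 j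
    split_ifs <;> linarith
  have h3 : ∑ j, p j * ((if j ∈ A then (2 : ℝ) else 1) - 1) = ∑ j ∈ A, p j := by
    rw [← Finset.sum_subset (Finset.subset_univ A)]
    · exact Finset.sum_congr rfl fun j hj => by simp [hj]; norm_num
    · intro j _ hj; simp [hj]
  rw [h3, ← h] at h2
  refine le_trans (le_of_eq (Finset.sum_congr rfl fun S _ => ?_)) h2
  rw [Finset.prod_ite, Finset.prod_const, Finset.prod_const_one, mul_one, Finset.filter_mem_eq_inter]

/-- Markov's inequality for `2 ^ (S ∩ A).card`. -/
theorem sum_bernoulliWeight_card_gt_le {p : J → ℝ} (h0 : ∀ j, 0 ≤ p j) (h1 : ∀ j, p j ≤ 1)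
    (A : Finset J) (D : ℕ) :
    ∑ S, (if D < (S ∩ A).card then bernoulliWeight p S else 0) ≤
      Real.exp (∑ j ∈ A, p j) / 2 ^ D := by
  rw [le_div_iff₀ (by positivity), Finset.sum_mul]
  refine le_trans (Finset.sum_le_sum fun S _ => ?_) (sum_bernoulliWeight_two_pow_le h0 A)
  have := bernoulliWeight_nonneg h0 h1 S
  split_ifs with h
  · exact mul_le_mul_of_nonneg_left (pow_le_pow_right₀ (by norm_num) h.le) this
  · rw [zero_mul]; positivity

theorem sum_bernoulliWeight_mem (p : J → ℝ) (j : J) :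
    ∑ S, (if j ∈ S then bernoulliWeight p S else 0) = p j := by
  have h := sum_bernoulliWeight_mul_prod p fun i => if i = j then 0 else 1
  rw [Finset.prod_eq_single j (fun i _ hi => by simp [hi]) (by simp)] at h
  simp only [if_true, mul_zero, zero_add] at h
  have h2 := sum_bernoulliWeight p
  have h3 : ∀ S : Finset J, bernoulliWeight p S =
      (if j ∈ S then bernoulliWeight p S else 0) +
        bernoulliWeight p S * ∏ i ∈ S, if i = j then (0 : ℝ) else 1 := by
    intro S
    split_ifs with hj
    · rw [Finset.prod_eq_zero hj (by simp)]; simp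
    · rw [Finset.prod_congr rfl fun i hi => if_neg (fun e : i = j => hj (e ▸ hi))]; simp
  rw [Finset.sum_congr rfl fun S _ => h3 S, Finset.sum_add_distrib, h] at h2
  linarith

end Bernoulli

/-! ### Weights of transcripts and plantings -/

section Planted
open scoped Classical
open OracleAlg (leaves Extends IsMatching)
variable {n m l : ℕ} (g : Bits m → OracleAlg (Bits n) (fun _ => Bits n) (Bits l)) (a b θ : ℝ)

/-- The weight of the transcripts with output `w`, where a pair costs `a`, a pair whose label occurs
in `W` costs `b` more, and pairs of `W` are free. -/
noncomputable def refWeight (W : Finset (Bits n × Bits n)) (w : Bits l) : ℝ :=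
  ∑ v, ∑ L ∈ (leaves (g v) ∅).filter (fun L => L.2 = w), ∏ p ∈ L.1,
    ((if p ∈ W then 1 else 0) + (a + if ∃ q ∈ W, q.2 = p.2 then b else 0))

/-- The seed `v` leads to a transcript of `f` of weight at least `θ`. -/
def HeavySeed (f : Bits n → Bits n) (v : Bits m) : Prop :=
  ∃ L ∈ leaves (g v) ∅, Extends f L.1 ∧ θ ≤ refWeight g a b L.1 L.2

/-- A seed, a transcript with output, and a part of the transcript. -/
abbrev Planting (n m l : ℕ) : Type :=
  Bits m × (Finset (Bits n × Bits n) × Bits l) × Finset (Bits n × Bits n)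

def Planting.Valid (j : Planting n m l) : Prop := j.2.1 ∈ leaves (g j.1) ∅ ∧ j.2.2 ⊆ j.2.1.1

theorem sum_valid (F : Planting n m l → ℝ) :
    ∑ j : Planting n m l, (if j.Valid g then F j else 0) =
      ∑ v, ∑ L ∈ leaves (g v) ∅, ∑ K ∈ L.1.powerset, F (v, L, K) := by
  rw [Fintype.sum_prod_type]
  refine Finset.sum_congr rfl fun v _ => ?_
  rw [Fintype.sum_prod_type, ← Finset.sum_subset (Finset.subset_univ (leaves (g v) ∅))]
  · refine Finset.sum_congr rfl fun L hL => ?_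
    rw [← Finset.sum_subset (Finset.subset_univ L.1.powerset)]
    · refine Finset.sum_congr rfl fun K hK => ?_
      rw [if_pos ⟨hL, Finset.mem_powerset.1 hK⟩]
    · intro K _ hK
      rw [if_neg fun h : Planting.Valid g (v, L, K) => hK (Finset.mem_powerset.2 h.2)]
  · intro L _ hL
    refine Finset.sum_eq_zero fun K _ => ?_
    rw [if_neg fun h : Planting.Valid g (v, L, K) => hL h.1]

/-- The witnesses of a set of plantings. -/
def plantedWit (T : Finset (Planting n m l)) (w : Bits l) : Set (Finset (Bits n × Bits n)) :=
  {K | ∃ j ∈ T, j.Valid g ∧ j.2.1.2 = w ∧ j.2.2 = K}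

variable (I : Set (Bits n))

/-- The inclusion probability of a pair with label `z`. -/
noncomputable def labelWeight (z : Bits n) : ℝ := a + if z ∈ I then b else 0

/-- The inclusion probability of a planting. -/
noncomputable def plantingProb (j : Planting n m l) : ℝ :=
  if j.Valid g then θ⁻¹ * ∏ p ∈ j.2.1.1 \ j.2.2, labelWeight a b I p.2 else 0

variable {a b θ} (ha : 0 ≤ a) (hb : 0 ≤ b) (hab : a + b ≤ 1) (hθ : 1 ≤ θ)

theorem labelWeight_nonneg (ha : 0 ≤ a) (hb : 0 ≤ b) (z : Bits n) : 0 ≤ labelWeight a b I z := by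
  unfold labelWeight; split_ifs <;> linarith

theorem labelWeight_le_one (hb : 0 ≤ b) (hab : a + b ≤ 1) (z : Bits n) :
    labelWeight a b I z ≤ 1 := by
  unfold labelWeight; split_ifs <;> linarith

include ha hb hθ in
theorem plantingProb_nonneg (j : Planting n m l) : 0 ≤ plantingProb g a b θ I j := by
  unfold plantingProb
  split_ifs
  · exact mul_nonneg (by positivity) (Finset.prod_nonneg fun p _ => labelWeight_nonneg I ha hb _)
  · exact le_rfl

include ha hb hab hθ in
theorem plantingProb_le_one (j : Planting n m l) : plantingProb g a b θ I j ≤ 1 := by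
  unfold plantingProb
  split_ifs
  · exact mul_le_one₀ (inv_le_one_of_one_le₀ hθ)
      (Finset.prod_nonneg fun p _ => labelWeight_nonneg I ha hb _)
      (Finset.prod_le_one (fun p _ => labelWeight_nonneg I ha hb _)
        fun p _ => labelWeight_le_one I hb hab _)
  · exact zero_le_one

/-- The expected number of plantings with output `w` that are part of `f`. -/
theorem sum_plantingProb_extends (f : Bits n → Bits n) (Q : Bits l → Prop) [DecidablePred Q] :
    ∑ j : Planting n m l, (if Q j.2.1.2 ∧ Extends f j.2.2 then plantingProb g a b θ I j else 0) =
      θ⁻¹ * ∑ v, ∑ L ∈ (leaves (g v) ∅).filter (fun L => Q L.2), ∏ p ∈ L.1,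
        ((if f p.1 = p.2 then 1 else 0) + labelWeight a b I p.2) := by
  have h1 : ∀ j : Planting n m l,
      (if Q j.2.1.2 ∧ Extends f j.2.2 then plantingProb g a b θ I j else 0) =
      if j.Valid g then (if Q j.2.1.2 then θ⁻¹ * ((∏ p ∈ j.2.2, if f p.1 = p.2 then (1 : ℝ) else 0) *
        ∏ p ∈ j.2.1.1 \ j.2.2, labelWeight a b I p.2) else 0) else 0 := by
    intro j
    by_cases hE : Extends f j.2.2
    · have : (∏ p ∈ j.2.2, if f p.1 = p.2 then (1 : ℝ) else 0) = 1 :=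
        Finset.prod_eq_one fun p hp => if_pos (hE p hp)
      rw [this, one_mul]
      unfold plantingProb
      by_cases hQ : Q j.2.1.2 <;> by_cases hV : j.Valid g <;> simp [hE, hQ, hV]
    · have : (∏ p ∈ j.2.2, if f p.1 = p.2 then (1 : ℝ) else 0) = 0 := by
        unfold Extends at hE
        push Not at hE
        obtain ⟨p, hp, h⟩ := hE
        exact Finset.prod_eq_zero hp (if_neg h)
      rw [this, zero_mul, mul_zero]
      simp [hE]
  rw [Finset.sum_congr rfl fun j _ => h1 j, sum_valid, Finset.mul_sum]
  refine Finset.sum_congr rfl fun v _ => ?_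
  rw [Finset.sum_filter, Finset.mul_sum]
  refine Finset.sum_congr rfl fun L _ => ?_
  simp only
  split_ifs with hQ
  -- Expanding the product decides for each pair of the transcript whether it lies in `K` and agrees
  -- with `f`, or is missing from `K` and paid for by its label weight.
  · rw [Finset.prod_add, Finset.mul_sum]
  · simp

include ha hb in
-- Pairs of `W` agree with `f`, and labels of `W` are values of `f`, hence lie in `I`. So the weight
-- relative to one transcript, which does not mention `f`, bounds from below the expected number of
-- plantings present in any `f` that extends it (up to `θ`).
theorem refWeight_le {f : Bits n → Bits n} (hf : ∀ x, f x ∈ I) {W : Finset (Bits n × Bits n)}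
    (hW : Extends f W) (w : Bits l) :
    refWeight g a b W w ≤ ∑ v, ∑ L ∈ (leaves (g v) ∅).filter (fun L => L.2 = w), ∏ p ∈ L.1,
        ((if f p.1 = p.2 then 1 else 0) + labelWeight a b I p.2) := by
  refine Finset.sum_le_sum fun v _ => Finset.sum_le_sum fun L _ =>
    Finset.prod_le_prod (fun p _ => ?_) fun p _ => add_le_add ?_ (add_le_add le_rfl ?_)
  · have : (0 : ℝ) ≤ if p ∈ W then 1 else 0 := by split_ifs <;> norm_num
    have : (0 : ℝ) ≤ if ∃ q ∈ W, q.2 = p.2 then b else 0 := by split_ifs <;> linarith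
    linarith
  · by_cases h : p ∈ W
    · rw [if_pos h, if_pos (hW p h)]
    · rw [if_neg h]; split_ifs <;> norm_num
  · by_cases h : ∃ q ∈ W, q.2 = p.2
    · obtain ⟨q, hq, e⟩ := h
      rw [if_pos ⟨q, hq, e⟩, if_pos (by rw [← e, ← hW q hq]; exact hf _)]
    · rw [if_neg h]; split_ifs <;> linarith

include ha hb in
-- The Kraft inequality with the sum over the replies to one question: 1 for the true reply, `a` for
-- each string and `b` for each label in `I`.
theorem sum_leaves_prod_labelWeight_le {r : ℕ} (hg : ∀ v f, (g v).calls f ≤ r)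
    (f : Bits n → Bits n) :
    ∑ v, ∑ L ∈ leaves (g v) ∅, ∏ p ∈ L.1,
        ((if f p.1 = p.2 then 1 else 0) + labelWeight a b I p.2) ≤
      2 ^ m * (1 + 2 ^ n * a + (Finset.univ.filter fun z => z ∈ I).card * b) ^ r := by
  have h0 : 0 ≤ 2 ^ n * a + (Finset.univ.filter fun z => z ∈ I).card * b := by positivity
  have h : ∀ v ∈ (Finset.univ : Finset (Bits m)), ∑ L ∈ leaves (g v) ∅, ∏ p ∈ L.1,
      ((if f p.1 = p.2 then 1 else 0) + labelWeight a b I p.2) ≤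
      (1 + 2 ^ n * a + (Finset.univ.filter fun z => z ∈ I).card * b) ^ r := by
    intro v _
    have := OracleAlg.sum_leaves_prod_le
      (ρ := fun p => (if f p.1 = p.2 then 1 else 0) + labelWeight a b I p.2)
      (fun p => by
        have : (0 : ℝ) ≤ if f p.1 = p.2 then 1 else 0 := by split_ifs <;> norm_num
        exact add_nonneg this (labelWeight_nonneg I ha hb _))
      (R := 1 + 2 ^ n * a + (Finset.univ.filter fun z => z ∈ I).card * b) (by linarith)
      (fun x => by
        simp only [labelWeight, Finset.sum_add_distrib, Finset.sum_ite_eq, Finset.mem_univ, if_true,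
          Finset.sum_const, Finset.card_univ, card_bits, nsmul_eq_mul, ← Finset.sum_filter]
        push_cast
        linarith) (by linarith) (g v) OracleAlg.isMatching_empty (d := r)
      (fun L hL => by
        simpa using OracleAlg.card_le_of_mem_leaves (g v) (hg v) hL)
    simpa using this
  refine (Finset.sum_le_card_nsmul _ _ _ h).trans (le_of_eq ?_)
  rw [Finset.card_univ, card_bits, nsmul_eq_mul]
  push_cast; rfl

end Planted

/-! ### The random breaker: risky queries and accepted strings -/

section PlantedSystem
open scoped Classical
open OracleAlg (leaves Extends IsMatching)
variable {n m l : ℕ} (g : Bits m → OracleAlg (Bits n) (fun _ => Bits n) (Bits l)) {a b θ : ℝ}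
  {Ω : Type} [Fintype Ω] [DecidableEq Ω] (S₀ : WitnessSystem n l Ω)

/-- The system whose witnesses are those of a set of plantings. -/
abbrev plantedSystem (T : Finset (Planting n m l)) : WitnessSystem n l Ω :=
  S₀.withWit (plantedWit g T)

/-- The plantings with output `w` that are part of the function and avoid the label `y`. -/
noncomputable def presentPlantings (π : Equiv.Perm Ω) (y : Ω) (w : Bits l) :
    Finset (Planting n m l) :=
  Finset.univ.filter fun j => j.Valid g ∧ j.2.1.2 = w ∧
    ∀ p ∈ j.2.2, S₀.lab (π (S₀.P p.1)) = p.2 ∧ π (S₀.P p.1) ≠ y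

/-- The plantings with output `w` that are part of the function up to a pair with label `y`. -/
noncomputable def criticalPlantings (π : Equiv.Perm Ω) (y : Ω) (w : Bits l) :
    Finset (Planting n m l) :=
  Finset.univ.filter fun j => j.Valid g ∧ j.2.1.2 = w ∧ (∃ x, (x, S₀.lab y) ∈ j.2.2) ∧
    ∀ p ∈ j.2.2, p.2 ≠ S₀.lab y → S₀.lab (π (S₀.P p.1)) = p.2

/-- A planting that agrees with the function and avoids `y` would get the query accepted. So every
critical position comes from a chosen planting that contains the label `y`, and can be read off from
it. -/
theorem disjoint_of_risky {D : ℕ} {π : Equiv.Perm Ω} {y : Ω} {w : Bits l}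
    {T : Finset (Planting n m l)} (h : (plantedSystem g S₀ T).Risky D π y w) :
    Disjoint T (presentPlantings g S₀ π y w) ∧ D < (T ∩ criticalPlantings g S₀ π y w).card := by
  obtain ⟨hno, hD⟩ := h
  have hdisj : Disjoint T (presentPlantings g S₀ π y w) := by
    refine Finset.disjoint_left.2 fun j hjT hj => hno ?_
    simp only [presentPlantings, Finset.mem_filter, Finset.mem_univ, true_and] at hj
    exact ⟨j.2.2, ⟨j, hjT, hj.1, hj.2.1, rfl⟩, hj.2.2⟩
  refine ⟨hdisj, hD.trans_le ?_⟩
  refine (Finset.card_le_card (t := (T ∩ criticalPlantings g S₀ π y w).image fun j =>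
    if h : ∃ x, (x, S₀.lab y) ∈ j.2.2 then S₀.P h.choose else y) fun c hc => ?_).trans
      Finset.card_image_le
  simp only [WitnessSystem.critical, Finset.mem_filter, Finset.mem_univ, true_and] at hc
  obtain ⟨K, ⟨j, hjT, hjV, hjw, rfl⟩, hK⟩ := hc
  have hex : ∃ x, (x, S₀.lab y) ∈ j.2.2 := by
    by_contra hnex
    push Not at hnex
    refine Finset.disjoint_left.1 hdisj hjT ?_
    simp only [presentPlantings, Finset.mem_filter, Finset.mem_univ, true_and]
    refine ⟨hjV, hjw, fun p hp => ?_⟩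
    rcases hK p hp with ⟨h1, _⟩ | ⟨h1, h2⟩
    · exact absurd (show (p.1, S₀.lab y) ∈ j.2.2 by
        rw [show S₀.lab y = p.2 from h1.symm]; exact hp) (hnex _)
    · exact ⟨h2, fun e => h1 (h2.symm.trans (congrArg S₀.lab e))⟩
  refine Finset.mem_image.2 ⟨j, Finset.mem_inter.2 ⟨hjT, ?_⟩, ?_⟩
  · simp only [criticalPlantings, Finset.mem_filter, Finset.mem_univ, true_and]
    refine ⟨hjV, hjw, hex, fun p hp hne => ?_⟩
    rcases hK p hp with ⟨h1, _⟩ | ⟨_, h2⟩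
    · exact absurd h1 hne
    · exact h2
  · rw [dif_pos hex]
    rcases hK _ hex.choose_spec with ⟨_, h2⟩ | ⟨h1, _⟩
    · exact h2
    · exact absurd rfl h1

variable (ha : 0 ≤ a) (hb : 0 ≤ b) (hab : a + b ≤ 1) (hθ : 1 ≤ θ)

include ha hb hθ in
/-- Removing the pair with label `y` turns critical plantings into present ones of only slightly
smaller probability. -/
theorem sum_criticalPlantings_le (π : Equiv.Perm Ω) (y : Ω) (w : Bits l) :
    b * ∑ j ∈ criticalPlantings g S₀ π y w, plantingProb g a b θ (Set.range S₀.lab) j ≤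
      ∑ j ∈ presentPlantings g S₀ π y w, plantingProb g a b θ (Set.range S₀.lab) j := by
  -- Transcripts are matchings, so `φ` removes exactly one pair from a critical planting. The
  -- transcript itself is kept and tells which one, so `φ` is injective.
  set φ : Planting n m l → Planting n m l := fun j =>
    (j.1, j.2.1, j.2.2.filter fun p => p.2 ≠ S₀.lab y) with hφ
  have hmatch : ∀ j : Planting n m l, j.Valid g → IsMatching j.2.1.1 := fun j hj =>
    (OracleAlg.leaves_subset_isMatching _ OracleAlg.isMatching_empty hj.1).2
  have hinsert : ∀ j ∈ criticalPlantings g S₀ π y w, ∀ x, (x, S₀.lab y) ∈ j.2.1.1 →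
      j.2.2 = insert (x, S₀.lab y) (φ j).2.2 ∧ (x, S₀.lab y) ∈ j.2.2 := by
    intro j hj x hx
    simp only [criticalPlantings, Finset.mem_filter, Finset.mem_univ, true_and] at hj
    obtain ⟨hV, _, ⟨x', hx'⟩, _⟩ := hj
    have hm := hmatch j hV
    have hxx : (x, S₀.lab y) ∈ j.2.2 := by
      rw [hm.2 _ hx _ (hV.2 hx') rfl]; exact hx'
    refine ⟨?_, hxx⟩
    ext p
    simp only [hφ, Finset.mem_insert, Finset.mem_filter]
    constructor
    · intro hp
      by_cases e : p.2 = S₀.lab y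
      · exact Or.inl (hm.2 _ (hV.2 hp) _ hx e)
      · exact Or.inr ⟨hp, e⟩
    · rintro (rfl | h)
      · exact hxx
      · exact h.1
  have hex : ∀ j ∈ criticalPlantings g S₀ π y w, ∃ x, (x, S₀.lab y) ∈ j.2.1.1 := by
    intro j hj
    simp only [criticalPlantings, Finset.mem_filter, Finset.mem_univ, true_and] at hj
    obtain ⟨hV, _, ⟨x', hx'⟩, _⟩ := hj
    exact ⟨x', hV.2 hx'⟩
  have hinj : Set.InjOn φ (criticalPlantings g S₀ π y w) := by
    intro j hj j' hj' e
    obtain ⟨x, hx⟩ := hex j hj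
    have e1 : (φ j).1 = (φ j').1 := by rw [e]
    have e2 : (φ j).2.1 = (φ j').2.1 := by rw [e]
    have e3 : (φ j).2.2 = (φ j').2.2 := by rw [e]
    change j.1 = j'.1 at e1
    change j.2.1 = j'.2.1 at e2
    refine Prod.ext e1 (Prod.ext e2 ?_)
    rw [(hinsert j hj x hx).1, (hinsert j' hj' x (e2 ▸ hx)).1, e3]
  have hsub : (criticalPlantings g S₀ π y w).image φ ⊆ presentPlantings g S₀ π y w := by
    intro j' hj'
    obtain ⟨j, hj, rfl⟩ := Finset.mem_image.1 hj'
    simp only [criticalPlantings, Finset.mem_filter, Finset.mem_univ, true_and] at hj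
    simp only [presentPlantings, Finset.mem_filter, Finset.mem_univ, true_and]
    refine ⟨⟨hj.1.1, (Finset.filter_subset _ _).trans hj.1.2⟩, hj.2.1, fun p hp => ?_⟩
    simp only [hφ, Finset.mem_filter] at hp
    have := hj.2.2.2 p hp.1 hp.2
    exact ⟨this, fun e => hp.2 (this.symm.trans (congrArg S₀.lab e))⟩
  calc b * ∑ j ∈ criticalPlantings g S₀ π y w, plantingProb g a b θ (Set.range S₀.lab) j
      ≤ ∑ j ∈ criticalPlantings g S₀ π y w, plantingProb g a b θ (Set.range S₀.lab) (φ j) := by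
        rw [Finset.mul_sum]
        refine Finset.sum_le_sum fun j hj => ?_
        obtain ⟨x, hx⟩ := hex j hj
        obtain ⟨h1, h2⟩ := hinsert j hj x hx
        have hV : j.Valid g := by
          simp only [criticalPlantings, Finset.mem_filter, Finset.mem_univ, true_and] at hj
          exact hj.1
        have hV' : (φ j).Valid g := ⟨hV.1, (Finset.filter_subset _ _).trans hV.2⟩
        have hnot : (x, S₀.lab y) ∉ j.2.1.1 \ j.2.2 := fun h => (Finset.mem_sdiff.1 h).2 h2
        have hsd : (φ j).2.1.1 \ (φ j).2.2 = insert (x, S₀.lab y) (j.2.1.1 \ j.2.2) := by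
          have hx' : (x, S₀.lab y) ∉ (φ j).2.2 := by simp [hφ]
          rw [h1]
          ext p
          simp only [Finset.mem_sdiff, Finset.mem_insert]
          change (p ∈ j.2.1.1 ∧ p ∉ (φ j).2.2) ↔ _
          by_cases hp : p = (x, S₀.lab y)
          · subst hp; simp [hx, hx']
          · simp [hp]
        rw [plantingProb, plantingProb, if_pos hV, if_pos hV', hsd, Finset.prod_insert hnot]
        have h3 : b ≤ labelWeight a b (Set.range S₀.lab) (S₀.lab y) := by
          rw [labelWeight, if_pos (Set.mem_range_self y)]; linarith
        have h4 : 0 ≤ ∏ p ∈ j.2.1.1 \ j.2.2, labelWeight a b (Set.range S₀.lab) p.2 :=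
          Finset.prod_nonneg fun p _ => labelWeight_nonneg _ ha hb _
        have h5 : 0 ≤ θ⁻¹ := by positivity
        calc _ = θ⁻¹ * (b * ∏ p ∈ j.2.1.1 \ j.2.2, labelWeight a b (Set.range S₀.lab) p.2) := by
              ring
          _ ≤ _ := mul_le_mul_of_nonneg_left (mul_le_mul_of_nonneg_right h3 h4) h5
    _ = ∑ j ∈ (criticalPlantings g S₀ π y w).image φ,
          plantingProb g a b θ (Set.range S₀.lab) j := (Finset.sum_image hinj).symm
    _ ≤ _ := Finset.sum_le_sum_of_subset_of_nonneg hsub fun j _ _ =>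
        plantingProb_nonneg g _ ha hb hθ j

include ha hab hθ in
/-- Risky queries are unlikely. -/
theorem sum_risky_planted_le (hb : 0 < b) (π : Equiv.Perm Ω) (y : Ω) (w : Bits l) (D : ℕ) {ν : ℝ}
    (hD : b⁻¹ * ν + ν ≤ D * Real.log 2) :
    ∑ T, (if (plantedSystem g S₀ T).Risky D π y w then
      bernoulliWeight (plantingProb g a b θ (Set.range S₀.lab)) T else 0) ≤ Real.exp (-ν) := by
  set p := plantingProb g a b θ (Set.range S₀.lab) with hp
  have h0 : ∀ j, 0 ≤ p j := plantingProb_nonneg g _ ha hb.le hθ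
  have h1 : ∀ j, p j ≤ 1 := plantingProb_le_one g _ ha hb.le hab hθ
  -- Either at least `ν` present plantings are expected, and with probability at least `1 - exp
  -- (-ν)` one is chosen and `w` is accepted without `y`; or at most `b⁻¹ * ν` critical plantings
  -- are expected, and more than `D` are unlikely to be chosen.
  by_cases hν : ν ≤ ∑ j ∈ presentPlantings g S₀ π y w, p j
  · refine le_trans (Finset.sum_le_sum fun T _ => ?_)
      ((sum_bernoulliWeight_disjoint_le h0 h1 (presentPlantings g S₀ π y w)).trans
        (Real.exp_le_exp.2 (neg_le_neg hν)))
    have := bernoulliWeight_nonneg h0 h1 T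
    by_cases hr : (plantedSystem g S₀ T).Risky D π y w
    · rw [if_pos hr, if_pos (disjoint_of_risky g S₀ hr).1]
    · rw [if_neg hr]; split_ifs <;> simp [this]
  · push Not at hν
    have h2 := sum_criticalPlantings_le g S₀ ha hb.le hθ π y w
    have h3 : ∑ j ∈ criticalPlantings g S₀ π y w, p j ≤ b⁻¹ * ν := by
      rw [← div_eq_inv_mul, le_div_iff₀ hb, mul_comm]
      exact h2.trans hν.le
    refine le_trans (Finset.sum_le_sum fun T _ => ?_)
      ((sum_bernoulliWeight_card_gt_le h0 h1 (criticalPlantings g S₀ π y w) D).trans ?_)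
    · have := bernoulliWeight_nonneg h0 h1 T
      by_cases hr : (plantedSystem g S₀ T).Risky D π y w
      · rw [if_pos hr, if_pos (disjoint_of_risky g S₀ hr).2]
      · rw [if_neg hr]; split_ifs <;> simp [this]
    · have h4 : (2 : ℝ) ^ D = Real.exp (D * Real.log 2) := by
        rw [Real.exp_nat_mul, Real.exp_log (by norm_num)]
      rw [h4, ← Real.exp_sub]
      exact Real.exp_le_exp.2 (by linarith)

theorem card_range_lab [DecidablePred fun z => z ∈ Set.range S₀.lab] :
    (Finset.univ.filter fun z => z ∈ Set.range S₀.lab).card = Fintype.card Ω := by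
  rw [← Finset.card_univ, ← Finset.card_map ⟨S₀.lab, S₀.lab_injective⟩]
  congr 1
  ext z
  simp

include ha hb hab hθ in
/-- Heavy seeds are accepted with probability at least one half. -/
theorem half_le_sum_accept (π : Equiv.Perm Ω) {v : Bits m}
    (hv : HeavySeed g a b θ (S₀.fn π) v) :
    1 / 2 ≤ ∑ T, (if (plantedSystem g S₀ T).breaker π ((g v).run (S₀.fn π)) = true then
      bernoulliWeight (plantingProb g a b θ (Set.range S₀.lab)) T else 0) := by
  set p := plantingProb g a b θ (Set.range S₀.lab) with hp
  have h0 : ∀ j, 0 ≤ p j := plantingProb_nonneg g _ ha hb hθ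
  have h1 : ∀ j, p j ≤ 1 := plantingProb_le_one g _ ha hb hab hθ
  obtain ⟨L, hL, hLf, hθL⟩ := hv
  have hrun := (OracleAlg.leaves_run_calls (g v) hL OracleAlg.isMatching_empty hLf).1
  rw [← hrun]
  set A : Finset (Planting n m l) := Finset.univ.filter fun j =>
    j.Valid g ∧ j.2.1.2 = L.2 ∧ Extends (S₀.fn π) j.2.2 with hA
  -- Heaviness means that at least one accepting planting is expected; then none is chosen with
  -- probability at most `exp (-1) < 1 / 2`.
  have hsum : 1 ≤ ∑ j ∈ A, p j := by
    have e := sum_plantingProb_extends (a := a) (b := b) (θ := θ) g (Set.range S₀.lab) (S₀.fn π)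
      (fun w => w = L.2)
    have e2 : ∑ j ∈ A, p j = ∑ j : Planting n m l, (if j.2.1.2 = L.2 ∧ Extends (S₀.fn π) j.2.2 then
        plantingProb g a b θ (Set.range S₀.lab) j else 0) := by
      rw [hA, Finset.sum_filter]
      refine Finset.sum_congr rfl fun j _ => ?_
      by_cases hV : j.Valid g
      · simp [hV, hp]
      · simp [hV, plantingProb]
    rw [e2, e]
    have h2 := refWeight_le g (Set.range S₀.lab) ha hb (f := S₀.fn π)
      (fun x => Set.mem_range_self _) hLf L.2
    have hθ0 : 0 < θ := by linarith
    rw [← div_eq_inv_mul, le_div_iff₀ hθ0, one_mul]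
    exact hθL.trans h2
  have hd := sum_bernoulliWeight_disjoint_le h0 h1 A
  have htot := sum_bernoulliWeight p
  have hsplit : ∀ T, bernoulliWeight p T ≤
      (if (plantedSystem g S₀ T).breaker π L.2 = true then bernoulliWeight p T else 0) +
      if Disjoint T A then bernoulliWeight p T else 0 := by
    intro T
    have hw := bernoulliWeight_nonneg h0 h1 T
    by_cases hT : Disjoint T A
    · rw [if_pos hT]; split_ifs <;> linarith
    · obtain ⟨j, hj, hjA⟩ := Finset.not_disjoint_iff.1 hT
      simp only [hA, Finset.mem_filter, Finset.mem_univ, true_and] at hjA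
      have hacc : (plantedSystem g S₀ T).breaker π L.2 = true :=
        decide_eq_true (⟨j.2.2, ⟨j, hj, hjA.1, hjA.2.1, rfl⟩, fun q hq =>
          ⟨hjA.2.2 q hq, by simp⟩⟩ : (plantedSystem g S₀ T).Holds π ∅ L.2)
      rw [if_pos hacc, if_neg hT, add_zero]
  have h3 := Finset.sum_le_sum fun T (_ : T ∈ Finset.univ) => hsplit T
  rw [htot, Finset.sum_add_distrib] at h3
  have h4 : Real.exp (-∑ j ∈ A, p j) ≤ 1 / 2 := by
    refine (Real.exp_le_exp.2 (neg_le_neg hsum)).trans ?_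
    have := Real.exp_neg_one_lt_d9
    linarith
  linarith

include ha hb hab hθ in
/-- Few strings are accepted. -/
theorem sum_accept_le {r : ℕ} (hg : ∀ v f, (g v).calls f ≤ r)
    (hθr : 50 * (1 + 2 ^ n * a + Fintype.card Ω * b) ^ r ≤ θ) (π : Equiv.Perm Ω) :
    ∑ T, bernoulliWeight (plantingProb g a b θ (Set.range S₀.lab)) T *
      ((Finset.univ.filter fun w => (plantedSystem g S₀ T).breaker π w = true).card : ℝ) ≤
        2 ^ m / 50 := by
  set p := plantingProb g a b θ (Set.range S₀.lab) with hp
  have h0 : ∀ j, 0 ≤ p j := plantingProb_nonneg g _ ha hb hθ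
  have h1 : ∀ j, p j ≤ 1 := plantingProb_le_one g _ ha hb hab hθ
  set A : Finset (Planting n m l) := Finset.univ.filter fun j =>
    j.Valid g ∧ Extends (S₀.fn π) j.2.2 with hA
  have hcard : ∀ T, (Finset.univ.filter fun w =>
      (plantedSystem g S₀ T).breaker π w = true).card ≤ (T ∩ A).card := by
    intro T
    refine (Finset.card_le_card (t := (T ∩ A).image fun j => j.2.1.2) fun w hw => ?_).trans
      Finset.card_image_le
    simp only [Finset.mem_filter, Finset.mem_univ, true_and, WitnessSystem.breaker,
      decide_eq_true_eq] at hw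
    obtain ⟨K, ⟨j, hj, hV, hw, rfl⟩, hK⟩ := hw
    refine Finset.mem_image.2 ⟨j, Finset.mem_inter.2 ⟨hj, ?_⟩, hw⟩
    simp only [hA, Finset.mem_filter, Finset.mem_univ, true_and]
    exact ⟨hV, fun q hq => (hK q hq).1⟩
  have h2 : ∑ T, bernoulliWeight p T * ((T ∩ A).card : ℝ) = ∑ j ∈ A, p j := by
    rw [← Finset.sum_congr rfl fun j _ => sum_bernoulliWeight_mem p j, Finset.sum_comm]
    refine Finset.sum_congr rfl fun T _ => ?_
    rw [← Finset.sum_filter, Finset.sum_const, nsmul_eq_mul, mul_comm]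
    congr 3
    ext j
    simp [and_comm]
  have h3 : ∑ j ∈ A, p j ≤ 2 ^ m / 50 := by
    have e := sum_plantingProb_extends (a := a) (b := b) (θ := θ) g (Set.range S₀.lab) (S₀.fn π)
      (fun _ => True)
    have e2 : ∑ j ∈ A, p j = ∑ j : Planting n m l, (if True ∧ Extends (S₀.fn π) j.2.2 then
        plantingProb g a b θ (Set.range S₀.lab) j else 0) := by
      rw [hA, Finset.sum_filter]
      refine Finset.sum_congr rfl fun j _ => ?_
      by_cases hV : j.Valid g
      · simp [hV, hp]
      · simp [hV, plantingProb]
    rw [e2, e]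
    simp only [Finset.filter_true]
    have h4 := sum_leaves_prod_labelWeight_le g (Set.range S₀.lab) ha hb hg (S₀.fn π)
    rw [card_range_lab] at h4
    have hθ0 : 0 < θ := by linarith
    rw [← div_eq_inv_mul, div_le_div_iff₀ hθ0 (by norm_num)]
    calc _ ≤ 2 ^ m * (1 + 2 ^ n * a + Fintype.card Ω * b) ^ r * 50 :=
          mul_le_mul_of_nonneg_right h4 (by norm_num)
      _ = 2 ^ m * (50 * (1 + 2 ^ n * a + Fintype.card Ω * b) ^ r) := by ring
      _ ≤ _ := mul_le_mul_of_nonneg_left hθr (by positivity)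
  refine le_trans (Finset.sum_le_sum fun T _ => ?_) (h2.le.trans h3)
  exact mul_le_mul_of_nonneg_left (by exact_mod_cast hcard T) (bernoulliWeight_nonneg h0 h1 T)

end PlantedSystem

/-! ### Hard instances when heavy seeds are frequent -/

/-- Averaging over a finite weighted space. -/
theorem exists_notMem_of_average {ι : Type*} [Fintype ι] (w v : ι → ℝ) (hw : ∀ i, 0 ≤ w i)
    (hv : ∀ i, v i ≤ 1) (F : ι → Prop) [DecidablePred F] {W : ℝ} (hW : ∑ i, w i = W) (hW0 : 0 < W)
    (hF : ∑ i, (if F i then w i else 0) ≤ W / 50) (hav : W / 25 ≤ ∑ i, w i * v i) :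
    ∃ i, ¬ F i ∧ 1 / 100 ≤ v i := by
  by_contra hno
  push Not at hno
  -- Otherwise the average would be at most `1 / 100 + 1 / 50`, which is less than `1 / 25`.
  have : ∀ i, w i * v i ≤ w i * (1 / 100) + if F i then w i else 0 := by
    intro i
    by_cases h : F i
    · rw [if_pos h]
      have := mul_le_mul_of_nonneg_left (hv i) (hw i)
      have := hw i
      linarith
    · rw [if_neg h, add_zero]
      exact mul_le_mul_of_nonneg_left (hno i h).le (hw i)
  have h := Finset.sum_le_sum fun i (_ : i ∈ Finset.univ) => this i
  rw [Finset.sum_add_distrib, ← Finset.sum_mul, hW] at h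
  linarith

theorem adv_le_one {n m l : ℕ} (g : Bits m → OracleAlg (Bits n) (fun _ => Bits n) (Bits l))
    (f : Bits n → Bits n) (B : Bits l → Bool) : adv g f B ≤ 1 := by
  unfold adv
  have := prob_le_one (PMF.uniformOfFintype (Bits m)) fun v => B ((g v).run f) = true
  have := prob_nonneg (PMF.uniformOfFintype (Bits l)) fun w => B w = true
  linarith

theorem adv_eq {n m l : ℕ} (g : Bits m → OracleAlg (Bits n) (fun _ => Bits n) (Bits l))
    (f : Bits n → Bits n) (B : Bits l → Bool) :
    adv g f B = ((Finset.univ.filter fun v => B ((g v).run f) = true).card : ℝ) / 2 ^ m -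
      ((Finset.univ.filter fun w => B w = true).card : ℝ) / 2 ^ l := by
  rw [adv, prob_uniform, prob_uniform, card_bits, card_bits]
  push_cast
  rfl

section Heavy
open scoped Classical
open OracleAlg (leaves Extends IsMatching)
variable {n m l : ℕ} (g : Bits m → OracleAlg (Bits n) (fun _ => Bits n) (Bits l)) {a b θ : ℝ}
  {Ω : Type} [Fintype Ω] [DecidableEq Ω]

/-- If heavy seeds are frequent, a random planting gives a breaker that does not help to invert. -/
theorem exists_of_heavySeeds [Nonempty Ω] (S₀ : WitnessSystem n l Ω) (hS : S₀.Balanced)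
    {C : Type} (coins : PMF C) {r s D : ℕ}
    (A : C → Bits s → Bits n → OracleAlg (Bits l ⊕ Bits n) (Reply l n) (Bits n))
    (hn : 1 ≤ n) (hs1 : 1 ≤ s) (hs : ∀ ω h y B f, (A ω h y).calls (pairOracle B f) ≤ s)
    (hg : ∀ v f, (g v).calls f ≤ r) (hml : m < l)
    (ha : 0 ≤ a) (hb : 0 < b) (hab : a + b ≤ 1) (hθ : 1 ≤ θ)
    (hθr : 50 * (1 + 2 ^ n * a + Fintype.card Ω * b) ^ r ≤ θ)
    (hheavy : 1 / 10 * (2 ^ m * ((Fintype.card Ω).factorial : ℝ)) ≤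
      ∑ π : Equiv.Perm Ω, ((Finset.univ.filter fun v => HeavySeed g a b θ (S₀.fn π) v).card : ℝ))
    (hq : 64 * s ^ 2 * (2 + s * (2 * r + D + 1)) ≤ Fintype.card Ω) {ν : ℝ}
    (hD : b⁻¹ * ν + ν ≤ D * Real.log 2)
    (hsmall : (2 : ℝ) ^ s * ((1 / 2) ^ (16 * s) + 4 * s * ((2 ^ n + 1) ^ s * Real.exp (-ν))) ≤
      1 / 50) :
    ∃ f B, IsRegularFun f ∧
      (∀ h : Bits s, WitnessSystem.invProb coins (fun ω => A ω h) f B ≤ 1 / s) ∧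
      1 / 100 ≤ adv g f B := by
  set p : Planting n m l → ℝ := plantingProb g a b θ (Set.range S₀.lab) with hp
  have h0 : ∀ j, 0 ≤ p j := plantingProb_nonneg g _ ha hb.le hθ
  have h1 : ∀ j, p j ≤ 1 := plantingProb_le_one g _ ha hb.le hab hθ
  set wt : Finset (Planting n m l) → ℝ := bernoulliWeight p with hwt
  have hwt0 : ∀ T, 0 ≤ wt T := bernoulliWeight_nonneg h0 h1
  have hwt1 : ∑ T, wt T = 1 := sum_bernoulliWeight p
  set N : ℝ := ((Fintype.card Ω).factorial : ℝ) with hN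
  have hN0 : 0 < N := by positivity
  have hperm : (Fintype.card (Equiv.Perm Ω) : ℝ) = N := by rw [Fintype.card_perm]
  have hfail := S₀.sum_invert_le hS wt hwt0 (plantedWit g) coins A hn hs1 hs (r := r) (D := D)
    (by
      rintro T w K ⟨j, _, hV, _, rfl⟩
      exact (Finset.card_le_card hV.2).trans (OracleAlg.card_le_of_mem_leaves _ (hg _) hV.1))
    hq (β := N * Real.exp (-ν)) (by
      intro y w
      rw [Finset.sum_comm]
      refine (Finset.sum_le_card_nsmul _ _ _ fun π _ =>
        sum_risky_planted_le g S₀ ha hab hθ hb π y w D hD).trans (le_of_eq ?_)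
      rw [Finset.card_univ, nsmul_eq_mul, hperm]) (by positivity)
  obtain ⟨⟨T, π⟩, hT, hadv⟩ := exists_notMem_of_average
    (ι := Finset (Planting n m l) × Equiv.Perm Ω) (fun i => wt i.1)
    (fun i => adv g (S₀.fn i.2) ((plantedSystem g S₀ i.1).breaker i.2)) (fun i => hwt0 i.1)
    (fun i => adv_le_one _ _ _) (fun i => ∃ h : Bits s, 1 / (s : ℝ) <
      WitnessSystem.invProb coins (fun ω => A ω h) (S₀.fn i.2)
        ((plantedSystem g S₀ i.1).breaker i.2)) (W := N)
    (by
      rw [Fintype.sum_prod_type]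
      simp only [Finset.sum_const, Finset.card_univ, nsmul_eq_mul, hperm, ← Finset.mul_sum, hwt1,
        mul_one]) hN0 (by
      rw [Fintype.sum_prod_type]
      refine le_trans (le_of_eq ?_) (hfail.trans ?_)
      · refine Finset.sum_congr rfl fun T _ => ?_
        dsimp only
        rw [← Finset.sum_filter, Finset.sum_const, nsmul_eq_mul, mul_comm]
        rfl
      · rw [hwt1, one_mul]
        calc _ = N * (2 ^ s * ((1 / 2) ^ (16 * s) +
              4 * s * ((2 ^ n + 1) ^ s * Real.exp (-ν)))) := by ring
          _ ≤ N * (1 / 50) := mul_le_mul_of_nonneg_left hsmall hN0.le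
          _ = _ := by ring) (by
      rw [Fintype.sum_prod_type, Finset.sum_comm]
      -- A heavy seed is accepted with probability 1/2, and of all `2 ^ l ≥ 2 * 2 ^ m` strings at
      -- most `2 ^ m / 50` are accepted in expectation. As heavy seeds have density 1/10, the
      -- average advantage is at least `1 / 20 - 1 / 100 = 1 / 25`.
      have key : ∀ π : Equiv.Perm Ω,
          (1 / 2) * ((Finset.univ.filter fun v => HeavySeed g a b θ (S₀.fn π) v).card : ℝ) / 2 ^ m -
            1 / 100 ≤
          ∑ T, wt T * adv g (S₀.fn π) ((plantedSystem g S₀ T).breaker π) := by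
        intro π
        simp only [adv_eq, mul_sub, Finset.sum_sub_distrib, ← mul_div_assoc, ← Finset.sum_div]
        refine sub_le_sub (div_le_div_of_nonneg_right ?_ (by positivity)) ?_
        · have h2 : ∀ T, wt T * ((Finset.univ.filter fun v =>
              (plantedSystem g S₀ T).breaker π ((g v).run (S₀.fn π)) = true).card : ℝ) =
              ∑ v, if (plantedSystem g S₀ T).breaker π ((g v).run (S₀.fn π)) = true then wt T
                else 0 := by
            intro T
            rw [← Finset.sum_filter, Finset.sum_const, nsmul_eq_mul, mul_comm]
          rw [Finset.sum_congr rfl fun T _ => h2 T, Finset.sum_comm]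
          calc (1 / 2) * ((Finset.univ.filter fun v => HeavySeed g a b θ (S₀.fn π) v).card : ℝ)
              = ∑ v ∈ Finset.univ.filter fun v => HeavySeed g a b θ (S₀.fn π) v, (1 / 2 : ℝ) := by
                rw [Finset.sum_const, nsmul_eq_mul, mul_comm]
            _ ≤ ∑ v ∈ Finset.univ.filter fun v => HeavySeed g a b θ (S₀.fn π) v, ∑ T,
                  (if (plantedSystem g S₀ T).breaker π ((g v).run (S₀.fn π)) = true then wt T
                    else 0) :=
                Finset.sum_le_sum fun v hv =>
                  half_le_sum_accept g S₀ ha hb.le hab hθ π (Finset.mem_filter.1 hv).2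
            _ ≤ _ := Finset.sum_le_sum_of_subset_of_nonneg (Finset.filter_subset _ _)
                fun v _ _ => Finset.sum_nonneg fun T _ => by
                  split_ifs
                  · exact hwt0 T
                  · exact le_rfl
        · rw [div_le_div_iff₀ (by positivity) (by norm_num)]
          have h3 := sum_accept_le g S₀ ha hb.le hab hθ hg hθr π
          have h4 : (2 : ℝ) ^ m * 2 ≤ 2 ^ l := by
            rw [← pow_succ]; exact pow_le_pow_right₀ (by norm_num) hml
          linarith
      refine le_trans ?_ (Finset.sum_le_sum fun π _ => key π)
      rw [Finset.sum_sub_distrib, ← Finset.sum_div, ← Finset.mul_sum, Finset.sum_const,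
        Finset.card_univ, nsmul_eq_mul, hperm]
      have h5 : N / 20 ≤ 1 / 2 * ∑ π : Equiv.Perm Ω,
          ((Finset.univ.filter fun v => HeavySeed g a b θ (S₀.fn π) v).card : ℝ) / 2 ^ m := by
        rw [← Finset.sum_div, ← mul_div_assoc, le_div_iff₀ (by positivity)]
        linarith
      rw [← Finset.sum_div] at h5
      rw [mul_div_assoc]
      linarith)
  refine ⟨S₀.fn π, (plantedSystem g S₀ T).breaker π, hS.isRegularFun π, ?_, hadv⟩
  push Not at hT
  exact hT

/-- The transcripts of weight at least `θ`. -/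
noncomputable def heavyLeaves (a b θ : ℝ) (v : Bits m) :
    Finset (Finset (Bits n × Bits n) × Bits l) :=
  (leaves (g v) ∅).filter fun L => θ ≤ refWeight g a b L.1 L.2

/-- By `leaves_unique` a seed has at most one leaf contained in `f`. Together with
`card_heavySeed_le`, heavy seeds are counted by heavy leaves, so two distributions of `f` can be
compared transcript by transcript. -/
theorem sum_extends_le_card_heavySeed (f : Bits n → Bits n) :
    ∑ v, ∑ L ∈ heavyLeaves g a b θ v, (if Extends f L.1 then 1 else 0) ≤
      (Finset.univ.filter fun v => HeavySeed g a b θ f v).card := by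
  rw [Finset.card_filter]
  refine Finset.sum_le_sum fun v _ => ?_
  rw [← Finset.card_filter]
  split_ifs with h
  · refine Finset.card_le_one.2 fun L hL L' hL' => ?_
    simp only [heavyLeaves, Finset.mem_filter] at hL hL'
    exact OracleAlg.leaves_unique (g v) OracleAlg.isMatching_empty hL.1.1 hL'.1.1 hL.2 hL'.2
  · refine le_of_eq (Finset.card_eq_zero.2 (Finset.filter_eq_empty_iff.2 fun L hL hf => h ?_))
    simp only [heavyLeaves, Finset.mem_filter] at hL
    exact ⟨L, hL.1, hf, hL.2⟩

theorem card_heavySeed_le (f : Bits n → Bits n) :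
    (Finset.univ.filter fun v => HeavySeed g a b θ f v).card ≤
      ∑ v, ∑ L ∈ heavyLeaves g a b θ v, (if Extends f L.1 then 1 else 0) := by
  rw [Finset.card_filter]
  refine Finset.sum_le_sum fun v _ => ?_
  rw [← Finset.card_filter]
  split_ifs with h
  · obtain ⟨L, hL, hf, hθ⟩ := h
    exact Finset.card_pos.2 ⟨L, by simp [heavyLeaves, hL, hθ, hf]⟩
  · exact Nat.zero_le _

/-- Frequent heavy seeds for random permutations give frequent heavy seeds for some system of
functions that factor through `Ω`. -/
theorem exists_system_heavySeeds {r : ℕ} (hg : ∀ v f, (g v).calls f ≤ r) {P : Bits n → Ω} {c : ℕ}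
    (hP : ∀ y, (Finset.univ.filter fun x => P x = y).card = c) {e : Ω → Bits n}
    (he : Function.Injective e) (hr : 2 * r ^ 2 ≤ Fintype.card Ω) :
    ∃ S₀ : WitnessSystem n l Ω, S₀.Balanced ∧ (Fintype.card Ω).factorial *
      ∑ π : Equiv.Perm (Bits n), (Finset.univ.filter fun v => HeavySeed g a b θ π v).card ≤
      2 * (2 ^ n).factorial *
        ∑ π : Equiv.Perm Ω, (Finset.univ.filter fun v => HeavySeed g a b θ (S₀.fn π) v).card := by
  -- The function is `τ ∘ e ∘ π ∘ P ∘ κ`. The comparison with random permutations holds on average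
  -- over `τ` and `κ`, so some choice of the two attains it and can be fixed.
  set sys : Equiv.Perm (Bits n) → Equiv.Perm (Bits n) → WitnessSystem n l Ω := fun τ κ =>
    { P := fun x => P (κ x), lab := fun y => τ (e y), lab_injective := τ.injective.comp he,
      wit := fun _ => ∅ } with hsys
  have hbal : ∀ τ κ, (sys τ κ).Balanced := by
    intro τ κ
    refine ⟨c, fun y => ?_⟩
    rw [← hP y, ← Finset.card_map κ.toEmbedding]
    congr 1
    ext x
    simp only [hsys, Finset.mem_map_equiv, Finset.mem_filter, Finset.mem_univ, true_and,
      Equiv.apply_symm_apply]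
  have hcardN : Fintype.card (Equiv.Perm (Bits n)) = (2 ^ n).factorial := by
    rw [Fintype.card_perm, card_bits]
  have hlow : ∀ v, ∀ L ∈ heavyLeaves g a b θ v,
      (2 ^ n).factorial * (Fintype.card Ω).factorial * numExt L.1 ≤
      2 * ∑ κ : Equiv.Perm (Bits n), ∑ π : Equiv.Perm Ω, ∑ τ : Equiv.Perm (Bits n),
        if Extends ((sys τ κ).fn π) L.1 then 1 else 0 := by
    intro v L hL
    have hL' : L ∈ leaves (g v) ∅ := (Finset.mem_filter.1 hL).1
    have := numExt_le_sum_extends hP he hr (OracleAlg.card_le_of_mem_leaves _ (hg v) hL')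
    rw [card_bits] at this
    exact this
  by_contra hno
  push Not at hno
  generalize (2 ^ n).factorial = N at *
  generalize (Fintype.card Ω).factorial = M at *
  obtain ⟨H, hH⟩ : ∃ H, H = ∑ π : Equiv.Perm (Bits n),
    (Finset.univ.filter fun v => HeavySeed g a b θ π v).card := ⟨_, rfl⟩
  rw [← hH] at hno
  set X : Equiv.Perm (Bits n) → Equiv.Perm (Bits n) → ℕ := fun τ κ => ∑ π : Equiv.Perm Ω,
    (Finset.univ.filter fun v => HeavySeed g a b θ ((sys τ κ).fn π) v).card with hX
  have hup : H ≤ ∑ v, ∑ L ∈ heavyLeaves g a b θ v, numExt L.1 := by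
    rw [hH]
    refine (Finset.sum_le_sum fun (π : Equiv.Perm (Bits n)) _ =>
      card_heavySeed_le (a := a) (b := b) (θ := θ) g (⇑π)).trans (le_of_eq ?_)
    rw [Finset.sum_comm]
    refine Finset.sum_congr rfl fun v _ => ?_
    rw [Finset.sum_comm]
    refine Finset.sum_congr rfl fun L _ => ?_
    rw [numExt, Finset.card_filter]
  have htotal : N * M * H ≤ 2 * ∑ κ, ∑ τ, X τ κ := by
    calc N * M * H
        ≤ N * M * ∑ v, ∑ L ∈ heavyLeaves g a b θ v, numExt L.1 :=
          Nat.mul_le_mul_left _ hup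
      _ ≤ ∑ v, ∑ L ∈ heavyLeaves g a b θ v, 2 * ∑ κ : Equiv.Perm (Bits n), ∑ π : Equiv.Perm Ω,
            ∑ τ : Equiv.Perm (Bits n), if Extends ((sys τ κ).fn π) L.1 then 1 else 0 := by
          rw [Finset.mul_sum]
          refine Finset.sum_le_sum fun v _ => ?_
          rw [Finset.mul_sum]
          exact Finset.sum_le_sum fun L hL => hlow v L hL
      _ = 2 * ∑ κ : Equiv.Perm (Bits n), ∑ τ : Equiv.Perm (Bits n), ∑ π : Equiv.Perm Ω,
            ∑ v, ∑ L ∈ heavyLeaves g a b θ v, if Extends ((sys τ κ).fn π) L.1 then 1 else 0 := by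
          simp only [← Finset.mul_sum]
          congr 1
          rw [Finset.sum_congr rfl fun v _ => Finset.sum_comm, Finset.sum_comm]
          refine Finset.sum_congr rfl fun κ _ => ?_
          rw [Finset.sum_congr rfl fun v _ => Finset.sum_comm, Finset.sum_comm]
          rw [Finset.sum_comm (s := (Finset.univ : Finset (Equiv.Perm (Bits n))))]
          refine Finset.sum_congr rfl fun π _ => ?_
          rw [Finset.sum_congr rfl fun v _ => Finset.sum_comm, Finset.sum_comm]
      _ ≤ _ := by
          refine Nat.mul_le_mul_left _ (Finset.sum_le_sum fun κ _ => Finset.sum_le_sum fun τ _ =>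
            Finset.sum_le_sum fun π _ => ?_)
          exact sum_extends_le_card_heavySeed g _
  have hlt : ∑ κ : Equiv.Perm (Bits n), ∑ τ : Equiv.Perm (Bits n), 2 * N * X τ κ <
      ∑ κ : Equiv.Perm (Bits n), ∑ τ : Equiv.Perm (Bits n), M * H :=
    Finset.sum_lt_sum_of_nonempty Finset.univ_nonempty fun κ _ =>
      Finset.sum_lt_sum_of_nonempty Finset.univ_nonempty fun τ _ => hno (sys τ κ) (hbal τ κ)
  simp only [Finset.sum_const, Finset.card_univ, hcardN, smul_eq_mul, ← Finset.mul_sum] at hlt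
  have := Nat.mul_le_mul_left N htotal
  have e1 : N * (N * M * H) = N * (N * (M * H)) := by
    ring
  have e2 : N * (2 * ∑ κ, ∑ τ, X τ κ) = 2 * N * ∑ κ, ∑ τ, X τ κ := by ring
  omega

end Heavy

/-! ### Moments of the number of transcripts contained in a random permutation -/

section Moments
open OracleAlg (Extends)
variable {X : Type} [Fintype X] [DecidableEq X]

theorem card_powerset_card_le {Y : Type*} [DecidableEq Y] (K : Finset Y) (r : ℕ) :
    (K.powerset.filter fun S => S.card ≤ r).card ≤ (K.card + 1) ^ r := by
  have h1 : (K.powerset.filter fun S => S.card ≤ r) ⊆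
      (Finset.range (r + 1)).biUnion fun i => K.powersetCard i := by
    intro S hS
    simp only [Finset.mem_filter, Finset.mem_powerset] at hS
    exact Finset.mem_biUnion.2 ⟨S.card, Finset.mem_range.2 (by omega),
      Finset.mem_powersetCard.2 ⟨hS.1, rfl⟩⟩
  refine (Finset.card_le_card h1).trans (Finset.card_biUnion_le.trans ?_)
  rw [add_pow]
  refine Finset.sum_le_sum fun i hi => ?_
  rw [Finset.card_powersetCard, one_pow, mul_one]
  refine (Nat.choose_le_pow _ _).trans (Nat.le_mul_of_pos_right _ ?_)
  exact Nat.choose_pos (by simpa [Nat.lt_succ_iff] using hi)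

open Classical in
/-- The moments of the number of transcripts that are part of a random permutation. -/
theorem sum_extends_mul_pow_le [Nonempty X] {ι : Type*} (F : Finset ι)
    (V : ι → Finset (X × X)) {r k : ℕ} (hV : ∀ j ∈ F, (V j).card ≤ r)
    (hk : 2 * k ≤ Fintype.card X) {c : ℝ} (hc : 0 ≤ c)
    (hsum : ∀ K : Finset (X × X), K.card ≤ k →
      ∑ j ∈ F, (2 / Fintype.card X : ℝ) ^ (V j \ K).card ≤ c) (p : ℕ) :
    ∀ K : Finset (X × X), K.card + r * p ≤ k →
      ∑ τ : Equiv.Perm X, (if Extends τ K then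
        ((F.filter fun j => Extends τ (V j)).card : ℝ) ^ p else 0) ≤
      c ^ p * ((Fintype.card X).factorial * (2 / Fintype.card X : ℝ) ^ K.card) := by
  induction p with
  | zero =>
    intro K hK
    simp only [pow_zero, one_mul]
    rw [← Finset.sum_filter, Finset.sum_const, nsmul_eq_mul, mul_one]
    refine le_trans (le_of_eq ?_) (numExt_le (K := K) (by omega))
    rw [numExt]
  | succ p ih =>
    intro K hK
    -- One factor of the power is expanded and the transcript it selects joins the condition `K`.
    -- This adds at most `r` pairs, so the condition never exceeds `k` pairs.
    have h1 : ∀ τ : Equiv.Perm X, (if Extends τ K then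
        ((F.filter fun j => Extends τ (V j)).card : ℝ) ^ (p + 1) else 0) =
        ∑ j ∈ F, if Extends τ (K ∪ V j) then
          ((F.filter fun j => Extends τ (V j)).card : ℝ) ^ p else 0 := by
      intro τ
      have hE : ∀ j, Extends τ (K ∪ V j) ↔ Extends τ K ∧ Extends τ (V j) := fun j =>
        ⟨fun h => ⟨h.mono Finset.subset_union_left, h.mono Finset.subset_union_right⟩,
          fun h q hq => (Finset.mem_union.1 hq).elim (h.1 q) (h.2 q)⟩
      by_cases hτ : Extends τ K
      · simp only [hE, hτ, true_and, if_true]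
        rw [← Finset.sum_filter, Finset.sum_const, nsmul_eq_mul, pow_succ, mul_comm]
      · simp [hE, hτ]
    rw [Finset.sum_congr rfl fun τ _ => h1 τ, Finset.sum_comm]
    have h2 : ∀ j ∈ F, ∑ τ : Equiv.Perm X, (if Extends τ (K ∪ V j) then
          ((F.filter fun j => Extends τ (V j)).card : ℝ) ^ p else 0) ≤
        c ^ p * ((Fintype.card X).factorial * (2 / Fintype.card X : ℝ) ^ K.card) *
          (2 / Fintype.card X : ℝ) ^ (V j \ K).card := by
      intro j hj
      have hcard : (K ∪ V j).card = K.card + (V j \ K).card := by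
        rw [← Finset.union_sdiff_self_eq_union, Finset.card_union_of_disjoint Finset.disjoint_sdiff]
      have h3 : (V j \ K).card ≤ r := (Finset.card_le_card Finset.sdiff_subset).trans (hV j hj)
      refine (ih (K ∪ V j) (by rw [hcard]; rw [Nat.mul_succ] at hK; omega)).trans (le_of_eq ?_)
      rw [hcard, pow_add]; ring
    refine (Finset.sum_le_sum h2).trans ?_
    rw [← Finset.mul_sum]
    calc _ ≤ c ^ p * ((Fintype.card X).factorial * (2 / Fintype.card X : ℝ) ^ K.card) * c :=
          mul_le_mul_of_nonneg_left (hsum K (by omega)) (by positivity)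
      _ = _ := by ring

end Moments

/-! ### Hard instances when heavy seeds are rare -/

section Light
open scoped Classical
open OracleAlg (leaves Extends IsMatching)
variable {n m l : ℕ} (g : Bits m → OracleAlg (Bits n) (fun _ => Bits n) (Bits l)) {a b θ : ℝ}

/-- The transcripts of weight less than `θ` and output `w`. -/
def lightWit (a b θ : ℝ) (w : Bits l) : Set (Finset (Bits n × Bits n)) :=
  {W | ∃ v, (W, w) ∈ leaves (g v) ∅ ∧ refWeight g a b W w < θ}

/-- The transcripts of weight less than `θ` and output `w` which contain the label `y`. -/
noncomputable def lightLeaves (a b θ : ℝ) (y : Bits n) (w : Bits l) :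
    Finset (Bits m × (Finset (Bits n × Bits n) × Bits l)) :=
  Finset.univ.filter fun j => j.2 ∈ leaves (g j.1) ∅ ∧ j.2.2 = w ∧ refWeight g a b j.2.1 w < θ ∧
    ∃ x, (x, y) ∈ j.2.1

/-- The pairs of a transcript with a label other than `y`. -/
def dropLabel (y : Bits n) (j : Bits m × (Finset (Bits n × Bits n) × Bits l)) :
    Finset (Bits n × Bits n) :=
  j.2.1.filter fun p => p.2 ≠ y

theorem refWeight_term_nonneg (ha : 0 ≤ a) (hb : 0 ≤ b) (W : Finset (Bits n × Bits n))
    (p : Bits n × Bits n) :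
    0 ≤ (if p ∈ W then (1 : ℝ) else 0) + (a + if ∃ q ∈ W, q.2 = p.2 then b else 0) := by
  split_ifs <;> linarith

/-- Transcripts of small weight that agree with each other on `K` are few. -/
theorem sum_lightLeaves_class_le (ha : (2 : ℝ) / 2 ^ n ≤ a) (hb : 0 < b) (hθ : 0 ≤ θ) (y : Bits n)
    (w : Bits l) (K K' : Finset (Bits n × Bits n)) :
    ∑ j ∈ (lightLeaves g a b θ y w).filter (fun j => dropLabel y j ∩ K = K'),
      ((2 : ℝ) / 2 ^ n) ^ (dropLabel y j \ K).card ≤ θ / b := by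
  have ha0 : 0 ≤ a := le_trans (by positivity) ha
  set G := (lightLeaves g a b θ y w).filter (fun j => dropLabel y j ∩ K = K') with hG
  -- One member `j₀` of the class serves as reference. In its weight, a member of the class has a
  -- factor at least `b` for its pair labelled `y`, a label that `j₀` contains too; at least 1 for
  -- each pair in `K'`; and at least `a ≥ 2 / 2 ^ n` for each other pair. As `j₀` is light, the
  -- class sums to at most `θ / b`.
  rcases G.eq_empty_or_nonempty with hGe | ⟨j₀, hj₀⟩
  · rw [hGe, Finset.sum_empty]; positivity
  have hmem : ∀ j ∈ G, j.2 ∈ leaves (g j.1) ∅ ∧ j.2.2 = w ∧ refWeight g a b j.2.1 w < θ ∧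
      (∃ x, (x, y) ∈ j.2.1) ∧ dropLabel y j ∩ K = K' := by
    intro j hj
    simp only [hG, lightLeaves, Finset.mem_filter, Finset.mem_univ, true_and] at hj
    exact ⟨hj.1.1, hj.1.2.1, hj.1.2.2.1, hj.1.2.2.2, hj.2⟩
  obtain ⟨_, _, hlt, ⟨x₀, hx₀⟩, hK₀⟩ := hmem j₀ hj₀
  set ρ : Bits n × Bits n → ℝ := fun p => (if p ∈ j₀.2.1 then (1 : ℝ) else 0) +
    (a + if ∃ q ∈ j₀.2.1, q.2 = p.2 then b else 0) with hρ
  have hρ0 : ∀ p, 0 ≤ ρ p := refWeight_term_nonneg ha0 hb.le _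
  have hterm : ∀ j ∈ G, b * ((2 : ℝ) / 2 ^ n) ^ (dropLabel y j \ K).card ≤ ∏ p ∈ j.2.1, ρ p := by
    intro j hj
    obtain ⟨hL, _, _, ⟨x, hx⟩, hK⟩ := hmem j hj
    have hm := (OracleAlg.leaves_subset_isMatching _ OracleAlg.isMatching_empty hL).2
    have hins : j.2.1 = insert (x, y) (dropLabel y j) := by
      ext p
      simp only [dropLabel, Finset.mem_insert, Finset.mem_filter]
      constructor
      · intro hp
        by_cases e : p.2 = y
        · exact Or.inl (hm.2 _ hp _ hx e)
        · exact Or.inr ⟨hp, e⟩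
      · rintro (rfl | h)
        · exact hx
        · exact h.1
    have hnot : (x, y) ∉ dropLabel y j := by simp [dropLabel]
    rw [hins, Finset.prod_insert hnot, ← Finset.prod_inter_mul_prod_sdiff (dropLabel y j) K]
    have h1 : b ≤ ρ (x, y) := by
      have hex : ∃ q ∈ j₀.2.1, q.2 = (x, y).2 := ⟨_, hx₀, rfl⟩
      rw [hρ]
      dsimp only
      rw [if_pos hex]
      have : (0 : ℝ) ≤ if (x, y) ∈ j₀.2.1 then 1 else 0 := by split_ifs <;> norm_num
      linarith
    have h2 : 1 ≤ ∏ p ∈ dropLabel y j ∩ K, ρ p := by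
      rw [hK, ← hK₀]
      refine le_trans (le_of_eq (Finset.prod_const_one (s := dropLabel y j₀ ∩ K)).symm)
        (Finset.prod_le_prod (fun _ _ => zero_le_one) fun p hp => ?_)
      have hp : p ∈ j₀.2.1 := (Finset.mem_filter.1 (Finset.mem_inter.1 hp).1).1
      simp only [hρ]
      rw [if_pos hp]
      have : (0 : ℝ) ≤ if ∃ q ∈ j₀.2.1, q.2 = p.2 then b else 0 := by split_ifs <;> linarith
      linarith
    have h3 : ((2 : ℝ) / 2 ^ n) ^ (dropLabel y j \ K).card ≤ ∏ p ∈ dropLabel y j \ K, ρ p := by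
      rw [← Finset.prod_const]
      refine Finset.prod_le_prod (fun _ _ => by positivity) fun p _ => ha.trans ?_
      simp only [hρ]
      have : (0 : ℝ) ≤ if p ∈ j₀.2.1 then 1 else 0 := by split_ifs <;> norm_num
      have : (0 : ℝ) ≤ if ∃ q ∈ j₀.2.1, q.2 = p.2 then b else 0 := by split_ifs <;> linarith
      linarith
    have h4 : (0 : ℝ) ≤ ∏ p ∈ dropLabel y j \ K, ρ p := Finset.prod_nonneg fun p _ => hρ0 p
    calc _ ≤ ρ (x, y) * ∏ p ∈ dropLabel y j \ K, ρ p :=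
          mul_le_mul h1 h3 (by positivity) (hρ0 _)
      _ ≤ ρ (x, y) * ((∏ p ∈ dropLabel y j ∩ K, ρ p) * ∏ p ∈ dropLabel y j \ K, ρ p) :=
          mul_le_mul_of_nonneg_left (le_mul_of_one_le_left h4 h2) (hρ0 _)
  rw [le_div_iff₀ hb, mul_comm, Finset.mul_sum]
  refine (Finset.sum_le_sum hterm).trans (le_trans ?_ hlt.le)
  rw [refWeight]
  calc ∑ j ∈ G, ∏ p ∈ j.2.1, ρ p
      ≤ ∑ j ∈ Finset.univ.filter (fun j : Bits m × (Finset (Bits n × Bits n) × Bits l) =>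
          j.2 ∈ leaves (g j.1) ∅ ∧ j.2.2 = w), ∏ p ∈ j.2.1, ρ p := by
        refine Finset.sum_le_sum_of_subset_of_nonneg (fun j hj => ?_)
          fun j _ _ => Finset.prod_nonneg fun p _ => hρ0 p
        have := hmem j hj
        exact Finset.mem_filter.2 ⟨Finset.mem_univ _, this.1, this.2.1⟩
    _ = _ := by
        rw [Finset.sum_filter, Fintype.sum_prod_type]
        refine Finset.sum_congr rfl fun v _ => ?_
        rw [← Finset.sum_filter]
        refine Finset.sum_congr ?_ fun L _ => rfl
        ext L
        simp

/-- A class is given by a subset of `K` with at most `r` elements, and there are at most `(k + 1) ^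
r` of them. -/
theorem sum_lightLeaves_le {r k : ℕ} (hg : ∀ v f, (g v).calls f ≤ r) (ha : (2 : ℝ) / 2 ^ n ≤ a)
    (hb : 0 < b) (hθ : 0 ≤ θ) (y : Bits n) (w : Bits l) (K : Finset (Bits n × Bits n))
    (hK : K.card ≤ k) :
    ∑ j ∈ lightLeaves g a b θ y w, ((2 : ℝ) / 2 ^ n) ^ (dropLabel y j \ K).card ≤
      (k + 1) ^ r * (θ / b) := by
  rw [← Finset.sum_fiberwise_of_maps_to (g := fun j => dropLabel y j ∩ K)
    (t := K.powerset.filter fun S => S.card ≤ r)]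
  · refine (Finset.sum_le_card_nsmul _ _ _ fun K' _ =>
      sum_lightLeaves_class_le g ha hb hθ y w K K').trans ?_
    rw [nsmul_eq_mul]
    refine mul_le_mul_of_nonneg_right ?_ (by positivity)
    have h := (card_powerset_card_le K r).trans (Nat.pow_le_pow_left (Nat.succ_le_succ hK) r)
    exact_mod_cast h
  · intro j hj
    simp only [lightLeaves, Finset.mem_filter, Finset.mem_univ, true_and] at hj
    refine Finset.mem_filter.2 ⟨Finset.mem_powerset.2 Finset.inter_subset_right, ?_⟩
    refine (Finset.card_le_card (Finset.inter_subset_left.trans (Finset.filter_subset _ _))).trans ?_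
    exact OracleAlg.card_le_of_mem_leaves _ (hg j.1) hj.1

/-- A light transcript that agrees with `π` and lacks the label `y` would get the query accepted. So
critical positions come from light transcripts containing `y` whose remaining pairs hold in `π`. -/
theorem lt_card_of_risky {D : ℕ} {π : Equiv.Perm (Bits n)} {y : Bits n} {w : Bits l}
    (h : (WitnessSystem.ofPerm n (lightWit g a b θ)).Risky D π y w) :
    D < ((lightLeaves g a b θ y w).filter fun j => Extends π (dropLabel y j)).card := by
  obtain ⟨hno, hD⟩ := h
  refine hD.trans_le ((Finset.card_le_card (t := ((lightLeaves g a b θ y w).filter fun j =>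
    Extends π (dropLabel y j)).image fun j => if h : ∃ x, (x, y) ∈ j.2.1 then h.choose else y)
    fun c hc => ?_).trans Finset.card_image_le)
  simp only [WitnessSystem.critical, Finset.mem_filter, Finset.mem_univ, true_and] at hc
  obtain ⟨W, ⟨v, hv, hlt⟩, hW⟩ := hc
  have hex : ∃ x, (x, y) ∈ W := by
    by_contra hnex
    push Not at hnex
    refine hno ⟨W, ⟨v, hv, hlt⟩, fun p hp => ?_⟩
    rcases hW p hp with ⟨h1, _⟩ | ⟨h1, h2⟩
    · exact absurd (show (p.1, y) ∈ W by rw [show y = p.2 from h1.symm]; exact hp) (hnex _)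
    · exact ⟨h2, fun e => h1 (h2.symm.trans e)⟩
  refine Finset.mem_image.2 ⟨(v, (W, w)), Finset.mem_filter.2 ⟨?_, fun p hp => ?_⟩, ?_⟩
  · simp only [lightLeaves, Finset.mem_filter, Finset.mem_univ, true_and]
    exact ⟨hv, hlt, hex⟩
  · obtain ⟨hp, hne⟩ := Finset.mem_filter.1 hp
    rcases hW p hp with ⟨h1, _⟩ | ⟨_, h2⟩
    · exact absurd h1 hne
    · exact h2
  · rw [dif_pos hex]
    rcases hW _ hex.choose_spec with ⟨_, h2⟩ | ⟨h1, _⟩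
    · exact h2
    · exact absurd rfl h1

/-- Markov's inequality for the `p`-th moment of the number of light transcripts that lack only the
label `y`. -/
theorem card_risky_light_le {r k p D : ℕ} (hg : ∀ v f, (g v).calls f ≤ r)
    (ha : (2 : ℝ) / 2 ^ n ≤ a) (hb : 0 < b) (hθ : 0 ≤ θ) (hk : 2 * k ≤ 2 ^ n) (hp : r * p ≤ k)
    (hD : 0 < D) (y : Bits n) (w : Bits l) :
    ((Finset.univ.filter fun π : Equiv.Perm (Bits n) =>
      (WitnessSystem.ofPerm n (lightWit g a b θ)).Risky D π y w).card : ℝ) ≤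
      ((k + 1) ^ r * (θ / b) / D) ^ p * (2 ^ n).factorial := by
  have h := sum_extends_mul_pow_le (lightLeaves g a b θ y w) (dropLabel y) (r := r) (k := k)
    (c := (k + 1) ^ r * (θ / b)) (fun j hj => by
      simp only [lightLeaves, Finset.mem_filter, Finset.mem_univ, true_and] at hj
      exact (Finset.card_le_card (Finset.filter_subset _ _)).trans
        (OracleAlg.card_le_of_mem_leaves _ (hg j.1) hj.1)) (by rw [card_bits]; exact hk)
    (by positivity) (fun K hK => by
      have := sum_lightLeaves_le g hg ha hb hθ y w K hK
      rw [card_bits]; push_cast; exact this) p ∅ (by simpa using hp)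
  simp only [Finset.card_empty, pow_zero, mul_one, card_bits] at h
  have hD0 : (0 : ℝ) < D := by exact_mod_cast hD
  rw [div_pow, div_mul_eq_mul_div, le_div_iff₀ (by positivity)]
  refine le_trans ?_ h
  rw [← nsmul_eq_mul, ← Finset.sum_const]
  refine (Finset.sum_le_sum fun π hπ => ?_).trans (Finset.sum_le_sum_of_subset_of_nonneg
    (Finset.subset_univ _) fun π _ _ => ?_)
  · rw [if_pos (by simp [Extends])]
    refine pow_le_pow_left₀ hD0.le ?_ p
    exact_mod_cast (lt_card_of_risky g (Finset.mem_filter.1 hπ).2).le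
  · split_ifs <;> positivity

/-- If heavy seeds are rare, accepting the strings with a light transcript does not help to
invert. -/
theorem exists_of_lightSeeds {C : Type} (coins : PMF C) {r s D k p : ℕ}
    (A : C → Bits s → Bits n → OracleAlg (Bits l ⊕ Bits n) (Reply l n) (Bits n))
    (hn : 1 ≤ n) (hs1 : 1 ≤ s) (hs : ∀ ω h y B f, (A ω h y).calls (pairOracle B f) ≤ s)
    (hg : ∀ v f, (g v).calls f ≤ r) (hml : m < l)
    (ha : (2 : ℝ) / 2 ^ n ≤ a) (hb : 0 < b) (hθ : 0 ≤ θ)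
    (hlight : ∑ π : Equiv.Perm (Bits n),
      ((Finset.univ.filter fun v => HeavySeed g a b θ π v).card : ℝ) ≤
        1 / 5 * (2 ^ m * (2 ^ n).factorial))
    (hq : 64 * s ^ 2 * (2 + s * (2 * r + D + 1)) ≤ 2 ^ n)
    (hk : 2 * k ≤ 2 ^ n) (hp : r * p ≤ k) (hD : 0 < D)
    (hsmall : (2 : ℝ) ^ s * ((1 / 2) ^ (16 * s) + 4 * s * ((2 ^ n + 1) ^ s *
      ((k + 1) ^ r * (θ / b) / D) ^ p)) ≤ 1 / 50) :
    ∃ f B, IsRegularFun f ∧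
      (∀ h : Bits s, WitnessSystem.invProb coins (fun ω => A ω h) f B ≤ 1 / s) ∧
      1 / 100 ≤ adv g f B := by
  set S : WitnessSystem n l (Bits n) := WitnessSystem.ofPerm n (lightWit g a b θ) with hSdef
  have hS : S.Balanced := WitnessSystem.balanced_ofPerm _
  set β : ℝ := ((k + 1) ^ r * (θ / b) / D) ^ p with hβ
  have hβ0 : 0 ≤ β := by positivity
  have hcard : (Fintype.card (Equiv.Perm (Bits n)) : ℝ) = ((2 ^ n).factorial : ℕ) := by
    rw [Fintype.card_perm, card_bits]
  have hN0 : (0 : ℝ) < ((2 ^ n).factorial : ℕ) := by positivity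
  have hrisk := card_risky_light_le g hg ha hb hθ hk hp hD
  have hcardX : (Fintype.card (Bits n)).factorial = (2 ^ n).factorial := by rw [card_bits]
  generalize (2 ^ n).factorial = N at *
  have hfail := S.sum_invert_le hS (I := Unit) (fun _ => 1) (fun _ => zero_le_one)
    (fun _ => lightWit g a b θ) coins A hn hs1 hs (r := r) (D := D)
    (by
      rintro _ w K ⟨v, hv, _⟩
      exact OracleAlg.card_le_of_mem_leaves _ (hg _) hv)
    (by rw [card_bits]; exact hq) (β := β * (N : ℝ)) (by
      intro y w
      have := hrisk y w
      rw [Fintype.sum_unique, ← Finset.sum_filter, Finset.sum_const, nsmul_eq_mul, mul_one]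
      exact this) (by positivity)
  rw [Fintype.sum_unique, Fintype.sum_unique, hcardX, one_mul, one_mul] at hfail
  obtain ⟨π, hπ, hadv⟩ := exists_notMem_of_average (ι := Equiv.Perm (Bits n)) (fun _ => 1)
    (fun π => adv g π (S.breaker π)) (fun _ => zero_le_one) (fun π => adv_le_one _ _ _)
    (fun π => ∃ h : Bits s, 1 / (s : ℝ) <
      WitnessSystem.invProb coins (fun ω => A ω h) π (S.breaker π))
    (W := (N : ℝ)) (by
      rw [Finset.sum_const, Finset.card_univ, nsmul_eq_mul, mul_one, hcard]) hN0 (by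
      rw [← Finset.sum_filter, Finset.sum_const, nsmul_eq_mul, mul_one]
      refine hfail.trans ?_
      calc _ = (N : ℝ) * (2 ^ s * ((1 / 2) ^ (16 * s) +
            4 * s * ((2 ^ n + 1) ^ s * β))) := by ring
        _ ≤ (N : ℝ) * (1 / 50 : ℝ) := mul_le_mul_of_nonneg_left hsmall hN0.le
        _ = _ := by ring) (by
      -- A seed that is not heavy has a light transcript and is accepted. An accepted string is an
      -- actual output, as its transcript is part of `π`, so at most half of all strings are
      -- accepted. With heavy seeds of density at most 1/5 the average advantage is at least `1 / 2
      -- - 1 / 5`.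
      have key : ∀ π : Equiv.Perm (Bits n),
          1 / 2 - ((Finset.univ.filter fun v => HeavySeed g a b θ π v).card : ℝ) / 2 ^ m ≤
          1 * adv g π (S.breaker π) := by
        intro π
        rw [one_mul, adv_eq]
        have h1 : 2 ^ m ≤ (Finset.univ.filter fun v =>
              S.breaker π ((g v).run π) = true).card +
            (Finset.univ.filter fun v => HeavySeed g a b θ π v).card := by
          rw [← card_bits m, ← Finset.card_univ]
          refine (Finset.card_le_card fun v _ => ?_).trans (Finset.card_union_le _ _)
          rw [Finset.mem_union, Finset.mem_filter, Finset.mem_filter]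
          by_cases hv : HeavySeed g a b θ π v
          · exact Or.inr ⟨Finset.mem_univ _, hv⟩
          · refine Or.inl ⟨Finset.mem_univ _, decide_eq_true ?_⟩
            obtain ⟨V, hV, hfV⟩ := OracleAlg.exists_mem_leaves (g v) π.injective (W := ∅)
              (by simp [Extends])
            refine ⟨V, ⟨v, hV, ?_⟩, fun q hq => ⟨hfV q hq, by simp⟩⟩
            by_contra hge
            exact hv ⟨_, hV, hfV, not_lt.1 hge⟩
        have h2 : (Finset.univ.filter fun w => S.breaker π w = true).card ≤ 2 ^ m := by
          rw [← card_bits m, ← Finset.card_univ]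
          refine (Finset.card_le_card (t := Finset.univ.image fun v => (g v).run π)
            fun w hw => ?_).trans Finset.card_image_le
          simp only [Finset.mem_filter, Finset.mem_univ, true_and, WitnessSystem.breaker,
            decide_eq_true_eq] at hw
          obtain ⟨W, ⟨v, hv, _⟩, hW⟩ := hw
          refine Finset.mem_image.2 ⟨v, Finset.mem_univ _, ?_⟩
          exact (OracleAlg.leaves_run_calls (g v) hv OracleAlg.isMatching_empty
            (f := π) (fun q hq => (hW q hq).1)).1.symm
        have h1' : (2 : ℝ) ^ m ≤ ((Finset.univ.filter fun v =>
              S.breaker π ((g v).run π) = true).card : ℝ) +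
            ((Finset.univ.filter fun v => HeavySeed g a b θ π v).card : ℝ) := by exact_mod_cast h1
        have h2' : ((Finset.univ.filter fun w => S.breaker π w = true).card : ℝ) ≤ 2 ^ m := by
          exact_mod_cast h2
        have h3 : (2 : ℝ) ^ m * 2 ≤ 2 ^ l := by
          rw [← pow_succ]; exact pow_le_pow_right₀ (by norm_num) hml
        have h4 : ((Finset.univ.filter fun w => S.breaker π w = true).card : ℝ) / 2 ^ l ≤ 1 / 2 := by
          rw [div_le_div_iff₀ (by positivity) (by norm_num)]; linarith
        have h5 : 1 ≤ ((Finset.univ.filter fun v =>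
              S.breaker π ((g v).run π) = true).card : ℝ) / 2 ^ m +
            ((Finset.univ.filter fun v => HeavySeed g a b θ π v).card : ℝ) / 2 ^ m := by
          rw [← add_div, le_div_iff₀ (by positivity), one_mul]; exact h1'
        linarith
      refine le_trans ?_ (Finset.sum_le_sum fun π _ => key π)
      rw [Finset.sum_sub_distrib, Finset.sum_const, Finset.card_univ, nsmul_eq_mul, hcard,
        ← Finset.sum_div]
      have h6 : (∑ π : Equiv.Perm (Bits n),
          ((Finset.univ.filter fun v => HeavySeed g a b θ π v).card : ℝ)) / 2 ^ m ≤
          1 / 5 * (N : ℝ) := by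
        rw [div_le_iff₀ (by positivity)]
        refine hlight.trans (le_of_eq ?_)
        ring
      linarith)
  refine ⟨π, S.breaker π, hS.isRegularFun π, ?_, hadv⟩
  push Not at hπ
  exact hπ

end Light

/-! ### Choice of parameters and conclusion -/

/-- There are balanced maps to shorter strings. -/
theorem exists_balanced_map {n d : ℕ} (h : d ≤ n) :
    ∃ (P : Bits n → Bits d) (c : ℕ) (e : Bits d → Bits n),
      (∀ y, (Finset.univ.filter fun x => P x = y).card = c) ∧ Function.Injective e := by
  have hcard : Fintype.card (Bits n) = Fintype.card (Bits d × Bits (n - d)) := by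
    rw [Fintype.card_prod, card_bits, card_bits, card_bits, ← pow_add, Nat.add_sub_cancel' h]
  set E := Fintype.equivOfCardEq hcard
  refine ⟨fun x => (E x).1, 2 ^ (n - d), fun y => E.symm (y, fun _ => false), fun y => ?_,
    fun y y' hy => congrArg Prod.fst (E.symm.injective hy)⟩
  rw [← card_bits (n - d), ← Finset.card_univ]
  refine Finset.card_bij' (fun x _ => (E x).2) (fun z _ => E.symm (y, z)) ?_ ?_ ?_ ?_
  · simp
  · simp
  · intro x hx
    simp only [Finset.mem_filter, Finset.mem_univ, true_and] at hx
    rw [← hx]; simp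
  · simp

theorem failure_le {s : ℕ} (hs1 : 1 ≤ s) {x : ℝ} (h : (2 : ℝ) ^ s * (4 * s) * x ≤ 1 / 128) :
    (2 : ℝ) ^ s * ((1 / 2) ^ (16 * s) + 4 * s * x) ≤ 1 / 50 := by
  have h1 : (2 : ℝ) ^ s * (1 / 2) ^ (16 * s) ≤ 1 / 128 := by
    rw [pow_mul, ← mul_pow]
    refine (pow_le_of_le_one (by norm_num) (by norm_num) (by omega)).trans (by norm_num)
  calc _ = (2 : ℝ) ^ s * (1 / 2) ^ (16 * s) + 2 ^ s * (4 * s) * x := by ring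
    _ ≤ 1 / 128 + 1 / 128 := add_le_add h1 h
    _ ≤ _ := by norm_num

/-- The price of the union bound over advice, of Markov's inequality and of the union bound over
reachable queries. -/
theorem two_pow_mul_le {n s : ℕ} :
    (2 : ℝ) ^ s * (4 * s) * (2 ^ n + 1) ^ s ≤ 2 ^ (2 + 3 * s + n * s) := by
  have h1 : (s : ℝ) ≤ 2 ^ s := by exact_mod_cast Nat.lt_two_pow_self.le
  have h2 : (2 ^ n + 1 : ℝ) ≤ 2 ^ (n + 1) := by
    have : (1 : ℝ) ≤ 2 ^ n := one_le_pow₀ (by norm_num)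
    rw [pow_succ]; linarith
  calc (2 : ℝ) ^ s * (4 * s) * (2 ^ n + 1) ^ s
      ≤ (2 : ℝ) ^ s * (4 * 2 ^ s) * (2 ^ (n + 1)) ^ s := by gcongr
    _ = _ := by rw [← pow_mul]; ring

section
variable {n m l : ℕ} (g : Bits m → OracleAlg (Bits n) (fun _ => Bits n) (Bits l))
  {C : Type} (coins : PMF C) {r s : ℕ}
  (A : C → Bits s → Bits n → OracleAlg (Bits l ⊕ Bits n) (Reply l n) (Bits n))

open Classical in
-- The threshold `D = 2 ^ n / L ^ 5` keeps forbidden sets small enough. The base of the moment bound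
-- is then at most `L ^ (21 r) / 2 ^ n ≤ 2 ^ (-n / 2)`, as `L ^ (42 r) ≤ 2 ^ n`, and the moment of
-- order `4 s` yields `2 ^ (-2 n s)` against a price of `2 ^ (2 + 3 s + n s)`.
theorem exists_hard_instance_of_short_of_light {q L : ℕ} (hL : L = 2 ^ q) (hL32 : 32 ≤ L) (hsL : s ≤ L) (hs1 : 1 ≤ s)
    (hr1 : 1 ≤ r) (hrL : r ≤ L) (hLpow : ∀ j ≤ 500 * r, L ^ j ≤ 2 ^ n) (hqn : 500 * q ≤ n)
    (hn : 500 ≤ n) (hml : m < l)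
    (hs : ∀ ω h y B f, (A ω h y).calls (pairOracle B f) ≤ s)
    (hg : ∀ v f, (g v).calls f ≤ r)
    (hlight : ∑ π : Equiv.Perm (Bits n), ((Finset.univ.filter fun v => HeavySeed g
      ((L : ℝ) ^ 9 / 2 ^ n) (1 / L) (50 * (1 + 2 * (L : ℝ) ^ 9) ^ r) π v).card : ℝ) ≤
      1 / 5 * (2 ^ m * (2 ^ n).factorial)) :
    ∃ f B, IsRegularFun f ∧
      (∀ h : Bits s, WitnessSystem.invProb coins (fun ω => A ω h) f B ≤ 1 / s) ∧
      1 / 100 ≤ adv g f B := by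
  classical
  have hLR : (32 : ℝ) ≤ L := by exact_mod_cast hL32
  have hL0 : (0 : ℝ) < L := by linarith
  set a : ℝ := (L : ℝ) ^ 9 / 2 ^ n with ha
  set b : ℝ := 1 / L with hb
  set θ : ℝ := 50 * (1 + 2 * (L : ℝ) ^ 9) ^ r with hθ
  have hpow2 : (0 : ℝ) < 2 ^ n := by positivity
  have ha0 : 0 ≤ a := by positivity
  have hb0 : 0 < b := by positivity
  have hL1 : (1 : ℝ) ≤ L := by linarith
  have hθ1 : 1 ≤ θ := by
    have : (1 : ℝ) ≤ (1 + 2 * (L : ℝ) ^ 9) ^ r := one_le_pow₀ (by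
      have : (0 : ℝ) ≤ (L : ℝ) ^ 9 := by positivity
      linarith)
    rw [hθ]; linarith
  have h5n : 5 * q ≤ n := by omega
  have hD : 2 ^ (n - 5 * q) * L ^ 5 = 2 ^ n := by
    rw [hL, ← pow_mul, ← pow_add]; congr 1; omega
  refine exists_of_lightSeeds g coins A (r := r) (D := 2 ^ (n - 5 * q)) (k := r * (4 * s))
    (p := 4 * s) (by omega) hs1 hs hg hml ?_ hb0 (by linarith) hlight ?_ ?_ le_rfl (by positivity)
    (failure_le hs1 ?_)
  · rw [ha]
    refine div_le_div_of_nonneg_right ?_ hpow2.le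
    calc (2 : ℝ) ≤ L := by linarith
      _ ≤ (L : ℝ) ^ 9 := le_self_pow₀ hL1 (by norm_num)
  · set D := 2 ^ (n - 5 * q)
    have h1 : 64 * s ^ 2 * (2 + s * (2 * r + D + 1)) ≤
        64 * L ^ 2 * (2 + L * (2 * L + D + 1)) := by gcongr
    have h2 : L ^ 6 ≤ 2 ^ n := hLpow 6 (by omega)
    have h3 : 2 * (64 * L ^ 3 * D) ≤ 2 ^ n := by
      rw [← hD]
      calc 2 * (64 * L ^ 3 * D) = 128 * L ^ 3 * D := by ring
        _ ≤ (L * L) * L ^ 3 * D := by gcongr; nlinarith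
        _ = _ := by ring
    have h4 : 2 * (64 * L ^ 2 * (2 + L * (2 * L + 1))) ≤ L ^ 6 := by
      calc 2 * (64 * L ^ 2 * (2 + L * (2 * L + 1))) ≤ 2 * (64 * L ^ 2 * (4 * L ^ 2)) := by
            gcongr; nlinarith
        _ = 512 * L ^ 4 := by ring
        _ ≤ (L * L) * L ^ 4 := by gcongr; nlinarith
        _ = _ := by ring
    have h5 : 64 * L ^ 2 * (2 + L * (2 * L + D + 1)) =
        64 * L ^ 2 * (2 + L * (2 * L + 1)) + 64 * L ^ 3 * D := by ring
    rw [h5] at h1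
    exact h1.trans (by omega)
  · calc 2 * (r * (4 * s)) ≤ 2 * (L * (4 * L)) := by gcongr
      _ = 8 * L ^ 2 := by ring
      _ ≤ L * L ^ 2 := by gcongr; omega
      _ = L ^ 3 := by ring
      _ ≤ _ := hLpow 3 (by omega)
  · have hbase : (((r * (4 * s) : ℕ) : ℝ) + 1) ^ r * (θ / b) / ((2 ^ (n - 5 * q) : ℕ) : ℝ) ≤
        (L : ℝ) ^ (21 * r) / 2 ^ n := by
      have hDR : ((2 ^ (n - 5 * q) : ℕ) : ℝ) = 2 ^ n / (L : ℝ) ^ 5 := by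
        rw [eq_div_iff (by positivity)]; exact_mod_cast hD
      have h1 : (((r * (4 * s) : ℕ) : ℝ) + 1) ≤ (L : ℝ) ^ 3 := by
        have : r * (4 * s) + 1 ≤ L ^ 3 := by
          calc r * (4 * s) + 1 ≤ L * (4 * L) + 1 := by gcongr
            _ ≤ 5 * L ^ 2 := by nlinarith
            _ ≤ L * L ^ 2 := by gcongr; omega
            _ = L ^ 3 := by ring
        exact_mod_cast this
      have h2 : (1 + 2 * (L : ℝ) ^ 9) ≤ (L : ℝ) ^ 10 := by
        have : (1 : ℝ) ≤ (L : ℝ) ^ 9 := one_le_pow₀ hL1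
        have e : (L : ℝ) ^ 10 = L * (L : ℝ) ^ 9 := by ring
        rw [e]
        nlinarith
      have h3 : (50 : ℝ) ≤ (L : ℝ) ^ 2 := by nlinarith
      have h4 : θ / b = θ * L := by rw [hb]; field_simp
      rw [hDR, div_div_eq_mul_div, h4, hθ]
      refine div_le_div_of_nonneg_right ?_ hpow2.le
      calc (((r * (4 * s) : ℕ) : ℝ) + 1) ^ r * (50 * (1 + 2 * (L : ℝ) ^ 9) ^ r * L) * (L : ℝ) ^ 5
          ≤ ((L : ℝ) ^ 3) ^ r * ((L : ℝ) ^ 2 * ((L : ℝ) ^ 10) ^ r * L) * (L : ℝ) ^ 5 := by gcongr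
        _ = (L : ℝ) ^ (13 * r + 8) := by ring
        _ ≤ _ := pow_le_pow_right₀ hL1 (by omega)
    have hsq : ((L : ℝ) ^ (21 * r) / 2 ^ n) ^ 2 ≤ (1 / 2) ^ n := by
      rw [div_pow, one_div, inv_pow, ← one_div, div_le_div_iff₀ (by positivity) (by positivity),
        one_mul, pow_two ((2 : ℝ) ^ n)]
      refine mul_le_mul_of_nonneg_right ?_ (by positivity)
      rw [← pow_mul]
      exact_mod_cast hLpow (21 * r * 2) (by omega)
    have hβ : ((((r * (4 * s) : ℕ) : ℝ) + 1) ^ r * (θ / b) / ((2 ^ (n - 5 * q) : ℕ) : ℝ)) ^ (4 * s) ≤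
        ((1 / 2) ^ n) ^ (2 * s) := by
      calc _ ≤ ((L : ℝ) ^ (21 * r) / 2 ^ n) ^ (4 * s) :=
            pow_le_pow_left₀ (by positivity) hbase _
        _ = (((L : ℝ) ^ (21 * r) / 2 ^ n) ^ 2) ^ (2 * s) := by rw [← pow_mul]; ring
        _ ≤ _ := pow_le_pow_left₀ (by positivity) hsq _
    calc _ = (2 : ℝ) ^ s * (4 * s) * (2 ^ n + 1) ^ s *
          ((((r * (4 * s) : ℕ) : ℝ) + 1) ^ r * (θ / b) / ((2 ^ (n - 5 * q) : ℕ) : ℝ)) ^ (4 * s) := by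
          ring
      _ ≤ 2 ^ (2 + 3 * s + n * s) * ((1 / 2) ^ n) ^ (2 * s) :=
          mul_le_mul two_pow_mul_le hβ (by positivity) (by positivity)
      _ = 4 * (2 ^ 3 * (1 / 2) ^ n) ^ s := by
          have h2 : (2 : ℝ) ^ (n * s) * ((1 / 2) ^ n) ^ s = 1 := by
            rw [← pow_mul, ← mul_pow]; norm_num
          calc (2 : ℝ) ^ (2 + 3 * s + n * s) * ((1 / 2) ^ n) ^ (2 * s)
              = 4 * (2 ^ 3) ^ s * ((1 / 2) ^ n) ^ s * (2 ^ (n * s) * ((1 / 2) ^ n) ^ s) := by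
                rw [← pow_mul 2 3 s, pow_add, pow_add, mul_comm 2 s, pow_mul _ s 2]; ring
            _ = _ := by rw [h2, mul_one, mul_assoc, ← mul_pow]
      _ ≤ 4 * (2 ^ 3 * (1 / 2) ^ 12) := by
          refine mul_le_mul_of_nonneg_left ?_ (by norm_num)
          have h3 : (1 / 2 : ℝ) ^ n ≤ (1 / 2) ^ 12 :=
            pow_le_pow_of_le_one (by norm_num) (by norm_num) (by omega)
          refine (pow_le_of_le_one (by positivity) ?_ (by omega)).trans ?_
          · calc (2 : ℝ) ^ 3 * (1 / 2) ^ n ≤ 2 ^ 3 * (1 / 2) ^ 12 := by gcongr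
              _ ≤ 1 := by norm_num
          · gcongr
      _ ≤ _ := by norm_num

open Classical in
-- `card Ω = L ^ 10` makes `2 ^ n * a` and `card Ω * b` both equal to `L ^ 9`, which explains `θ`.
-- With `D = L ^ 5` the concentration bound needs only `256 L ^ 8 ≤ card Ω`, and `ν = L ^ 3` is
-- possible since `L ^ 4 + L ^ 3 ≤ L ^ 5 log 2`. Finally `exp (-L ^ 3)` beats the union bounds
-- because `n * s ≤ 8 L ^ 2`.
theorem exists_hard_instance_of_short_of_heavy {q L : ℕ} (hL : L = 2 ^ q) (hL32 : 32 ≤ L) (hsL : s ≤ L) (hs1 : 1 ≤ s)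
    (hr1 : 1 ≤ r) (hrL : r ≤ L) (hLpow : ∀ j ≤ 500 * r, L ^ j ≤ 2 ^ n) (hqn : 500 * q ≤ n)
    (hnL : n ≤ 8 * L) (hn : 500 ≤ n) (hml : m < l)
    (hs : ∀ ω h y B f, (A ω h y).calls (pairOracle B f) ≤ s)
    (hg : ∀ v f, (g v).calls f ≤ r)
    (hheavy : 1 / 5 * (2 ^ m * (2 ^ n).factorial) <
      ∑ π : Equiv.Perm (Bits n), ((Finset.univ.filter fun v => HeavySeed g
      ((L : ℝ) ^ 9 / 2 ^ n) (1 / L) (50 * (1 + 2 * (L : ℝ) ^ 9) ^ r) π v).card : ℝ)) :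
    ∃ f B, IsRegularFun f ∧
      (∀ h : Bits s, WitnessSystem.invProb coins (fun ω => A ω h) f B ≤ 1 / s) ∧
      1 / 100 ≤ adv g f B := by
  classical
  have hLR : (32 : ℝ) ≤ L := by exact_mod_cast hL32
  have hL0 : (0 : ℝ) < L := by linarith
  set a : ℝ := (L : ℝ) ^ 9 / 2 ^ n with ha
  set b : ℝ := 1 / L with hb
  set θ : ℝ := 50 * (1 + 2 * (L : ℝ) ^ 9) ^ r with hθ
  have hpow2 : (0 : ℝ) < 2 ^ n := by positivity
  have ha0 : 0 ≤ a := by positivity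
  have hb0 : 0 < b := by positivity
  have hL1 : (1 : ℝ) ≤ L := by linarith
  have hθ1 : 1 ≤ θ := by
    have : (1 : ℝ) ≤ (1 + 2 * (L : ℝ) ^ 9) ^ r := one_le_pow₀ (by
      have : (0 : ℝ) ≤ (L : ℝ) ^ 9 := by positivity
      linarith)
    rw [hθ]; linarith
  have hcardΩ : Fintype.card (Bits (10 * q)) = L ^ 10 := by
    rw [card_bits, hL, ← pow_mul]; congr 1; ring
  obtain ⟨P, c, e, hP, he⟩ := exists_balanced_map (n := n) (d := 10 * q) (by omega)
  obtain ⟨S₀, hS₀, hS⟩ := exists_system_heavySeeds g (a := a) (b := b) (θ := θ) hg hP he (by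
    rw [hcardΩ]
    calc 2 * r ^ 2 ≤ 2 * L ^ 2 := by gcongr
      _ ≤ L * L ^ 2 := by gcongr; omega
      _ = L ^ 3 := by ring
      _ ≤ _ := Nat.pow_le_pow_right (by omega) (by norm_num))
  refine exists_of_heavySeeds g S₀ hS₀ coins A (r := r) (D := L ^ 5) (a := a) (b := b) (θ := θ)
    (ν := (L : ℝ) ^ 3) (by omega) hs1 hs hg hml ha0 hb0 ?_ hθ1 ?_ ?_ ?_ ?_ (failure_le hs1 ?_)
  · have h1 : a ≤ 1 / 2 := by
      rw [ha, div_le_div_iff₀ hpow2 (by norm_num), one_mul]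
      have : L ^ 10 ≤ 2 ^ n := hLpow 10 (by omega)
      have h : (L : ℝ) ^ 10 ≤ 2 ^ n := by exact_mod_cast this
      calc (L : ℝ) ^ 9 * 2 ≤ (L : ℝ) ^ 9 * L := by gcongr; linarith
        _ = (L : ℝ) ^ 10 := by ring
        _ ≤ _ := h
    have h2 : b ≤ 1 / 2 := one_div_le_one_div_of_le (by norm_num) (by linarith)
    linarith
  · rw [hcardΩ, ha, hb, hθ]
    refine le_of_eq ?_
    push_cast
    congr 2
    field_simp
    ring
  · generalize (Fintype.card (Bits (10 * q))).factorial = M at *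
    have hN0 : (0 : ℝ) < ((2 ^ n).factorial : ℕ) := by positivity
    generalize (2 ^ n).factorial = N at *
    have h1 : (M : ℝ) * ∑ π : Equiv.Perm (Bits n),
        ((Finset.univ.filter fun v => HeavySeed g a b θ π v).card : ℝ) ≤
        2 * N * ∑ π : Equiv.Perm (Bits (10 * q)),
          ((Finset.univ.filter fun v => HeavySeed g a b θ (S₀.fn π) v).card : ℝ) := by
      exact_mod_cast hS
    have h2 : (M : ℝ) * (1 / 5 * (2 ^ m * N)) ≤ M * ∑ π : Equiv.Perm (Bits n),
        ((Finset.univ.filter fun v => HeavySeed g a b θ π v).card : ℝ) :=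
      mul_le_mul_of_nonneg_left hheavy.le (Nat.cast_nonneg _)
    refine le_of_mul_le_mul_left ?_ (show (0 : ℝ) < 2 * N by linarith)
    refine le_trans (le_of_eq ?_) (h2.trans h1)
    ring
  · rw [hcardΩ]
    calc 64 * s ^ 2 * (2 + s * (2 * r + L ^ 5 + 1))
        ≤ 64 * L ^ 2 * (2 + L * (2 * L + L ^ 5 + 1)) := by gcongr
      _ ≤ 64 * L ^ 2 * (L ^ 5 + L * (L ^ 5 + L ^ 5 + L ^ 5)) := by
          have h1 : L ≤ L ^ 5 := Nat.le_self_pow (by norm_num) L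
          have h2 : 2 * L ≤ L ^ 5 := by
            calc 2 * L ≤ L * L := by gcongr; omega
              _ = L ^ 2 := by ring
              _ ≤ L ^ 5 := Nat.pow_le_pow_right (by omega) (by norm_num)
          gcongr <;> omega
      _ ≤ 64 * L ^ 2 * (L * (L ^ 5) + L * (L ^ 5 + L ^ 5 + L ^ 5)) := by
          gcongr
          exact Nat.le_mul_of_pos_left _ (by omega)
      _ = 256 * L ^ 8 := by ring
      _ ≤ (L * L) * L ^ 8 := by gcongr; nlinarith
      _ = _ := by ring
  · have h1 : b⁻¹ = L := by rw [hb, one_div, inv_inv]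
    have h2 := Real.log_two_gt_d9
    rw [h1]
    push_cast
    have h3 : (0 : ℝ) < (L : ℝ) ^ 3 := by positivity
    have h4 : (L : ℝ) + 1 ≤ L ^ 2 * Real.log 2 := by nlinarith
    calc (L : ℝ) * L ^ 3 + L ^ 3 = L ^ 3 * (L + 1) := by ring
      _ ≤ L ^ 3 * (L ^ 2 * Real.log 2) := mul_le_mul_of_nonneg_left h4 h3.le
      _ = _ := by ring
  · have h1 : Real.exp (-(L : ℝ) ^ 3) ≤ (1 / 2) ^ (L ^ 3) := by
      have h2 : Real.exp (-1) ≤ 1 / 2 := by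
        have := Real.exp_neg_one_lt_d9
        linarith
      have h3 : -(L : ℝ) ^ 3 = ((L ^ 3 : ℕ) : ℝ) * (-1) := by push_cast; ring
      rw [h3, Real.exp_nat_mul]
      exact pow_le_pow_left₀ (Real.exp_pos _).le h2 _
    have h4 : 2 + 3 * s + n * s + 7 ≤ L ^ 3 := by
      calc 2 + 3 * s + n * s + 7 ≤ 2 + 3 * L + (8 * L) * L + 7 := by gcongr
        _ ≤ 32 * L ^ 2 := by nlinarith
        _ ≤ L * L ^ 2 := by gcongr
        _ = _ := by ring
    calc _ = (2 : ℝ) ^ s * (4 * s) * (2 ^ n + 1) ^ s * Real.exp (-(L : ℝ) ^ 3) := by ring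
      _ ≤ 2 ^ (2 + 3 * s + n * s) * (1 / 2) ^ (2 + 3 * s + n * s + 7) :=
          mul_le_mul two_pow_mul_le
            (h1.trans (pow_le_pow_of_le_one (by norm_num) (by norm_num) h4))
            (Real.exp_pos _).le (by positivity)
      _ = 1 / 128 := by
          rw [pow_add (1 / 2 : ℝ), ← mul_assoc, ← mul_pow]; norm_num

open Classical in
/-- The case of strings that are short compared to the security, and many generator queries. -/
theorem exists_hard_instance_of_short {q : ℕ} (hq5 : 5 ≤ q) (hs1 : 1 ≤ s) (hsL : s ≤ 2 ^ q)
    (hr1 : 1 ≤ r) (hrn : 500 * (r * q) ≤ n) (hnL : n ≤ 8 * 2 ^ q) (hml : m < l)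
    (hs : ∀ ω h y B f, (A ω h y).calls (pairOracle B f) ≤ s)
    (hg : ∀ v f, (g v).calls f ≤ r) :
    ∃ f B, IsRegularFun f ∧
      (∀ h : Bits s, WitnessSystem.invProb coins (fun ω => A ω h) f B ≤ 1 / s) ∧
      1 / 100 ≤ adv g f B := by
  classical
  obtain ⟨L, hL⟩ : ∃ L, L = 2 ^ q := ⟨_, rfl⟩
  have hL32 : 32 ≤ L := by
    rw [hL]; exact (show 32 = 2 ^ 5 by norm_num) ▸ Nat.pow_le_pow_right (by norm_num) hq5
  rw [← hL] at hsL hnL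
  have hLpow : ∀ j, j ≤ 500 * r → L ^ j ≤ 2 ^ n := by
    intro j hj
    rw [hL, ← pow_mul]
    refine Nat.pow_le_pow_right (by norm_num) (le_trans ?_ hrn)
    calc q * j ≤ q * (500 * r) := Nat.mul_le_mul_left _ hj
      _ = _ := by ring
  have hqn : 500 * q ≤ n := by nlinarith
  have hn : 500 ≤ n := by omega
  have hrL : r ≤ L := by nlinarith
  rcases le_or_gt (∑ π : Equiv.Perm (Bits n), ((Finset.univ.filter fun v => HeavySeed g
        ((L : ℝ) ^ 9 / 2 ^ n) (1 / L) (50 * (1 + 2 * (L : ℝ) ^ 9) ^ r) π v).card : ℝ))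
      (1 / 5 * (2 ^ m * (2 ^ n).factorial)) with h | h
  · exact exists_hard_instance_of_short_of_light g coins A hL hL32 hsL hs1 hr1 hrL hLpow hqn hn
      hml hs hg h
  · exact exists_hard_instance_of_short_of_heavy g coins A hL hL32 hsL hs1 hr1 hrL hLpow hqn hnL
      hn hml hs hg h

theorem cube_le_two_pow {n s : ℕ} (hn : 18 ≤ n) (hs5 : s ^ 5 ≤ 2 ^ n) :
    64 * s ^ 2 * (2 + s) ≤ 2 ^ n := by
  by_cases h : s < 14
  · calc 64 * s ^ 2 * (2 + s) ≤ 64 * 13 ^ 2 * (2 + 13) := by gcongr <;> omega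
      _ ≤ 2 ^ 18 := by norm_num
      _ ≤ _ := Nat.pow_le_pow_right (by norm_num) hn
  · push Not at h
    refine le_trans ?_ hs5
    calc 64 * s ^ 2 * (2 + s) ≤ 64 * s ^ 2 * (3 * s) := by gcongr; omega
      _ = 192 * s ^ 3 := by ring
      _ ≤ (s * s) * s ^ 3 := by gcongr; nlinarith
      _ = _ := by ring

theorem exists_hard_instance (hn : 51 ≤ n) (hs1 : 1 ≤ s) (hs5 : s ^ 5 ≤ 2 ^ n)
    (hr : 1000 * (r : ℝ) * Real.logb 2 s < n) (hml : m < l)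
    (hs : ∀ ω h y B f, (A ω h y).calls (pairOracle B f) ≤ s)
    (hg : ∀ v f, (g v).calls f ≤ r) :
    ∃ f B, IsRegularFun f ∧
      (∀ h : Bits s, WitnessSystem.invProb coins (fun ω => A ω h) f B ≤ 1 / s) ∧
      1 / 100 ≤ adv g f B := by
  classical
  have hreg : ∀ π : Equiv.Perm (Bits n), IsRegularFun π := fun π =>
    (WitnessSystem.balanced_ofPerm (l := l) fun _ => ∅).isRegularFun π
  -- The replies can be guessed, so the breaker may simply accept the range of the generator.
  by_cases hlong : 64 * (s * 2 ^ s) ^ 2 * (2 + s) ≤ 2 ^ n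
  · obtain ⟨π, hπ⟩ := WitnessSystem.exists_perm_forall_invProb_le coins A hs1 hs hlong
      fun π w => decide (∃ v, (g v).run π = w)
    refine ⟨π, _, hreg π, hπ, le_trans (by norm_num) (half_le_adv hml g π _ fun w => ?_)⟩
    simp only [decide_eq_true_eq]
  -- With `r = 0` that range is the same for all permutations and reveals nothing.
  rcases Nat.eq_zero_or_pos r with rfl | hr1
  · obtain ⟨π, hπ⟩ := WitnessSystem.exists_perm_of_no_witness coins A (by omega) hs1 hs
      (cube_le_two_pow (by omega) hs5) fun w => ∃ v, (g v).run id = w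
    refine ⟨π, _, hreg π, hπ, le_trans (by norm_num) (half_le_adv hml g π _ fun w => ?_)⟩
    have hrun : ∀ v, (g v).run π = (g v).run id := by
      intro v
      refine (OracleAlg.run_queries_congr (O := id) (g v) fun q hq => ?_).1
      have h0 : (g v).queries id = [] := by
        rw [← List.length_eq_zero_iff, OracleAlg.length_queries]
        exact Nat.le_zero.1 (hg v id)
      rw [h0] at hq
      simp at hq
    simp only [hrun]
    simp only [decide_eq_true_eq]
  · push Not at hlong
    -- With `n ≥ 51`, the failure of the guessing case forces `s > 16`, hence `q ≥ 5`; below it also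
    -- gives `n ≤ 8 s`.
    have hs16 : 16 < s := by
      by_contra h
      push Not at h
      have h1 : 64 * (s * 2 ^ s) ^ 2 * (2 + s) ≤ 64 * (16 * 2 ^ 16) ^ 2 * (2 + 16) := by
        gcongr; norm_num
      have h2 : 2 ^ 51 ≤ 2 ^ n := Nat.pow_le_pow_right (by norm_num) hn
      norm_num at h1 h2
      omega
    have hclog : s ≤ 2 ^ Nat.clog 2 s := Nat.le_pow_clog (by norm_num) s
    have hpred : 2 ^ (Nat.clog 2 s - 1) < s := Nat.pow_pred_clog_lt_self (by norm_num) (by omega)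
    set q := Nat.clog 2 s with hq
    have hq5 : 5 ≤ q := by
      by_contra h
      have : 2 ^ q ≤ 2 ^ 4 := Nat.pow_le_pow_right (by norm_num) (by omega)
      omega
    refine exists_hard_instance_of_short g coins A hq5 hs1 hclog hr1 ?_ ?_ hml hs hg
    · have h1 : ((q - 1 : ℕ) : ℝ) ≤ Real.logb 2 s := by
        rw [Real.le_logb_iff_rpow_le (by norm_num) (by exact_mod_cast hs1), Real.rpow_natCast]
        exact_mod_cast hpred.le
      -- Rounding `log s` up to `q` costs a factor of at most 2, which turns 1000 into 500.
      have h2 : (q : ℝ) / 2 ≤ ((q - 1 : ℕ) : ℝ) := by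
        rw [Nat.cast_sub (by omega)]
        have : (5 : ℝ) ≤ q := by exact_mod_cast hq5
        push_cast
        linarith
      have h3 : 1000 * (r : ℝ) * (q / 2) ≤ 1000 * (r : ℝ) * Real.logb 2 s :=
        mul_le_mul_of_nonneg_left (h2.trans h1) (by positivity)
      have h4 : ((500 * (r * q) : ℕ) : ℝ) ≤ n := by push_cast; linarith
      exact_mod_cast h4
    · refine le_trans ?_ (Nat.mul_le_mul_left 8 hclog)
      by_contra hlt
      push Not at hlt
      have h1 : s ≤ 2 ^ s := Nat.lt_two_pow_self.le
      have h2 : 2 + s ≤ 2 ^ s * 2 := by omega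
      have h3 : 64 * (s * 2 ^ s) ^ 2 * (2 + s) ≤ 64 * (2 ^ s * 2 ^ s) ^ 2 * (2 ^ s * 2) := by gcongr
      have h4 : 64 * (2 ^ s * 2 ^ s) ^ 2 * (2 ^ s * 2) = 2 ^ (5 * s + 7) := by ring
      have h5 : 2 ^ (5 * s + 7) ≤ 2 ^ n := Nat.pow_le_pow_right (by norm_num) (by omega)
      omega

/-- For the large `k` at which `r` is not small: the breaker need not succeed there, but the
reduction must still fail, since it is only required to invert infinitely often. -/
theorem exists_hard_instance_of_no_generator (hn : 18 ≤ n) (hs1 : 1 ≤ s) (hs5 : s ^ 5 ≤ 2 ^ n)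
    (hs : ∀ ω h y B f, (A ω h y).calls (pairOracle B f) ≤ s) :
    ∃ f B, IsRegularFun f ∧
      ∀ h : Bits s, WitnessSystem.invProb coins (fun ω => A ω h) f B ≤ 1 / s := by
  obtain ⟨π, hπ⟩ := WitnessSystem.exists_perm_of_no_witness coins A (by omega) hs1 hs
    (cube_le_two_pow hn hs5) fun _ => False
  exact ⟨π, _, (WitnessSystem.balanced_ofPerm (l := l) fun _ => ∅).isRegularFun π, hπ⟩

end

theorem theorem2 (n r s : ℕ → ℕ)
    (hn : Tendsto n atTop atTop)
    (hs_pos : ∀ᶠ k in atTop, 1 ≤ s k)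
    (hs_le : ∀ᶠ k in atTop, (s k : ℝ) ≤ (2 : ℝ) ^ ((n k : ℝ) / 5))
    (hr : ∃ᶠ k in atTop, 1000 * (r k : ℝ) * Real.logb 2 (s k) < n k) :
    ¬ ∃ (G : PRGConstruction n) (A : Reduction n s G.m'),
        IsNonuniformFBB s G A ∧
        ∀ (k : ℕ) (f : Bits (n k) → Bits (n k)) (v : Bits (G.m k)), (G.g k v).calls f ≤ r k := by
  rintro ⟨G, A, ⟨hcalls, hred⟩, hg⟩
  have hev : ∀ᶠ k in atTop, 51 ≤ n k ∧ 1 ≤ s k ∧ s k ^ 5 ≤ 2 ^ n k := by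
    filter_upwards [hn.eventually_ge_atTop 51, hs_pos, hs_le] with k h1 h2 h3
    refine ⟨h1, h2, ?_⟩
    have h4 : (s k : ℝ) ^ 5 ≤ ((2 : ℝ) ^ ((n k : ℝ) / 5)) ^ 5 := by gcongr
    rw [← Real.rpow_natCast ((2 : ℝ) ^ ((n k : ℝ) / 5)), ← Real.rpow_mul (by norm_num)] at h4
    have h5 : (n k : ℝ) / 5 * ((5 : ℕ) : ℝ) = n k := by push_cast; ring
    rw [h5, Real.rpow_natCast] at h4
    exact_mod_cast h4
  -- The instances are chosen independently for each `k`. At the remaining `k`, which are bounded,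
  -- any regular function will do, and the identity is taken.
  have hex : ∀ k, ∃ f B, IsRegularFun f ∧
      (51 ≤ n k ∧ 1 ≤ s k ∧ s k ^ 5 ≤ 2 ^ n k →
        (∀ h, A.invProb k f B h ≤ 1 / s k) ∧
        (1000 * (r k : ℝ) * Real.logb 2 (s k) < n k → 1 / 100 ≤ G.advantage k f B)) := by
    intro k
    by_cases hk : 51 ≤ n k ∧ 1 ≤ s k ∧ s k ^ 5 ≤ 2 ^ n k
    · by_cases hrk : 1000 * (r k : ℝ) * Real.logb 2 (s k) < n k
      · obtain ⟨f, B, h1, h2, h3⟩ := exists_hard_instance (G.g k) (A.coins k) (A.A k) hk.1 hk.2.1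
          hk.2.2 hrk (G.expands k) (hcalls k) fun v f => hg k f v
        exact ⟨f, B, h1, fun _ => ⟨h2, fun _ => h3⟩⟩
      · obtain ⟨f, B, h1, h2⟩ := exists_hard_instance_of_no_generator (A.coins k) (A.A k)
          (by omega) hk.2.1 hk.2.2 (hcalls k)
        exact ⟨f, B, h1, fun _ => ⟨h2, fun h => absurd h hrk⟩⟩
    · exact ⟨fun x => x, fun _ => false,
        (WitnessSystem.balanced_ofPerm (l := G.m' k) fun _ => ∅).isRegularFun 1,
        fun h => absurd h hk⟩
  choose f B hf hfB using hex
  obtain ⟨h, hh⟩ := hred f hf B ((hr.and_eventually hev).mono fun k hk => (hfB k hk.2).2 hk.1)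
  obtain ⟨k, hk, hk'⟩ := (hh.and_eventually hev).exists
  exact absurd hk (not_lt.2 ((hfB k hk').1 (h k)))
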